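/- **Setting.** Let $n\ge 4$, let $m=-(dy^0)^2+\sum_{I=1}^n (dy^I)^2$ be the Minkowski metric on $\mathcal N=\mathbb R\times\mathbb T^3\times\mathbb R^{n-3}$ with $\mathbb T^3=\mathbb R^3/\mathbb Z^3$, let $U\subseteq\mathbb R$ be open and let $I\subseteq U$ be an interval. Let $Y:U\times\mathbb T^3\to\mathcal N$ be a smooth timelike immersion (the induced metric $g_{\alpha\beta}=m(\partial_\alpha Y,\partial_\beta Y)$ is Lorentzian) and let $\{e_{\bar A}\}_{\bar A=4}^n$ be a smooth, not necessarily orthonormal, frame of its normal bundle. Put $m(e)_{\bar A\bar B}=m(e_{\bar A},e_{\bar B})$, and let $k^{\bar A}_{\alpha\beta}$ and $\omega^{\bar A}_{\alpha\bar B}$ be the components along $e_{\bar A}$ of the normal projections of $\partial_\alpha\partial_\beta Y$ and of $\partial_\alpha e_{\bar B}$. Here $\alpha,\beta,\gamma,\delta\in\{0,1,2,3\}$ and $x^0$ is the variable in $U$. For families $\chi,\psi$ of such components let $$(\chi\wedge\psi)^{\bar A\bar B}_{\alpha\beta\gamma\delta}=\chi^{\bar B}_{\alpha\gamma}\psi^{\bar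 A}_{\beta\delta}-\chi^{\bar A}_{\alpha\delta}\psi^{\bar B}_{\beta\gamma}.$$ Fix $\phi\in C^\infty(\mathbb R)$ with $\phi(z)=1$ for $z\le\frac32$ and $\phi(z)=0$ for $z\ge\frac74$. For $j\in\mathbb N$ let $P_j$ be the spatial Fourier multiplier on $\mathbb T^3$ (acting componentwise) with symbol $\phi(2^{-j}|\xi|)-\phi(2^{-j+1}|\xi|)$ if $j>0$, and $\phi(|\xi|)$ if $j=0$. Mixed norms $L^pL^q$ and $L^pW^{s,q}$ are $L^p$ in $x^0\in I$ of the $L^q(\mathbb T^3)$ norm of $f$, respectively of $\langle D\rangle^s f$, $\langle D\rangle=(1+|\xi|^2)^{1/2}$; norms of $k$, $\omega$, $g\cdot\partial g$ are sums over all components $k^{\bar A}_{\alpha\beta}$, $\omega^{\bar A}_{\alpha\bar B}$, $g^{\mu\nu}\partial_\kappa g_{\lambda\rho}$. **Schematic notation.** $\bar\partial$ is one of $\partial_1,\partial_2,\partial_3$ and $\partial$ one of $\partial_0,\dots,\partial_3$. An equality with a schematic right-hand side means: the left-hand side equals a finite sum of terms of the displayed types, in which * $k$ and $m(e)$ stand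 for some component, and $g\cdot\partial g\cdot k+\omega\cdot k$ for some monomial $g^{\mu\nu}\partial_\kappa g_{\lambda\rho}\,k^{\bar C}_{\sigma\tau}$ or $\omega^{\bar C}_{\alpha\bar D}\,k^{\bar E}_{\sigma\tau}$; * $\langle D\rangle^{-1}f$ stands for $\sigma_{j'}(D)f$, where $(\sigma_{j'})_{j'\in\mathbb N}$ are smooth symbols on $\mathbb R^3$ of order $-1$ uniformly in $j'$, i.e. $|\nabla^l\sigma_{j'}(\xi)|\le C_l(1+|\xi|)^{-1-l}$ for all $l\in\mathbb N$; * $\widetilde{k}$ stands for $\sigma_{j'}(D)$ applied to a component of $k$, where $\sigma_{j'}$ are smooth symbols of order $0$ uniformly in $j'$; * $(j_1,j_2)$ is one of $(j',j'+J')$, $(j'+J',j')$. The list of terms (their number, components, directions of differentiation, orderings $(j_1,j_2)$ and symbols) depends only on $n$, $\phi$, $J'$ and the free indices on the left; it does not depend on $j'$ (except through the subscript of $\sigma_{j'}$), $j_3$, $U$, $Y$, $e$. **Statement.** Let $J'\in\{-2,\dots,2\}$, $a,b\in\{1,2,3\}$, $\gamma,\delta\in\{0,1,2,3\}$, $\bar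 A,\bar B\in\{4,\dots,n\}$, and for $j'>2$ let $$W^{\bar A\bar B}_{ab\gamma\delta}=(P_{j'}k\wedge P_{j'+J'}k)^{\bar A\bar B}_{ab\gamma\delta}+(P_{j'+J'}k\wedge P_{j'}k)^{\bar A\bar B}_{ab\gamma\delta}.$$ 1. For every $j'>2$, on $U\times\mathbb T^3$, schematically, $$W^{\bar A\bar B}_{ab\gamma\delta}=\sum\Big[\bar\partial\big(P_{j_1}(\langle D\rangle^{-1}k)\cdot P_{j_2}k\big)+P_{j_1}\big(\langle D\rangle^{-1}(g\cdot\partial g\cdot k+\omega\cdot k)\big)\cdot P_{j_2}\widetilde{k}\Big].$$ 2. For every $j'>2$ and $j_3\in\mathbb N$, on $U\times\mathbb T^3$, schematically, $$\begin{aligned}\sum_{\bar A,\bar B}P_{j_3}(m(e)_{\bar A\bar B})\,W^{\bar A\bar B}_{ab\gamma\delta}=\sum\Big[&\bar\partial\partial\big\{P_{j_3}(m(e))\cdot P_{j_1}(\langle D\rangle^{-1}k)\cdot P_{j_2}(\langle D\rangle^{-1}k)\big\}\\&+\bar\partial\big\{P_{j_3}(m(e))\cdot P_{j_1}(\langle D\rangle^{-1}(g\cdot\partial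 g\cdot k+\omega\cdot k))\cdot P_{j_2}(\langle D\rangle^{-1}k)\big\}\\&+\partial\{P_{j_3}(m(e))\}\cdot P_{j_1}(\langle D\rangle^{-1}k)\cdot P_{j_2}\widetilde{k}\\&+\bar\partial\partial\{P_{j_3}(m(e))\}\cdot P_{j_1}(\langle D\rangle^{-1}k)\cdot P_{j_2}(\langle D\rangle^{-1}k)\\&+P_{j_3}(m(e))\cdot P_{j_1}(\langle D\rangle^{-1}(g\cdot\partial g\cdot k+\omega\cdot k))\cdot P_{j_2}\widetilde{k}\Big].\end{aligned}$$ If $\gamma,\delta\in\{1,2,3\}$, all derivatives $\partial$ on the right can be taken to be spatial. 3. Let $s>\frac52+\frac16$ and $0<\delta_0<\min\{\frac1{10}(s-\frac52-\frac16),\frac1{100}\}$. There is a constant $C$ depending only on $s,\delta_0,\phi$ such that for all $j'>2$ and $0\le j<j'-2$ $$\begin{aligned}\|P_jW^{\bar A\bar B}_{ab\gamma\delta}\|_{L^1L^\infty}\le C\Big[&2^{j-(1-\delta_0)j'}\|P_{j'}k\|_{L^2L^\infty}\|P_{j'+J'}k\|_{L^2L^\infty}\\&+2^{2j-(1+2\delta_0)j'}\big(\|g\cdot\partial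 g\|_{L^2L^6}+\|\omega\|_{L^2L^6}\big)\|k\|_{L^4W^{2\delta_0,4}}^2\Big].\end{aligned}$$ -/

import Mathlib

open MeasureTheory
open scoped ContDiff ENNReal NNReal

noncomputable section

namespace MinimalSurface

/-! ### Functions on `U × 𝕋³`

`𝕋³ = ℝ³ / ℤ³`.  A function on `U × 𝕋³`, `U ⊆ ℝ`, is represented by its lift: a function of
`x = (x⁰, x¹, x², x³)`, defined for `x⁰ ∈ U`, which is 1-periodic in `x¹, x², x³`. -/

abbrev Spacetime := Fin 4 → ℝ

/-- Frequency space `ℝ³` with its Euclidean norm. -/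
abbrev Freq := EuclideanSpace ℝ (Fin 3)

abbrev Field := Spacetime → ℂ

/-- The lift `{x : x⁰ ∈ U}` of `U × 𝕋³`. -/
def slab (U : Set ℝ) : Set Spacetime := {x | x 0 ∈ U}

/-- The coordinate derivative `∂_α f`. -/
def pd {E : Type*} [NormedAddCommGroup E] [NormedSpace ℝ E]
    (α : Fin 4) (f : Spacetime → E) : Spacetime → E :=
  fun x => fderiv ℝ f x (Pi.single α 1)

/-! ### Fourier multipliers in the spatial variables, Littlewood--Paley projections -/

/-- The fundamental domain `[0,1]³` of `𝕋³`. -/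
def unitCube : Set (Fin 3 → ℝ) := Set.Icc 0 1

/-- Spatial Fourier coefficient
`f̂(t, ξ) = ∫_{𝕋³} f(t, y) e^{-2πi ξ·y} dy`, `ξ ∈ ℤ³`. -/
def fourierCoef (f : Field) (t : ℝ) (ξ : Fin 3 → ℤ) : ℂ :=
  ∫ y in unitCube, f (Matrix.vecCons t y) *
    Complex.exp (-(2 * Real.pi * Complex.I * ∑ i, (ξ i : ℂ) * (y i : ℂ)))

/-- The inclusion `ℤ³ ⊆ ℝ³`. -/
def latticePoint (ξ : Fin 3 → ℤ) : Freq := WithLp.toLp 2 (fun i => (ξ i : ℝ))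

/-- The Fourier multiplier `σ(D)` acting in the spatial variables:
`σ(D) f (t, x) = ∑_{ξ ∈ ℤ³} σ(ξ) f̂(t, ξ) e^{2πi x·ξ}`. -/
def mult (σ : Freq → ℂ) (f : Field) : Field := fun x =>
  ∑' ξ : Fin 3 → ℤ, σ (latticePoint ξ) * fourierCoef f (x 0) ξ *
    Complex.exp (2 * Real.pi * Complex.I * ∑ i : Fin 3, (ξ i : ℂ) * (x i.succ : ℂ))

/-- The radial cut-off functions used to define the Littlewood--Paley projections. -/
structure IsCutoff (φ : ℝ → ℝ) : Prop where
  smooth : ContDiff ℝ ∞ φ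
  eq_one : ∀ z, z ≤ 3 / 2 → φ z = 1
  eq_zero : ∀ z, 7 / 4 ≤ z → φ z = 0

/-- `χ_j(ξ) = φ(2^{-j}|ξ|) - φ(2^{-j+1}|ξ|)` for `j > 0` and `χ_0(ξ) = φ(|ξ|)`. -/
def lpSymbol (φ : ℝ → ℝ) (j : ℕ) (ξ : Freq) : ℂ :=
  if j = 0 then ((φ ‖ξ‖ : ℝ) : ℂ)
  else ((φ (‖ξ‖ / 2 ^ j) - φ (2 * ‖ξ‖ / 2 ^ j) : ℝ) : ℂ)

/-- The Littlewood--Paley projection `P_j`. -/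
def LP (φ : ℝ → ℝ) (j : ℕ) (f : Field) : Field := mult (lpSymbol φ j) f

/-- A sequence of smooth symbols that are of order `r` uniformly in the index:
`|∇^l σ_j(ξ)| ≤ C_l (1 + |ξ|)^{r - l}` with `C_l` independent of `j`. -/
structure IsSymbolFamily (r : ℤ) (σ : ℕ → Freq → ℂ) : Prop where
  smooth : ∀ j, ContDiff ℝ ∞ (σ j)
  bound : ∀ l : ℕ, ∃ C : ℝ, ∀ (j : ℕ) (ξ : Freq),
    ‖iteratedFDeriv ℝ l (σ j) ξ‖ ≤ C * (1 + ‖ξ‖) ^ (r - (l : ℤ))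

/-! ### Mixed norms -/

/-- `‖f(t, ·)‖_{L^q(𝕋³)}`. -/
def sliceNorm (q : ℝ≥0∞) (f : Field) (t : ℝ) : ℝ≥0∞ :=
  eLpNorm (fun y : Fin 3 → ℝ => f (Matrix.vecCons t y)) q (volume.restrict unitCube)

/-- `‖f‖_{L^p L^q} = (∫_I ‖f(t, ·)‖_{L^q(𝕋³)}^p dt)^{1/p}`, for finite `p`. -/
def mixedNorm (I : Set ℝ) (p : ℝ) (q : ℝ≥0∞) (f : Field) : ℝ≥0∞ :=
  (∫⁻ t in I, sliceNorm q f t ^ p) ^ (1 / p)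

/-- `⟨D⟩^s`, the multiplier with symbol `(1 + |ξ|²)^{s/2}`. -/
def bracketPow (s : ℝ) (f : Field) : Field :=
  mult (fun ξ => (((1 + ‖ξ‖ ^ 2) ^ (s / 2) : ℝ) : ℂ)) f

/-- `‖f‖_{L^p W^{s,q}} = ‖⟨D⟩^s f‖_{L^p L^q}`. -/
def mixedSobolevNorm (I : Set ℝ) (p s : ℝ) (q : ℝ≥0∞) (f : Field) : ℝ≥0∞ :=
  mixedNorm I p q (bracketPow s f)

/-! ### Timelike immersions into `ℝ × 𝕋³ × ℝ^{n-3}`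

We write `n = d + 3`; the Cartesian coordinates of the target are indexed by `Fin (d + 4)` (the
coordinates `1, 2, 3` being those of `𝕋³`), the normal frame by `Fin d`. -/

/-- The Minkowski metric `m = -(dy⁰)² + ∑_{I=1}^n (dyᴵ)²`. -/
def mink {d : ℕ} (v w : Fin (d + 4) → ℝ) : ℝ :=
  ∑ A, (if A = 0 then -1 else 1) * v A * w A

/-- The matrix `g_{αβ} = m(∂_α Y, ∂_β Y)`. -/
def inducedMetric {d : ℕ} (Y : Spacetime → Fin (d + 4) → ℝ) (x : Spacetime) :
    Matrix (Fin 4) (Fin 4) ℝ :=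
  Matrix.of fun α β => mink (pd α Y x) (pd β Y x)

/-- Signature `(-,+,+,+)`. -/
def IsLorentzian (g : Matrix (Fin 4) (Fin 4) ℝ) : Prop :=
  ∃ P : Matrix (Fin 4) (Fin 4) ℝ, IsUnit P.det ∧
    P.transpose * g * P = Matrix.diagonal (fun α => if α = 0 then -1 else 1)

/-- A smooth timelike immersion `Y : U × 𝕋³ → ℝ × 𝕋³ × ℝ^{n-3}`, `n = d + 3`, together with a
smooth (not necessarily orthonormal) frame `e` of its normal bundle.  `Y` is given through a lift
with values in `ℝ^{n+1}`; since the target contains the factor `𝕋³`, going once around a circle of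
the domain may change the target coordinates `1, 2, 3` by integers. -/
structure FramedImmersion (d : ℕ) (U : Set ℝ) where
  Y : Spacetime → Fin (d + 4) → ℝ
  e : Fin d → Spacetime → Fin (d + 4) → ℝ
  smooth_Y : ContDiffOn ℝ ∞ Y (slab U)
  descends_Y : ∀ x ∈ slab U, ∀ i : Fin 3, ∃ p : Fin (d + 4) → ℤ,
    (∀ A, A = 0 ∨ 4 ≤ A.val → p A = 0) ∧
    ∀ A, Y (x + Pi.single i.succ 1) A = Y x A + p A
  timelike : ∀ x ∈ slab U, IsLorentzian (inducedMetric Y x)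
  smooth_e : ∀ A, ContDiffOn ℝ ∞ (e A) (slab U)
  periodic_e : ∀ A, ∀ x ∈ slab U, ∀ i : Fin 3, e A (x + Pi.single i.succ 1) = e A x
  normal : ∀ A α, ∀ x ∈ slab U, mink (e A x) (pd α Y x) = 0
  independent : ∀ x ∈ slab U, LinearIndependent ℝ (fun A => e A x)

namespace FramedImmersion

variable {d : ℕ} {U : Set ℝ} (M : FramedImmersion d U)

/-- `g_{αβ}` -/
def g (α β : Fin 4) (x : Spacetime) : ℝ := inducedMetric M.Y x α β

/-- `g^{αβ}` -/
def gInv (α β : Fin 4) (x : Spacetime) : ℝ := (inducedMetric M.Y x)⁻¹ α β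

/-- The matrix `m_{AB} = m(e_A, e_B)`. -/
def gram (x : Spacetime) : Matrix (Fin d) (Fin d) ℝ :=
  Matrix.of fun A B => mink (M.e A x) (M.e B x)

/-- The component `(Π^⊥ V)^A` along `e_A` of the orthogonal projection of `V` to the normal
space: `(Π^⊥ V)^A = m^{AC} m(e_C, V)`. -/
def normalPart (A : Fin d) (x : Spacetime) (V : Fin (d + 4) → ℝ) : ℝ :=
  ∑ C, (M.gram x)⁻¹ A C * mink (M.e C x) V

/-- The second fundamental form `k^A_{αβ} = (Π^⊥ ∂_α ∂_β Y)^A`. -/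
def k (α β : Fin 4) (A : Fin d) (x : Spacetime) : ℝ :=
  M.normalPart A x (pd α (pd β M.Y) x)

/-- The connection coefficients `ω^A_{αB} = (Π^⊥ ∂_α e_B)^A`. -/
def conn (α : Fin 4) (A B : Fin d) (x : Spacetime) : ℝ :=
  M.normalPart A x (pd α (M.e B) x)

end FramedImmersion

/-- Indices `(α, β, A)` of the components `k^A_{αβ}`. -/
abbrev KIdx (d : ℕ) := Fin 4 × Fin 4 × Fin d

/-- Indices `(A, B)` of the components `m(e)_{AB}`. -/
abbrev MIdx (d : ℕ) := Fin d × Fin d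

/-- Indices of the quadratic and cubic monomials denoted by `g·∂g·k` and `ω·k`. -/
abbrev SIdx (d : ℕ) :=
  (Fin 4 × Fin 4 × Fin 4 × Fin 4 × Fin 4 × KIdx d) ⊕ (Fin 4 × Fin d × Fin d × KIdx d)

namespace FramedImmersion

variable {d : ℕ} {U : Set ℝ} (M : FramedImmersion d U)

def kField (p : KIdx d) : Field := fun x => (M.k p.1 p.2.1 p.2.2 x : ℂ)

def mField (p : MIdx d) : Field := fun x => (M.gram x p.1 p.2 : ℂ)

def connField (α : Fin 4) (A B : Fin d) : Field := fun x => (M.conn α A B x : ℂ)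

/-- `g^{μν} ∂_κ g_{λρ}` -/
def gdgField (μ ν κ l ρ : Fin 4) : Field :=
  fun x => (M.gInv μ ν x * pd κ (M.g l ρ) x : ℝ)

/-- The components of `g·∂g·k` and `ω·k`: the monomials `g^{μν} ∂_κ g_{λρ} k_p` and
`ω^A_{αB} k_p`. -/
def sourceField : SIdx d → Field
  | .inl (μ, ν, κ, l, ρ, p) => fun x => M.gdgField μ ν κ l ρ x * M.kField p x
  | .inr (α, A, B, p) => fun x => M.connField α A B x * M.kField p x

/-- The components `(P_j k)^A_{αβ} = P_j (k^A_{αβ})`. -/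
def projK (φ : ℝ → ℝ) (j : ℕ) (α β : Fin 4) (A : Fin d) : Field :=
  LP φ j (M.kField (α, β, A))

/-- `‖P_j k‖_{L^p L^q}`, the sum over all components. -/
def projKNorm (φ : ℝ → ℝ) (I : Set ℝ) (p : ℝ) (q : ℝ≥0∞) (j : ℕ) : ℝ≥0∞ :=
  ∑ α, ∑ β, ∑ A, mixedNorm I p q (M.projK φ j α β A)

/-- `‖k‖_{L^p W^{s,q}}`. -/
def kSobolevNorm (I : Set ℝ) (p s : ℝ) (q : ℝ≥0∞) : ℝ≥0∞ :=
  ∑ α, ∑ β, ∑ A, mixedSobolevNorm I p s q (M.kField (α, β, A))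

/-- `‖ω‖_{L^p L^q}`. -/
def connNorm (I : Set ℝ) (p : ℝ) (q : ℝ≥0∞) : ℝ≥0∞ :=
  ∑ α, ∑ A, ∑ B, mixedNorm I p q (M.connField α A B)

/-- `‖g·∂g‖_{L^p L^q}`. -/
def gdgNorm (I : Set ℝ) (p : ℝ) (q : ℝ≥0∞) : ℝ≥0∞ :=
  ∑ μ, ∑ ν, ∑ κ, ∑ l, ∑ ρ, mixedNorm I p q (M.gdgField μ ν κ l ρ)

end FramedImmersion

/-- `(χ ∧ ψ)^{AB}_{αβγδ} = χ^B_{αγ} ψ^A_{βδ} - χ^A_{αδ} ψ^B_{βγ}`. -/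
def wedge {d : ℕ} (χ ψ : Fin 4 → Fin 4 → Fin d → Field)
    (A B : Fin d) (α β γ δ : Fin 4) : Field :=
  fun x => χ α γ B x * ψ β δ A x - χ α δ A x * ψ β γ B x

/-- The symmetrised high-high interaction
`(P_{j₁} k ∧ P_{j₂} k)^{AB}_{αβγδ} + (P_{j₂} k ∧ P_{j₁} k)^{AB}_{αβγδ}`. -/
def FramedImmersion.hhWedge {d : ℕ} {U : Set ℝ} (M : FramedImmersion d U) (φ : ℝ → ℝ)
    (j₁ j₂ : ℕ) (A B : Fin d) (α β γ δ : Fin 4) : Field :=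
  fun x => wedge (M.projK φ j₁) (M.projK φ j₂) A B α β γ δ x +
    wedge (M.projK φ j₂) (M.projK φ j₁) A B α β γ δ x

/-! ### Schematic expressions

`⟨D⟩^r f` in a schematic expression stands for any operator of order `r` applied to `f`; here the
operators are Fourier multipliers in the spatial variables. -/

/-- The recipe of one term
`P_{j₁}(⟨D⟩^{r₁} u) · P_{j₂}(⟨D⟩^{r₂} v)`, with `(j₁, j₂)` one of `(j', j'')`, `(j'', j')`.
It says which of the two orderings is taken (`swap`), which components of `u` and `v` occur, and
which multipliers `A j'`, `B j'` of order `r₁`, `r₂`, uniformly in `j'`, are applied to them.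
(Numerical factors are part of the multipliers.) -/
structure BiTerm (ι₁ ι₂ : Type) (r₁ r₂ : ℤ) where
  swap : Bool
  fst : ι₁
  snd : ι₂
  A : ℕ → Freq → ℂ
  B : ℕ → Freq → ℂ
  order_A : IsSymbolFamily r₁ A
  order_B : IsSymbolFamily r₂ B

def BiTerm.eval {ι₁ ι₂ : Type} {r₁ r₂ : ℤ} (τ : BiTerm ι₁ ι₂ r₁ r₂) (φ : ℝ → ℝ)
    (u : ι₁ → Field) (v : ι₂ → Field) (j' j'' : ℕ) : Field := fun x =>
  LP φ (if τ.swap then j'' else j') (mult (τ.A j') (u τ.fst)) x *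
    LP φ (if τ.swap then j' else j'') (mult (τ.B j') (v τ.snd)) x

/-- Recipe of a finite sum of terms of the form
`∂̄ (P_{j₁}(⟨D⟩⁻¹ k) · P_{j₂} k)` and `P_{j₁}(⟨D⟩⁻¹ (g·∂g·k + ω·k)) · P_{j₂} k`.
In the terms of the first kind the second factor is exactly a component of `P_{j₂} k`; in those of
the second kind a multiplier of order `0` may act on it. -/
structure OneDerivScheme (d : ℕ) where
  main : List (Fin 3 × BiTerm (KIdx d) (KIdx d) (-1) 0)
  main_snd : ∀ τ ∈ main, ∀ j ξ, τ.2.B j ξ = 1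
  err : List (BiTerm (SIdx d) (KIdx d) (-1) 0)

def OneDerivScheme.eval {d : ℕ} (S : OneDerivScheme d) {U : Set ℝ} (M : FramedImmersion d U)
    (φ : ℝ → ℝ) (j' j'' : ℕ) : Field := fun x =>
  (S.main.map fun τ => pd τ.1.succ (τ.2.eval φ M.kField M.kField j' j'') x).sum +
  (S.err.map fun τ => τ.eval φ M.sourceField M.kField j' j'' x).sum

/-- Recipe of a finite sum of terms of the forms, in this order,
* `∂̄∂ {P_{j₃}(m(e)) · P_{j₁}(⟨D⟩⁻¹ k) · P_{j₂}(⟨D⟩⁻¹ k)}`,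
* `∂̄ {P_{j₃}(m(e)) · P_{j₁}(⟨D⟩⁻¹ (g·∂g·k + ω·k)) · P_{j₂}(⟨D⟩⁻¹ k)}`,
* `∂ {P_{j₃}(m(e))} · P_{j₁}(⟨D⟩⁻¹ k) · P_{j₂} k`,
* `∂̄∂ {P_{j₃}(m(e))} · P_{j₁}(⟨D⟩⁻¹ k) · P_{j₂}(⟨D⟩⁻¹ k)`,
* `P_{j₃}(m(e)) · P_{j₁}(⟨D⟩⁻¹ (g·∂g·k + ω·k)) · P_{j₂} k`,
where a multiplier of order `0` may act on the factors `P_{j₂} k`; an entry of `Fin 3` is the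
direction of `∂̄`, an entry of `Fin 4` that of `∂`. -/
structure TwoDerivScheme (d : ℕ) where
  main : List (Fin 3 × Fin 4 × MIdx d × BiTerm (KIdx d) (KIdx d) (-1) (-1))
  derErr : List (Fin 3 × MIdx d × BiTerm (SIdx d) (KIdx d) (-1) (-1))
  dm : List (Fin 4 × MIdx d × BiTerm (KIdx d) (KIdx d) (-1) 0)
  ddm : List (Fin 3 × Fin 4 × MIdx d × BiTerm (KIdx d) (KIdx d) (-1) (-1))
  err : List (MIdx d × BiTerm (SIdx d) (KIdx d) (-1) 0)

/-- Every `∂` in the expression is a spatial derivative `∂̄`. -/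
def TwoDerivScheme.IsSpatial {d : ℕ} (S : TwoDerivScheme d) : Prop :=
  (∀ τ ∈ S.main, τ.2.1 ≠ 0) ∧ (∀ τ ∈ S.dm, τ.1 ≠ 0) ∧ (∀ τ ∈ S.ddm, τ.2.1 ≠ 0)

def TwoDerivScheme.eval {d : ℕ} (S : TwoDerivScheme d) {U : Set ℝ} (M : FramedImmersion d U)
    (φ : ℝ → ℝ) (j₃ j' j'' : ℕ) : Field := fun x =>
  (S.main.map fun (i, β, c, τ) => pd i.succ (pd β fun z =>
    LP φ j₃ (M.mField c) z * τ.eval φ M.kField M.kField j' j'' z) x).sum +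
  (S.derErr.map fun (i, c, τ) => pd i.succ (fun z =>
    LP φ j₃ (M.mField c) z * τ.eval φ M.sourceField M.kField j' j'' z) x).sum +
  (S.dm.map fun (β, c, τ) => pd β (LP φ j₃ (M.mField c)) x *
    τ.eval φ M.kField M.kField j' j'' x).sum +
  (S.ddm.map fun (i, β, c, τ) => pd i.succ (pd β (LP φ j₃ (M.mField c))) x *
    τ.eval φ M.kField M.kField j' j'' x).sum +
  (S.err.map fun (c, τ) => LP φ j₃ (M.mField c) x *
    τ.eval φ M.sourceField M.kField j' j'' x).sum

end MinimalSurface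

end

noncomputable section

namespace MinimalSurface

/-! ### Periodic functions of the spatial variables -/

/-! The source of everything is the Codazzi equation: third derivatives of `Y` commute, so ∂_c
k^A_{αγ} − ∂_α k^A_{cγ} is a combination of monomials g·∂g·k and ω·k (`codazzi_kField`). For fixed γ
and A the covector k_{·γ} is thus curl-free up to lower order. At frequencies comparable to 2^{j'}
the spatial Laplacian is invertible, and Φ_γ = ∑_i ∂_iΔ⁻¹P_j k_{iγ} satisfies P_j k_{αγ} = ∂_αΦ_γ +
E_{αγ}, where E consists of operators ∂_iΔ⁻¹, of order −1, applied to Codazzi terms (`projK_eq`).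
Only spatial derivatives are inverted, yet the identity also holds for α = 0.

One derivative. The symmetrised wedge is a sum of two null forms u_a v_b − v_a u_b with u =
P_{j₁}k^B_{·γ} and v = P_{j₂}k^A_{·δ}. Inserting u = ∂Φ + E gives ∂_a(Φ v_b) − ∂_b(Φ v_a) + Φ(∂_b
v_a − ∂_a v_b) + E_a v_b − E_b v_a (`wedge_potential`). The middle term is again a Codazzi source;
its inverse derivative sits on Φ and is moved to the source, which is free because both factors live
near frequency 2^{j'} (`BiRep.source_pot`).

Two derivatives. Since m(e) is symmetric, the contraction leaves u_{aγ}v_{bδ} + v_{aγ}u_{bδ} −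
v_{aδ}u_{bγ} − u_{aδ}v_{bγ}, with u = P_{j'}k^B and v = P_{j''}k^A, the algebraic form of the Gauss
curvature. For potentials Φ of u and Ψ of v it equals ∂_a∂_δ(Φ_bΨ_γ) + ∂_b∂_γ(Φ_aΨ_δ) −
∂_a∂_γ(Φ_bΨ_δ) − ∂_b∂_δ(Φ_aΨ_γ) modulo Codazzi terms (`TwoRep.leibniz`, `TwoRep.curvature`), and the
weight P_{j₃}m(e) is brought under the derivatives by the Leibniz rule.

Dependence of the recipes. In `BiRep`, `OneRep` and `TwoRep` the existence of the list of terms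
precedes the quantifiers over U, the immersion and the frequencies. These predicates are stable
under finite sums and changes of sign, so the algebraic identities assemble the schemes.

Estimate. The null form identity is used at each time (`exists_nullForm_le`). In the divergence
terms P_j∂ costs 2^j and Φ gains 2^{-j'}. The error terms are taken from L^{3/2} to L^∞ by
Bernstein, at cost 2^{2j}; Hölder uses 1/6 + 1/4 + 1/4 = 2/3, one inverse derivative gains 2^{-j'},
and one factor k measured in W^{2δ₀,4} gains 2^{-2δ₀j'}. Hölder in time concludes. Multiplier bounds
uniform in j come from `HasKernel`: such a σ(D) is a superposition of translations with controlled
total mass. -/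

abbrev Space := Fin 3 → ℝ

/-- Periodicity with respect to `ℤ³`. -/
def IsPeriodic {E : Type*} (v : Space → E) : Prop := ∀ y (i : Fin 3), v (y + Pi.single i 1) = v y

/-- The character `e^{2πi ξ·y}`. -/
def chr (ξ : Fin 3 → ℤ) (y : Space) : ℂ :=
  Complex.exp (2 * Real.pi * Complex.I * ∑ i, (ξ i : ℂ) * (y i : ℂ))

/-- Fourier coefficients of a function of the spatial variables. -/
def coef (v : Space → ℂ) (ξ : Fin 3 → ℤ) : ℂ := ∫ y in unitCube, v y * chr (-ξ) y

lemma chr_neg (ξ : Fin 3 → ℤ) (y : Space) :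
    chr (-ξ) y = Complex.exp (-(2 * Real.pi * Complex.I * ∑ i, (ξ i : ℂ) * (y i : ℂ))) := by
  simp [chr]

lemma fourierCoef_eq (f : Field) (t : ℝ) (ξ : Fin 3 → ℤ) :
    fourierCoef f t ξ = coef (fun y => f (Matrix.vecCons t y)) ξ := by
  simp only [fourierCoef, coef, chr_neg]

lemma mult_vecCons (σ : Freq → ℂ) (f : Field) (t : ℝ) (y : Space) :
    mult σ f (Matrix.vecCons t y) =
      ∑' ξ : Fin 3 → ℤ, σ (latticePoint ξ) * fourierCoef f t ξ * chr ξ y := by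
  simp [mult, chr]

lemma IsPeriodic.add_int {E : Type*} {v : Space → E} (hv : IsPeriodic v) (y : Space)
    (n : Fin 3 → ℤ) : v (y + fun i => (n i : ℝ)) = v y := by
  have one (i : Fin 3) (y : Space) (k : ℤ) : v (y + Pi.single i (k : ℝ)) = v y := by
    induction k using Int.induction_on generalizing y with
    | zero => simp
    | succ k ih =>
      have h := hv (y + Pi.single i (k : ℝ)) i
      rw [add_assoc, ← Pi.single_add] at h
      push_cast at ih ⊢
      rw [h, ih]
    | pred k ih =>
      rw [← ih y, ← hv (y + Pi.single i _) i, add_assoc, ← Pi.single_add]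
      push_cast; ring_nf
  have : (fun i => (n i : ℝ)) = Pi.single 0 (n 0 : ℝ) + Pi.single 1 (n 1 : ℝ)
      + Pi.single 2 (n 2 : ℝ) := by
    ext i; fin_cases i <;> simp
  rw [this, ← add_assoc, ← add_assoc, one, one, one]

/-- The projection `ℝ³ → 𝕋³`. -/
def toTorus (y : Space) : UnitAddTorus (Fin 3) := fun i => (y i : UnitAddCircle)

lemma isOpenQuotientMap_toTorus : IsOpenQuotientMap toTorus :=
  IsOpenQuotientMap.piMap (fun _ => QuotientAddGroup.isOpenQuotientMap_mk)

lemma IsPeriodic.factorsThrough {E : Type*} {v : Space → E} (hv : IsPeriodic v) :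
    Function.FactorsThrough v toTorus := by
  intro y z h
  have h' (i : Fin 3) : ∃ k : ℤ, y i = z i + k := by
    have := (QuotientAddGroup.eq_iff_sub_mem.mp (congrFun h i))
    obtain ⟨k, hk⟩ := AddSubgroup.mem_zmultiples_iff.mp this
    refine ⟨k, ?_⟩
    simp at hk
    linarith
  choose n hn using h'
  rw [show y = z + fun i => (n i : ℝ) from funext hn, hv.add_int]

-- The bridge to `UnitAddTorus`, from which Fourier inversion and the invariance of integrals are
-- imported.
lemma IsPeriodic.exists_lift {E : Type*} [Nonempty E] {v : Space → E} (hv : IsPeriodic v) :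
    ∃ F : UnitAddTorus (Fin 3) → E, ∀ y, F (toTorus y) = v y :=
  ⟨Function.extend toTorus v (fun _ => Classical.arbitrary E),
    fun y => hv.factorsThrough.extend_apply _ y⟩

lemma ioc_box_ae_eq (a : Space) :
    {x : Space | ∀ i, x i ∈ Set.Ioc (a i) (a i + 1)} =ᵐ[volume] Set.Icc a (a + 1) := by
  have := Measure.univ_pi_Ioc_ae_eq_Icc (μ := fun _ : Fin 3 => (volume : Measure ℝ))
    (f := a) (g := a + 1)
  have h : {x : Space | ∀ i, x i ∈ Set.Ioc (a i) (a i + 1)} =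
      Set.univ.pi fun i => Set.Ioc (a i) ((a + 1) i) := by
    ext x; simp [Set.mem_pi]
  rw [h]
  exact this

lemma unitCube_eq : unitCube = Set.Icc (0 : Space) (0 + 1) := by simp [unitCube]

/-- The integral of a periodic function over a unit cube does not depend on the cube. -/
lemma IsPeriodic.setLIntegral_Icc {v : Space → ℝ≥0∞} (hv : IsPeriodic v) (a : Space) :
    ∫⁻ y in Set.Icc a (a + 1), v y = ∫⁻ y in unitCube, v y := by
  obtain ⟨F, hF⟩ := hv.exists_lift
  -- Both cube integrals equal the integral of `F` over the torus, computed with base points `a` and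
  -- `0`.
  have key := (UnitAddTorus.lintegral_preimage F a).symm.trans
    (UnitAddTorus.lintegral_preimage F 0)
  rw [setLIntegral_congr (ioc_box_ae_eq a), setLIntegral_congr (ioc_box_ae_eq 0),
    ← unitCube_eq] at key
  simpa only [← hF] using! key

/-- Translation turns the unit cube into the cube based at −w, over which a periodic function has
the same integral. This is the translation invariance behind the convolution inequalities. -/
lemma IsPeriodic.setLIntegral_sub {v : Space → ℝ≥0∞} (hv : IsPeriodic v) (w : Space) :
    ∫⁻ y in unitCube, v (y - w) = ∫⁻ y in unitCube, v y := by
  rw [← hv.setLIntegral_Icc (0 - w)]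
  have := (measurePreserving_sub_right (volume : Measure Space) w).setLIntegral_comp_emb
    (MeasurableEquiv.subRight w).measurableEmbedding v (unitCube)
  rw [← this.symm]
  congr 2
  rw [unitCube_eq]
  simp [sub_eq_add_neg, add_comm]

lemma mFourier_toTorus (ξ : Fin 3 → ℤ) (y : Space) :
    UnitAddTorus.mFourier ξ (toTorus y) = chr ξ y := by
  simp only [UnitAddTorus.mFourier, ContinuousMap.coe_mk, toTorus, fourier_coe_apply, chr,
    ← Complex.exp_sum, Finset.mul_sum]
  congr 1
  refine Finset.sum_congr rfl fun i _ => ?_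
  push_cast; ring

lemma mFourierCoeff_eq_coef {v : Space → ℂ} {F : UnitAddTorus (Fin 3) → ℂ}
    (hF : ∀ y, F (toTorus y) = v y) (ξ : Fin 3 → ℤ) :
    UnitAddTorus.mFourierCoeff F ξ = coef v ξ := by
  rw [UnitAddTorus.mFourierCoeff_eq_integral F ξ 0, setIntegral_congr_set (ioc_box_ae_eq 0),
    ← unitCube_eq, coef]
  refine setIntegral_congr_fun measurableSet_Icc fun y _ => ?_
  simp only [← hF, ← mFourier_toTorus, smul_eq_mul]
  exact mul_comm _ _

/-- Fourier inversion for continuous periodic functions with summable coefficients. -/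
lemma hasSum_coef {v : Space → ℂ} (hc : Continuous v) (hv : IsPeriodic v)
    (hs : Summable (coef v)) (y : Space) : HasSum (fun ξ => coef v ξ * chr ξ y) (v y) := by
  obtain ⟨F, hF⟩ := hv.exists_lift
  have hFc : Continuous F := by
    rw [isOpenQuotientMap_toTorus.isQuotientMap.continuous_iff]
    exact hc.congr fun y => (hF y).symm
  have hco : UnitAddTorus.mFourierCoeff (⟨F, hFc⟩ : C(UnitAddTorus (Fin 3), ℂ)) = coef v :=
    funext fun ξ => mFourierCoeff_eq_coef hF ξ
  have := UnitAddTorus.hasSum_mFourier_series_apply_of_summable (f := ⟨F, hFc⟩)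
    (by rw [hco]; exact hs) (toTorus y)
  rw [hco] at this
  simpa only [mFourier_toTorus, smul_eq_mul, ContinuousMap.coe_mk, hF] using this

lemma continuous_chr (ξ : Fin 3 → ℤ) : Continuous (chr ξ) := by unfold chr; fun_prop

@[simp] lemma norm_chr (ξ : Fin 3 → ℤ) (y : Space) : ‖chr ξ y‖ = 1 := by
  rw [chr, show 2 * Real.pi * Complex.I * ∑ i, (ξ i : ℂ) * (y i : ℂ) =
    ((2 * Real.pi * ∑ i, (ξ i : ℝ) * y i : ℝ) : ℂ) * Complex.I by push_cast; ring]
  exact Complex.norm_exp_ofReal_mul_I _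

lemma isPeriodic_chr (ξ : Fin 3 → ℤ) : IsPeriodic (chr ξ) := fun y i => by
  have : toTorus (y + Pi.single i 1) = toTorus y := by
    ext k
    by_cases h : k = i
    · subst h; simp [toTorus]
    · simp [toTorus, h]
  rw [← mFourier_toTorus, ← mFourier_toTorus, this]

lemma chr_sub_right (ξ : Fin 3 → ℤ) (y z : Space) : chr ξ (y - z) = chr ξ y * chr (-ξ) z := by
  simp only [chr, ← Complex.exp_add]
  congr 1
  simp [mul_sub, Finset.sum_sub_distrib]
  ring

lemma volume_unitCube : volume unitCube = 1 := by
  simp [unitCube, Real.volume_Icc_pi]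

instance : IsProbabilityMeasure (volume.restrict unitCube : Measure Space) :=
  ⟨by simp [volume_unitCube]⟩

lemma coef_chr (η ξ : Fin 3 → ℤ) : coef (chr η) ξ = if η = ξ then 1 else 0 := by
  rw [← mFourierCoeff_eq_coef (F := UnitAddTorus.mFourier η) (mFourier_toTorus η) ξ]
  have := orthonormal_iff_ite.mp (UnitAddTorus.orthonormal_mFourier (d := Fin 3)) ξ η
  simp only [UnitAddTorus.mFourierLp, ContinuousMap.inner_toLp] at this
  rw [UnitAddTorus.mFourierCoeff]
  simp only [UnitAddTorus.mFourier_neg, smul_eq_mul, eq_comm (a := η)]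
  rw [← this]
  congr 1; ext t; ring

/-- The coefficients of an absolutely convergent Fourier series. -/
lemma coef_tsum {c : (Fin 3 → ℤ) → ℂ} (hc : Summable c) (ξ : Fin 3 → ℤ) :
    coef (fun y => ∑' η, c η * chr η y) ξ = c ξ := by
  have h1 : coef (fun y => ∑' η, c η * chr η y) ξ =
      ∑' η, ∫ y in unitCube, c η * chr η y * chr (-ξ) y := by
    rw [coef]
    simp only [← tsum_mul_right]
    refine (integral_tsum_of_summable_integral_norm (fun η => ?_) ?_).symm
    · exact ((continuous_const.mul (continuous_chr η)).mul (continuous_chr _)).continuousOn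
        |>.integrableOn_compact isCompact_Icc
    · simpa using hc.norm
  have h2 (η : Fin 3 → ℤ) : ∫ y in unitCube, c η * chr η y * chr (-ξ) y =
      if η = ξ then c ξ else 0 := by
    simp only [mul_assoc]
    rw [integral_const_mul]
    have := coef_chr η ξ
    rw [coef] at this
    rw [this]
    split_ifs with h <;> simp [h]
  rw [h1]
  simp only [h2]
  exact tsum_ite_eq ξ _

end MinimalSurface
end

noncomputable section

namespace MinimalSurface

open Filter Topology

/-! ### Smooth functions on `U × 𝕋³` -/

/-- Smooth functions on `U × 𝕋³`. -/
structure SmoothPer {E : Type*} [NormedAddCommGroup E] [NormedSpace ℝ E] (U : Set ℝ)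
    (f : Spacetime → E) : Prop where
  smooth : ContDiffOn ℝ ∞ f (slab U)
  periodic : ∀ x ∈ slab U, ∀ i : Fin 3, f (x + Pi.single i.succ 1) = f x

section SmoothPer

variable {E : Type*} [NormedAddCommGroup E] [NormedSpace ℝ E] {U : Set ℝ}

lemma isOpen_slab (hU : IsOpen U) : IsOpen (slab U) := hU.preimage (continuous_apply 0)

@[simp] lemma vecCons_mem_slab {t : ℝ} {y : Space} : Matrix.vecCons t y ∈ slab U ↔ t ∈ U := by
  simp [slab]

lemma add_single_mem_slab {x : Spacetime} (hx : x ∈ slab U) (i : Fin 3) :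
    x + Pi.single i.succ 1 ∈ slab U := by
  simpa [slab] using hx

lemma slab_mem_nhds (hU : IsOpen U) {x : Spacetime} (hx : x ∈ slab U) : slab U ∈ 𝓝 x :=
  (isOpen_slab hU).mem_nhds hx

lemma continuous_vecCons : Continuous fun p : ℝ × Space => Matrix.vecCons p.1 p.2 := by
  refine continuous_pi fun i => ?_
  refine Fin.cases ?_ (fun k => ?_) i
  · simpa using continuous_fst
  · simp only [Matrix.cons_val_succ]; fun_prop

lemma vecCons_eta (x : Spacetime) : Matrix.vecCons (x 0) (fun i : Fin 3 => x i.succ) = x := by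
  ext i; refine Fin.cases ?_ (fun k => ?_) i <;> simp

lemma vecCons_add_single (t : ℝ) (y : Space) (i : Fin 3) :
    Matrix.vecCons t (y + Pi.single i 1) = Matrix.vecCons t y + Pi.single i.succ 1 := by
  ext k; refine Fin.cases ?_ (fun k => ?_) k
  · simp
  · simp [Pi.single_apply]

lemma pd_congr (hU : IsOpen U) {f g : Spacetime → E} (h : Set.EqOn f g (slab U)) (α : Fin 4) :
    Set.EqOn (pd α f) (pd α g) (slab U) := fun x hx => by
  have : f =ᶠ[𝓝 x] g := Filter.eventuallyEq_of_mem (slab_mem_nhds hU hx) h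
  simp only [pd, this.fderiv_eq]

namespace SmoothPer

variable {f g : Spacetime → E}

lemma congr (hf : SmoothPer U f) (h : Set.EqOn g f (slab U)) : SmoothPer U g where
  smooth := hf.smooth.congr h
  periodic x hx i := by
    rw [h hx, h (add_single_mem_slab hx i), hf.periodic x hx]

lemma differentiableAt (hf : SmoothPer U f) (hU : IsOpen U) {x : Spacetime} (hx : x ∈ slab U) :
    DifferentiableAt ℝ f x :=
  (hf.smooth.contDiffAt (slab_mem_nhds hU hx)).differentiableAt (by simp)

lemma pd (hf : SmoothPer U f) (hU : IsOpen U) (α : Fin 4) : SmoothPer U (pd α f) where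
  smooth := (hf.smooth.fderiv_of_isOpen (isOpen_slab hU) (m := ∞) (by simp)).clm_apply
    contDiffOn_const
  periodic x hx i := by
    have : (fun z => f (z + Pi.single i.succ 1)) =ᶠ[𝓝 x] f :=
      Filter.eventuallyEq_of_mem (slab_mem_nhds hU hx) fun z hz => hf.periodic z hz i
    simp only [MinimalSurface.pd]
    rw [← this.fderiv_eq, fderiv_comp_add_right]

lemma add (hf : SmoothPer U f) (hg : SmoothPer U g) : SmoothPer U fun x => f x + g x where
  smooth := hf.smooth.add hg.smooth
  periodic x hx i := by rw [hf.periodic x hx, hg.periodic x hx]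

lemma sub (hf : SmoothPer U f) (hg : SmoothPer U g) : SmoothPer U fun x => f x - g x where
  smooth := hf.smooth.sub hg.smooth
  periodic x hx i := by rw [hf.periodic x hx, hg.periodic x hx]

lemma const (c : E) : SmoothPer U fun _ => c where
  smooth := contDiffOn_const
  periodic _ _ _ := rfl

lemma sum {ι : Type*} {s : Finset ι} {f : ι → Spacetime → E} (hf : ∀ i ∈ s, SmoothPer U (f i)) :
    SmoothPer U fun x => ∑ i ∈ s, f i x where
  smooth := ContDiffOn.sum fun i hi => (hf i hi).smooth
  periodic x hx k := Finset.sum_congr rfl fun i hi => (hf i hi).periodic x hx k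

lemma mul {A : Type*} [NormedRing A] [NormedAlgebra ℝ A] {f g : Spacetime → A}
    (hf : SmoothPer U f) (hg : SmoothPer U g) : SmoothPer U fun x => f x * g x where
  smooth := hf.smooth.mul hg.smooth
  periodic x hx i := by rw [hf.periodic x hx, hg.periodic x hx]

lemma prod {ι : Type*} {s : Finset ι} {f : ι → Spacetime → ℝ}
    (hf : ∀ i ∈ s, SmoothPer U (f i)) : SmoothPer U fun x => ∏ i ∈ s, f i x where
  smooth := contDiffOn_prod fun i hi => (hf i hi).smooth
  periodic x hx k := Finset.prod_congr rfl fun i hi => (hf i hi).periodic x hx k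

lemma inv {f : Spacetime → ℝ} (hf : SmoothPer U f) (h0 : ∀ x ∈ slab U, f x ≠ 0) :
    SmoothPer U fun x => (f x)⁻¹ where
  smooth := hf.smooth.inv h0
  periodic x hx i := by rw [hf.periodic x hx]

lemma ofReal {f : Spacetime → ℝ} (hf : SmoothPer U f) : SmoothPer U fun x => (f x : ℂ) where
  smooth := Complex.ofRealCLM.contDiff.comp_contDiffOn hf.smooth
  periodic x hx i := by rw [hf.periodic x hx]

lemma apply {ι : Type*} [Fintype ι] {f : Spacetime → ι → ℝ} (hf : SmoothPer U f) (i : ι) :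
    SmoothPer U fun x => f x i where
  smooth := contDiffOn_pi.mp hf.smooth i
  periodic x hx k := by rw [hf.periodic x hx]

lemma continuousOn (hf : SmoothPer U f) : ContinuousOn f (slab U) := hf.smooth.continuousOn

end SmoothPer

/-- Continuous functions on `U × 𝕋³`. -/
structure ContPer {E : Type*} [TopologicalSpace E] (U : Set ℝ) (f : Spacetime → E) : Prop where
  continuousOn : ContinuousOn f (slab U)
  periodic : ∀ x ∈ slab U, ∀ i : Fin 3, f (x + Pi.single i.succ 1) = f x

lemma SmoothPer.contPer {f : Spacetime → E} (hf : SmoothPer U f) : ContPer U f :=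
  ⟨hf.continuousOn, hf.periodic⟩

namespace ContPer

variable {E : Type*} [NormedAddCommGroup E] {f : Spacetime → E}

lemma slice_continuous (hf : ContPer U f) {t : ℝ} (ht : t ∈ U) :
    Continuous fun y : Space => f (Matrix.vecCons t y) := by
  rw [← continuousOn_univ]
  refine hf.continuousOn.comp (Continuous.continuousOn ?_) fun y _ => by simpa
  exact continuous_vecCons.comp (by fun_prop : Continuous fun y : Space => (t, y))

lemma slice_periodic (hf : ContPer U f) {t : ℝ} (ht : t ∈ U) :
    IsPeriodic fun y : Space => f (Matrix.vecCons t y) := fun y i => by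
  simp only [vecCons_add_single]
  exact hf.periodic _ (by simpa) i

lemma continuousOn_prod (hf : ContPer U f) :
    ContinuousOn (fun p : ℝ × Space => f (Matrix.vecCons p.1 p.2)) (U ×ˢ Set.univ) :=
  hf.continuousOn.comp continuous_vecCons.continuousOn fun p hp => by simpa using hp.1

/-- Compactness of a closed time interval times the cube. Uniformity in time near t₀ is what permits
differentiation under the integral and locally uniform decay of Fourier coefficients. -/
lemma exists_bound (hf : ContPer U f) (hU : IsOpen U) {t₀ : ℝ} (ht : t₀ ∈ U) :
    ∃ C : ℝ, ∃ ε > 0, Metric.ball t₀ ε ⊆ U ∧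
      ∀ t ∈ Metric.ball t₀ ε, ∀ y ∈ unitCube, ‖f (Matrix.vecCons t y)‖ ≤ C := by
  obtain ⟨ε, hε, hεU⟩ := Metric.nhds_basis_closedBall.mem_iff.mp (hU.mem_nhds ht)
  obtain ⟨C, hC⟩ := ((isCompact_closedBall t₀ ε).prod
    (isCompact_Icc (a := (0 : Space)) (b := 1))).exists_bound_of_continuousOn
    (hf.continuousOn_prod.mono (Set.prod_mono hεU (Set.subset_univ _)))
  exact ⟨C, ε, hε, Metric.ball_subset_closedBall.trans hεU, fun t ht y hy =>
    hC (t, y) ⟨Metric.ball_subset_closedBall ht, hy⟩⟩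

end ContPer

lemma hasFDerivAt_slice (hU : IsOpen U) {f : Spacetime → E} (hf : SmoothPer U f) {t : ℝ}
    (ht : t ∈ U) (y : Space) : ∃ L : Space →L[ℝ] E,
      HasFDerivAt (fun y => f (Matrix.vecCons t y)) L y ∧
      ∀ i, L (Pi.single i 1) = pd i.succ f (Matrix.vecCons t y) := by
  have h1 : HasFDerivAt (fun y : Space => (Matrix.vecCons t y : Spacetime))
      (ContinuousLinearMap.pi (Fin.cases (motive := fun _ => Space →L[ℝ] ℝ) 0 fun k =>
        ContinuousLinearMap.proj (R := ℝ) (φ := fun _ : Fin 3 => ℝ) k)) y := by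
    rw [hasFDerivAt_pi]
    intro i
    refine Fin.cases ?_ (fun k => ?_) i
    · simpa using hasFDerivAt_const t y
    · simpa using! (ContinuousLinearMap.proj (R := ℝ) (φ := fun _ : Fin 3 => ℝ) k).hasFDerivAt
  have h2 := (hf.differentiableAt hU (x := Matrix.vecCons t y) (by simpa)).hasFDerivAt
  refine ⟨_, h2.comp y h1, fun i => ?_⟩
  simp only [ContinuousLinearMap.comp_apply, pd]
  congr 1
  ext k
  refine Fin.cases ?_ (fun k => ?_) k
  · simp
  · simp [Pi.single_apply]

lemma hasDerivAt_time (hU : IsOpen U) {f : Spacetime → E} (hf : SmoothPer U f) {t : ℝ}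
    (ht : t ∈ U) (y : Space) :
    HasDerivAt (fun t => f (Matrix.vecCons t y)) (pd 0 f (Matrix.vecCons t y)) t := by
  have h1 : HasDerivAt (fun t : ℝ => (Matrix.vecCons t y : Spacetime)) (Pi.single 0 1) t := by
    rw [hasDerivAt_pi]
    intro i
    refine Fin.cases ?_ (fun k => ?_) i
    · simpa using hasDerivAt_id' t
    · simpa using hasDerivAt_const t (y k)
  exact (hf.differentiableAt hU (x := Matrix.vecCons t y) (by simpa)).hasFDerivAt.comp_hasDerivAt
    t h1

end SmoothPer

/-! ### Fourier coefficients of smooth functions -/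

section Coef

variable {U : Set ℝ}

lemma norm_coef_le {v : Space → ℂ} {C : ℝ} (hv : ∀ y ∈ unitCube, ‖v y‖ ≤ C) (ξ : Fin 3 → ℤ) :
    ‖coef v ξ‖ ≤ C := by
  have := norm_setIntegral_le_of_norm_le_const (μ := volume) (s := unitCube)
    (f := fun y => v y * chr (-ξ) y) (C := C) (by simp [volume_unitCube])
    (fun y hy => by simpa using hv y hy)
  simpa [coef, measureReal_def, volume_unitCube] using this

lemma coef_add {v w : Space → ℂ} (hv : Continuous v) (hw : Continuous w) (ξ : Fin 3 → ℤ) :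
    coef (fun y => v y + w y) ξ = coef v ξ + coef w ξ := by
  simp only [coef, add_mul]
  exact integral_add
    ((hv.mul (continuous_chr _)).continuousOn.integrableOn_compact isCompact_Icc)
    ((hw.mul (continuous_chr _)).continuousOn.integrableOn_compact isCompact_Icc)

lemma coef_const_mul (c : ℂ) (v : Space → ℂ) (ξ : Fin 3 → ℤ) :
    coef (fun y => c * v y) ξ = c * coef v ξ := by
  simp only [coef, mul_assoc, integral_const_mul]

lemma coef_sum {ι : Type*} {s : Finset ι} {v : ι → Space → ℂ} (hv : ∀ i ∈ s, Continuous (v i))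
    (ξ : Fin 3 → ℤ) : coef (fun y => ∑ i ∈ s, v i y) ξ = ∑ i ∈ s, coef (v i) ξ := by
  simp only [coef, Finset.sum_mul]
  exact integral_finsetSum _ fun i hi =>
    (((hv i hi).mul (continuous_chr _)).continuousOn.integrableOn_compact isCompact_Icc)

/-- The divergence theorem on the cube for the vector field v·e_i: the contributions of opposite
faces cancel by periodicity. -/
lemma integral_deriv_eq_zero {v : Space → ℂ} (hp : IsPeriodic v) {v' : Space → Space →L[ℝ] ℂ}
    (hd : ∀ y, HasFDerivAt v (v' y) y) (i : Fin 3)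
    (hc : Continuous fun y => v' y (Pi.single i 1)) :
    ∫ y in unitCube, v' y (Pi.single i 1) = 0 := by
  have hcv : Continuous v := continuous_iff_continuousAt.mpr fun y => (hd y).continuousAt
  have hs (y : Space) : ∑ k : Fin 3, (ContinuousLinearMap.single ℝ (fun _ : Fin 3 => ℂ) i
      ∘L v' y) (Pi.single k 1) k = v' y (Pi.single i 1) := by
    rw [Finset.sum_eq_single i]
    · simp
    · intro k _ hk; simp [hk]
    · simp
  have := integral_divergence_of_hasFDerivAt_off_countable (0 : Space) 1 zero_le_one
    (fun y => Pi.single i (v y))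
    (fun y => ContinuousLinearMap.single ℝ (fun _ : Fin 3 => ℂ) i ∘L v' y) ∅ Set.countable_empty
    (by
      have : Continuous fun y => (Pi.single i (v y) : Fin 3 → ℂ) :=
        (ContinuousLinearMap.single ℝ (fun _ : Fin 3 => ℂ) i).continuous.comp hcv
      exact this.continuousOn)
    (fun y _ => (ContinuousLinearMap.single ℝ (fun _ : Fin 3 => ℂ) i).hasFDerivAt.comp y (hd y))
    (by simp only [hs]; exact hc.continuousOn.integrableOn_compact isCompact_Icc)
  simp only [hs] at this
  rw [unitCube, this]
  refine Finset.sum_eq_zero fun k _ => ?_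
  rw [sub_eq_zero]
  congr 1
  ext x
  by_cases hk : k = i
  · subst hk
    simp only [Pi.single_eq_same, Pi.zero_apply, Pi.one_apply]
    rw [← hp (k.insertNth 0 x) k]
    congr 1
    ext l
    refine Fin.succAboveCases k ?_ (fun l => ?_) l <;> simp
  · simp [hk]

lemma hasFDerivAt_chr (ξ : Fin 3 → ℤ) (y : Space) : ∃ L : Space →L[ℝ] ℂ,
    HasFDerivAt (chr ξ) L y ∧
      ∀ i, L (Pi.single i 1) = 2 * Real.pi * Complex.I * ξ i * chr ξ y := by
  have h1 : HasFDerivAt (fun y : Space => 2 * Real.pi * Complex.I * ∑ i, (ξ i : ℂ) * (y i : ℂ))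
      (∑ i, (2 * Real.pi * Complex.I * ξ i) • (Complex.ofRealCLM ∘L
        ContinuousLinearMap.proj (R := ℝ) (φ := fun _ : Fin 3 => ℝ) i)) y := by
    simp only [Finset.mul_sum, ← mul_assoc]
    refine HasFDerivAt.fun_sum fun i _ => ?_
    exact ((Complex.ofRealCLM ∘L ContinuousLinearMap.proj (R := ℝ)
      (φ := fun _ : Fin 3 => ℝ) i).hasFDerivAt (x := y)).const_mul _
  refine ⟨_, h1.cexp, fun i => ?_⟩
  have : ∑ x, 2 * Real.pi * Complex.I * ξ x * ((Pi.single i 1 : Space) x : ℂ) =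
      2 * Real.pi * Complex.I * ξ i := by
    rw [Finset.sum_eq_single i]
    · simp
    · intro k _ hk; simp [hk]
    · simp
  simp only [chr, FunLike.coe_smul, Pi.smul_apply, FunLike.coe_sum, Finset.sum_apply,
    ContinuousLinearMap.comp_apply, ContinuousLinearMap.proj_apply, Complex.ofRealCLM_apply,
    smul_eq_mul]
  rw [this, mul_comm]

/-- Integration by parts: the product of f with a character is periodic, so its i-th derivative has
mean zero. -/
lemma fourierCoef_pd_succ (hU : IsOpen U) {f : Field} (hf : SmoothPer U f) {t : ℝ} (ht : t ∈ U)
    (i : Fin 3) (ξ : Fin 3 → ℤ) : fourierCoef (pd i.succ f) t ξ =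
      2 * Real.pi * Complex.I * ξ i * fourierCoef f t ξ := by
  choose L hL hL' using hasFDerivAt_slice hU hf ht
  choose M hM hM' using hasFDerivAt_chr (-ξ)
  have hv (y : Space) := (hL y).mul (hM y)
  have hc := (hf.contPer.slice_continuous ht)
  have hc' := ((hf.pd hU i.succ).contPer.slice_continuous ht)
  have e1 (y : Space) : (f (Matrix.vecCons t y) • M y + chr (-ξ) y • L y) (Pi.single i 1) =
      pd i.succ f (Matrix.vecCons t y) * chr (-ξ) y -
        (2 * Real.pi * Complex.I * ξ i) * (f (Matrix.vecCons t y) * chr (-ξ) y) := by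
    simp [hM', hL']; ring
  have := integral_deriv_eq_zero (v := fun y => f (Matrix.vecCons t y) * chr (-ξ) y)
    (fun y k => by
      simp only [hf.contPer.slice_periodic ht y k, isPeriodic_chr (-ξ) y k]) hv i
    (by
      simp only [e1]
      exact (hc'.mul (continuous_chr _)).sub
        (continuous_const.mul (hc.mul (continuous_chr _))))
  simp only [e1] at this
  have i1 : IntegrableOn (fun y => pd i.succ f (Matrix.vecCons t y) * chr (-ξ) y) unitCube :=
    (hc'.mul (continuous_chr _)).continuousOn.integrableOn_compact isCompact_Icc
  have i2 : IntegrableOn (fun y => (2 * Real.pi * Complex.I * ξ i) *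
      (f (Matrix.vecCons t y) * chr (-ξ) y)) unitCube :=
    (continuous_const.mul (hc.mul (continuous_chr _))).continuousOn.integrableOn_compact
      isCompact_Icc
  rw [integral_sub i1 i2, integral_const_mul, sub_eq_zero] at this
  simpa only [fourierCoef_eq, coef] using this

lemma hasDerivAt_fourierCoef (hU : IsOpen U) {f : Field} (hf : SmoothPer U f) {t : ℝ}
    (ht : t ∈ U) (ξ : Fin 3 → ℤ) :
    HasDerivAt (fun t => fourierCoef f t ξ) (fourierCoef (pd 0 f) t ξ) t := by
  obtain ⟨C, ε, hε, hεU, hC⟩ := (hf.pd hU 0).contPer.exists_bound hU ht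
  simp only [fourierCoef_eq, coef]
  have cont {g : Field} (hg : SmoothPer U g) {s : ℝ} (hs : s ∈ U) :
      Continuous fun y => g (Matrix.vecCons s y) * chr (-ξ) y :=
    (hg.contPer.slice_continuous hs).mul (continuous_chr _)
  refine (hasDerivAt_integral_of_dominated_loc_of_deriv_le (Metric.ball_mem_nhds t hε)
    (F := fun t y => f (Matrix.vecCons t y) * chr (-ξ) y)
    (F' := fun t y => pd 0 f (Matrix.vecCons t y) * chr (-ξ) y) (bound := fun _ => C)
    ?_ ?_ ?_ ?_ ?_ ?_).2
  · filter_upwards [hU.mem_nhds ht] with s hs using (cont hf hs).aestronglyMeasurable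
  · exact (cont hf ht).continuousOn.integrableOn_compact isCompact_Icc
  · exact (cont (hf.pd hU 0) ht).aestronglyMeasurable
  · refine ae_restrict_of_forall_mem measurableSet_Icc fun y hy s hs => ?_
    simpa using hC s hs y hy
  · exact integrable_const C
  · exact ae_of_all _ fun y s hs => (hasDerivAt_time hU hf (hεU hs) y).mul_const _

/-- Induction on the order of differentiability: the time derivative of a coefficient of f is the
same coefficient of `pd 0 f`, which is again smooth and periodic. -/
lemma contDiffOn_fourierCoef (hU : IsOpen U) {f : Field} (hf : SmoothPer U f)
    (ξ : Fin 3 → ℤ) : ContDiffOn ℝ ∞ (fun t => fourierCoef f t ξ) U := by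
  rw [contDiffOn_infty]
  intro n
  induction n generalizing f with
  | zero =>
    exact contDiffOn_zero.mpr fun t ht =>
      (hasDerivAt_fourierCoef hU hf ht ξ).continuousAt.continuousWithinAt
  | succ n ih =>
    push_cast
    rw [contDiffOn_succ_iff_deriv_of_isOpen hU]
    refine ⟨fun t ht => (hasDerivAt_fourierCoef hU hf ht ξ).differentiableAt.differentiableWithinAt,
      by simp, ?_⟩
    exact (ih (hf.pd hU 0)).congr fun t ht => (hasDerivAt_fourierCoef hU hf ht ξ).deriv

end Coef

end MinimalSurface
end

noncomputable section

namespace MinimalSurface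

open Filter Topology

/-! ### Decay of Fourier coefficients -/

/-- `1 + |ξ|²` for a lattice frequency. -/
def japSq (ξ : Fin 3 → ℤ) : ℝ := 1 + ‖latticePoint ξ‖ ^ 2

lemma norm_latticePoint_sq (ξ : Fin 3 → ℤ) : ‖latticePoint ξ‖ ^ 2 = ∑ i, (ξ i : ℝ) ^ 2 := by
  simp [EuclideanSpace.norm_sq_eq, latticePoint]

lemma one_le_japSq (ξ : Fin 3 → ℤ) : 1 ≤ japSq ξ := by simp [japSq]

lemma japSq_pos (ξ : Fin 3 → ℤ) : 0 < japSq ξ := one_pos.trans_le (one_le_japSq ξ)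

/-- A finite set of frequencies lies in the box of its coordinate projections, and over a box the
sum of products factors into one-dimensional sums. -/
lemma summable_fin_three_prod {u : ℤ → ℝ} (hu : Summable u) (h0 : ∀ n, 0 ≤ u n) :
    Summable fun ξ : Fin 3 → ℤ => ∏ i, u (ξ i) := by
  refine summable_of_sum_le (c := ∏ _i : Fin 3, ∑' n, u n)
    (fun ξ => Finset.prod_nonneg fun i _ => h0 _) fun s => ?_
  calc ∑ ξ ∈ s, ∏ i, u (ξ i)
      ≤ ∑ ξ ∈ Fintype.piFinset fun i : Fin 3 => s.image fun ξ => ξ i, ∏ i, u (ξ i) := by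
        refine Finset.sum_le_sum_of_subset_of_nonneg (fun ξ hξ => ?_)
          fun ξ _ _ => Finset.prod_nonneg fun i _ => h0 _
        exact Fintype.mem_piFinset.mpr fun i => Finset.mem_image_of_mem _ hξ
    _ = ∏ i : Fin 3, ∑ n ∈ s.image fun ξ => ξ i, u n := by
        rw [Finset.prod_univ_sum]
    _ ≤ _ := Finset.prod_le_prod (fun i _ => Finset.sum_nonneg fun n _ => h0 _)
        fun i _ => hu.sum_le_tsum _ fun n _ => h0 _

/-- Each factor of ∏(1 + ξ_i²) is at most 1 + |ξ|², so the series is dominated by a product of three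
convergent one-dimensional series. -/
lemma summable_japSq : Summable fun ξ : Fin 3 → ℤ => (japSq ξ ^ 3)⁻¹ := by
  have h1 : Summable fun n : ℤ => (1 + (n : ℝ) ^ 2)⁻¹ := by
    refine Summable.of_norm_bounded_eventually
      (Real.summable_one_div_int_pow (p := 2).mpr (by norm_num)) ?_
    refine (Set.finite_singleton (0 : ℤ)).subset fun n hn => ?_
    by_contra h
    apply hn
    have : (0 : ℝ) < (n : ℝ) ^ 2 := by
      have : (n : ℝ) ≠ 0 := by exact_mod_cast h
      positivity
    change ‖(1 + (n : ℝ) ^ 2)⁻¹‖ ≤ 1 / (n : ℝ) ^ 2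
    rw [Real.norm_of_nonneg (by positivity), one_div]
    exact inv_anti₀ this (by linarith)
  refine Summable.of_nonneg_of_le (fun ξ => by have := japSq_pos ξ; positivity) (fun ξ => ?_)
    (summable_fin_three_prod h1 fun n => by positivity)
  rw [Finset.prod_inv_distrib]
  refine inv_anti₀ (Finset.prod_pos fun i _ => by positivity) ?_
  calc ∏ i, (1 + (ξ i : ℝ) ^ 2) ≤ ∏ _i : Fin 3, japSq ξ := by
        refine Finset.prod_le_prod (fun i _ => by positivity) fun i _ => ?_
        rw [japSq, norm_latticePoint_sq]
        have := Finset.single_le_sum (f := fun i => (ξ i : ℝ) ^ 2) (fun i _ => by positivity)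
          (Finset.mem_univ i)
        linarith
    _ = _ := by simp

/-- The operator `1 - Δ / 4π²`, with symbol `1 + |ξ|²`. -/
def bessel (f : Field) : Field := fun x =>
  f x + (-(1 / (4 * Real.pi ^ 2) : ℂ)) * ∑ i : Fin 3, pd i.succ (pd i.succ f) x

section

variable {U : Set ℝ}

lemma SmoothPer.bessel (hU : IsOpen U) {f : Field} (hf : SmoothPer U f) :
    SmoothPer U (bessel f) :=
  hf.add ((SmoothPer.const _).mul (SmoothPer.sum fun _ _ => (hf.pd hU _).pd hU _))

lemma fourierCoef_bessel (hU : IsOpen U) {f : Field} (hf : SmoothPer U f) {t : ℝ} (ht : t ∈ U)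
    (ξ : Fin 3 → ℤ) : fourierCoef (bessel f) t ξ = japSq ξ * fourierCoef f t ξ := by
  have c0 := hf.contPer.slice_continuous ht
  have c1 (i : Fin 3) := ((hf.pd hU i.succ).pd hU i.succ).contPer.slice_continuous ht
  have e (i : Fin 3) : coef (fun y => MinimalSurface.pd i.succ
      (MinimalSurface.pd i.succ f) (Matrix.vecCons t y)) ξ =
      -(4 * Real.pi ^ 2) * (ξ i : ℂ) ^ 2 * fourierCoef f t ξ := by
    rw [← fourierCoef_eq, fourierCoef_pd_succ hU (hf.pd hU _) ht, fourierCoef_pd_succ hU hf ht]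
    linear_combination (4 * Real.pi ^ 2 * (ξ i : ℂ) ^ 2 * fourierCoef f t ξ) * Complex.I_sq
  rw [fourierCoef_eq]
  simp only [MinimalSurface.bessel]
  have c2 : Continuous fun y : Space => (-(1 / (4 * Real.pi ^ 2) : ℂ)) * ∑ i : Fin 3,
      MinimalSurface.pd i.succ (MinimalSurface.pd i.succ f) (Matrix.vecCons t y) :=
    continuous_const.mul (continuous_finsetSum _ fun i _ => c1 i)
  rw [coef_add c0 c2,
    coef_const_mul, coef_sum fun i _ => c1 i, ← fourierCoef_eq]
  simp only [e]
  rw [← Finset.sum_mul, ← Finset.mul_sum, japSq, norm_latticePoint_sq]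
  have : (Real.pi : ℂ) ≠ 0 := by exact_mod_cast Real.pi_ne_zero
  push_cast
  field_simp

/-- Each application of `bessel` multiplies the coefficients by `japSq`, so the trivial bound for
the N-fold image of f is decay of order N for f itself. -/
lemma exists_decay (hU : IsOpen U) (N : ℕ) {f : Field} (hf : SmoothPer U f) {t₀ : ℝ}
    (ht : t₀ ∈ U) : ∃ C : ℝ, ∃ ε > 0, Metric.ball t₀ ε ⊆ U ∧
      ∀ t ∈ Metric.ball t₀ ε, ∀ ξ, ‖fourierCoef f t ξ‖ ≤ C * (japSq ξ ^ N)⁻¹ := by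
  induction N generalizing f with
  | zero =>
    obtain ⟨C, ε, hε, hεU, hC⟩ := hf.contPer.exists_bound hU ht
    refine ⟨C, ε, hε, hεU, fun t ht ξ => ?_⟩
    rw [fourierCoef_eq]
    simpa using norm_coef_le (hC t ht) ξ
  | succ N ih =>
    obtain ⟨C, ε, hε, hεU, hC⟩ := ih (hf.bessel hU)
    refine ⟨C, ε, hε, hεU, fun t ht ξ => ?_⟩
    have h := hC t ht ξ
    have hp := japSq_pos ξ
    rw [fourierCoef_bessel hU hf (hεU ht), norm_mul, Complex.norm_real,
      Real.norm_of_nonneg hp.le] at h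
    rw [pow_succ, mul_inv, ← mul_assoc, ← div_eq_mul_inv _ (japSq ξ), le_div_iff₀ hp]
    linarith

/-! ### Fourier multipliers on smooth functions -/

/-- Symbols growing at most like `1 + |ξ|²`. -/
def ModerateSymbol (σ : Freq → ℂ) : Prop := ∃ C : ℝ, ∀ ξ, ‖σ (latticePoint ξ)‖ ≤ C * japSq ξ

lemma ModerateSymbol.of_bounded {σ : Freq → ℂ} {C : ℝ} (h : ∀ ξ, ‖σ ξ‖ ≤ C) :
    ModerateSymbol σ :=
  ⟨C, fun ξ => (h _).trans <| by
    have h0 : 0 ≤ C := (norm_nonneg _).trans (h 0)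
    nlinarith [one_le_japSq ξ]⟩

/-- Decay of order four against symbol growth of order one leaves the summable `japSq`⁻³. The
majorant is common to all times near t₀, so that the series converges uniformly there. -/
lemma exists_summable_bound (hU : IsOpen U) {f : Field} (hf : SmoothPer U f) {σ : Freq → ℂ}
    (hσ : ModerateSymbol σ) {t₀ : ℝ} (ht : t₀ ∈ U) :
    ∃ u : (Fin 3 → ℤ) → ℝ, Summable u ∧ ∃ ε > 0, Metric.ball t₀ ε ⊆ U ∧
      ∀ t ∈ Metric.ball t₀ ε, ∀ ξ, ‖σ (latticePoint ξ) * fourierCoef f t ξ‖ ≤ u ξ := by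
  obtain ⟨C, ε, hε, hεU, hC⟩ := exists_decay hU 4 hf ht
  obtain ⟨D, hD⟩ := hσ
  refine ⟨fun ξ => D * C * (japSq ξ ^ 3)⁻¹, summable_japSq.mul_left _, ε, hε, hεU,
    fun t ht ξ => ?_⟩
  have hp := japSq_pos ξ
  rw [norm_mul]
  calc _ ≤ (D * japSq ξ) * (C * (japSq ξ ^ 4)⁻¹) :=
        mul_le_mul (hD ξ) (hC t ht ξ) (norm_nonneg _) ((norm_nonneg _).trans (hD ξ))
    _ = _ := by field_simp

lemma summable_mult (hU : IsOpen U) {f : Field} (hf : SmoothPer U f) {σ : Freq → ℂ}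
    (hσ : ModerateSymbol σ) {t : ℝ} (ht : t ∈ U) :
    Summable fun ξ => σ (latticePoint ξ) * fourierCoef f t ξ := by
  obtain ⟨u, hu, ε, hε, -, h⟩ := exists_summable_bound hU hf hσ ht
  exact hu.of_norm_bounded fun ξ => h t (Metric.mem_ball_self hε) ξ

lemma mult_eq_tsum (σ : Freq → ℂ) (f : Field) (x : Spacetime) : mult σ f x =
    ∑' ξ : Fin 3 → ℤ, σ (latticePoint ξ) * fourierCoef f (x 0) ξ * chr ξ fun i => x i.succ := rfl

lemma contPer_mult (hU : IsOpen U) {f : Field} (hf : SmoothPer U f) {σ : Freq → ℂ}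
    (hσ : ModerateSymbol σ) : ContPer U (mult σ f) where
  continuousOn := by
    intro x hx
    obtain ⟨u, hu, ε, hε, hεU, h⟩ := exists_summable_bound hU hf hσ (t₀ := x 0) hx
    refine ContinuousAt.continuousWithinAt ?_
    have : ContinuousOn (mult σ f) (slab (Metric.ball (x 0) ε)) := by
      refine continuousOn_tsum (fun ξ => ?_) hu fun ξ z hz => ?_
      · refine ContinuousOn.mul (continuousOn_const.mul ?_) (Continuous.continuousOn ?_)
        · exact (contDiffOn_fourierCoef hU hf ξ).continuousOn.comp
            (continuous_apply 0).continuousOn fun z hz => hεU hz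
        · exact (continuous_chr ξ).comp (by fun_prop : Continuous fun z : Spacetime =>
            fun i : Fin 3 => z i.succ)
      · have := h (z 0) hz ξ
        change ‖_ * chr ξ (fun i => z i.succ)‖ ≤ _
        rwa [norm_mul, norm_chr, mul_one]
    exact this.continuousAt (slab_mem_nhds Metric.isOpen_ball (Metric.mem_ball_self hε))
  periodic x hx i := by
    simp only [mult_eq_tsum]
    refine tsum_congr fun ξ => ?_
    have e : (fun k : Fin 3 => (x + Pi.single i.succ 1 : Spacetime) k.succ) =
        (fun k : Fin 3 => x k.succ) + (Pi.single i 1 : Space) := by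
      ext k; simp [Pi.single_apply]
    have e0 : (x + Pi.single i.succ 1 : Spacetime) 0 = x 0 := by simp
    rw [e, isPeriodic_chr, e0]

lemma fourierCoef_mult (hU : IsOpen U) {f : Field} (hf : SmoothPer U f) {σ : Freq → ℂ}
    (hσ : ModerateSymbol σ) {t : ℝ} (ht : t ∈ U) (ξ : Fin 3 → ℤ) :
    fourierCoef (mult σ f) t ξ = σ (latticePoint ξ) * fourierCoef f t ξ := by
  rw [fourierCoef_eq]
  simp only [mult_vecCons]
  exact coef_tsum (summable_mult hU hf hσ ht) ξ

lemma mult_mult (hU : IsOpen U) {f : Field} (hf : SmoothPer U f) {σ : Freq → ℂ}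
    (hσ : ModerateSymbol σ) (τ : Freq → ℂ) {x : Spacetime} (hx : x ∈ slab U) :
    mult τ (mult σ f) x = mult (fun ξ => τ ξ * σ ξ) f x := by
  simp only [mult_eq_tsum]
  refine tsum_congr fun ξ => ?_
  rw [fourierCoef_mult hU hf hσ hx, ← mul_assoc (τ _)]

lemma mult_one (hU : IsOpen U) {f : Field} (hf : SmoothPer U f) {x : Spacetime}
    (hx : x ∈ slab U) : mult (fun _ => 1) f x = f x := by
  have hs := summable_mult hU hf (.of_bounded (σ := fun _ => 1) (C := 1) (by simp)) (t := x 0) hx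
  simp only [one_mul] at hs
  have := hasSum_coef (hf.contPer.slice_continuous (t := x 0) hx)
    (hf.contPer.slice_periodic (t := x 0) hx)
    (hs.congr fun ξ => fourierCoef_eq f _ ξ) (fun i => x i.succ)
  rw [mult_eq_tsum, ← vecCons_eta x, ← this.tsum_eq]
  simp [fourierCoef_eq]

lemma mult_congr_on {f g : Field} (h : Set.EqOn f g (slab U)) (σ : Freq → ℂ) :
    Set.EqOn (mult σ f) (mult σ g) (slab U) := fun x hx => by
  simp only [mult_eq_tsum]
  have (ξ : Fin 3 → ℤ) : fourierCoef f (x 0) ξ = fourierCoef g (x 0) ξ := by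
    simp only [fourierCoef_eq]
    congr 1
    ext y
    exact h (vecCons_mem_slab.mpr hx)
  simp only [this]

/-! ### Finitely many frequencies: smoothness and commutation with derivatives. -/

/-- Symbols vanishing at all but finitely many lattice points. -/
def FiniteSymbol (σ : Freq → ℂ) : Prop := {ξ | σ (latticePoint ξ) ≠ 0}.Finite

lemma finite_lattice_ball (R : ℝ) : {ξ : Fin 3 → ℤ | ‖latticePoint ξ‖ ≤ R}.Finite := by
  refine (Set.finite_Icc (fun _ => -⌈R⌉ : Fin 3 → ℤ) (fun _ => ⌈R⌉)).subset fun ξ hξ => ?_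
  have h (i : Fin 3) : |(ξ i : ℝ)| ≤ ⌈R⌉ := by
    have := PiLp.norm_apply_le (latticePoint ξ) i
    exact (this.trans hξ).trans (Int.le_ceil R)
  exact ⟨fun i => by exact_mod_cast (abs_le.mp (h i)).1,
    fun i => by exact_mod_cast (abs_le.mp (h i)).2⟩

lemma FiniteSymbol.of_support {σ : Freq → ℂ} {R : ℝ} (h : ∀ ξ, R < ‖ξ‖ → σ ξ = 0) :
    FiniteSymbol σ :=
  (finite_lattice_ball R).subset fun ξ hξ => by
    by_contra h'
    exact hξ (h _ (not_le.mp h'))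

lemma FiniteSymbol.mul_right {σ : Freq → ℂ} (h : FiniteSymbol σ) (τ : Freq → ℂ) :
    FiniteSymbol fun ξ => σ ξ * τ ξ :=
  h.subset fun _ hξ h' => hξ (by simp [h'])

lemma FiniteSymbol.moderate {σ : Freq → ℂ} (h : FiniteSymbol σ) : ModerateSymbol σ := by
  refine ⟨∑ ξ ∈ h.toFinset, ‖σ (latticePoint ξ)‖, fun ξ => ?_⟩
  have hj := one_le_japSq ξ
  have h0 : 0 ≤ ∑ ξ ∈ h.toFinset, ‖σ (latticePoint ξ)‖ := Finset.sum_nonneg fun _ _ => norm_nonneg _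
  by_cases hξ : σ (latticePoint ξ) = 0
  · rw [hξ, norm_zero]; positivity
  · have := Finset.single_le_sum (f := fun ξ => ‖σ (latticePoint ξ)‖) (fun _ _ => norm_nonneg _)
      (h.mem_toFinset.mpr hξ)
    nlinarith

lemma FiniteSymbol.mult_eq {σ : Freq → ℂ} (h : FiniteSymbol σ) (f : Field) (x : Spacetime) :
    mult σ f x = ∑ ξ ∈ h.toFinset, σ (latticePoint ξ) * fourierCoef f (x 0) ξ *
      chr ξ fun i => x i.succ := by
  rw [mult_eq_tsum]
  refine tsum_eq_sum fun ξ hξ => ?_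
  have : σ (latticePoint ξ) = 0 := by
    by_contra h'
    exact hξ (h.mem_toFinset.mpr h')
  simp [this]

lemma contDiff_chr (ξ : Fin 3 → ℤ) : ContDiff ℝ ∞ (chr ξ) := by
  have : chr ξ = fun y => Complex.exp (2 * Real.pi * Complex.I *
      ∑ i, (ξ i : ℂ) * Complex.ofRealCLM (y i)) := rfl
  rw [this]
  fun_prop

/-- The result is a trigonometric polynomial with coefficients smooth in time, so no convergence
question arises. The Littlewood–Paley localised fields that are differentiated later are all of this
kind. -/
lemma SmoothPer.mult (hU : IsOpen U) {f : Field} (hf : SmoothPer U f) {σ : Freq → ℂ}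
    (hσ : FiniteSymbol σ) : SmoothPer U (mult σ f) where
  smooth := by
    refine ContDiffOn.congr ?_ fun x _ => hσ.mult_eq f x
    refine ContDiffOn.sum fun ξ _ => ContDiffOn.mul (contDiffOn_const.mul ?_) ?_
    · exact (contDiffOn_fourierCoef hU hf ξ).comp (contDiff_apply ℝ ℝ (0 : Fin 4)).contDiffOn
        fun z hz => hz
    · exact ((contDiff_chr ξ).comp (by fun_prop : ContDiff ℝ ∞ fun z : Spacetime =>
            fun i : Fin 3 => z i.succ)).contDiffOn
  periodic := (contPer_mult hU hf hσ.moderate).periodic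

lemma pd_mult (hU : IsOpen U) {f : Field} (hf : SmoothPer U f) {σ : Freq → ℂ}
    (hσ : FiniteSymbol σ) (α : Fin 4) {x : Spacetime} (hx : x ∈ slab U) :
    pd α (mult σ f) x = mult σ (pd α f) x := by
  have hsm := hf.mult hU hσ
  have hpd := (hf.pd hU α).mult hU hσ
  rw [← vecCons_eta x]
  have hx0 : x 0 ∈ U := hx
  generalize (fun i : Fin 3 => x i.succ) = y
  generalize x 0 = t at hx0
  refine Fin.cases ?_ (fun i => ?_) α
  · refine (hasDerivAt_time hU hsm hx0 y).unique ?_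
    simp only [hσ.mult_eq, Matrix.cons_val_zero, Matrix.cons_val_succ]
    exact HasDerivAt.fun_sum fun ξ _ =>
      ((hasDerivAt_fourierCoef hU hf hx0 ξ).const_mul _).mul_const _
  · obtain ⟨L, hL, hL'⟩ := hasFDerivAt_slice hU hsm hx0 y
    rw [← hL' i]
    choose M hM hM' using fun ξ => hasFDerivAt_chr ξ y
    have : HasFDerivAt (fun y => MinimalSurface.mult σ f (Matrix.vecCons t y))
        (∑ ξ ∈ hσ.toFinset, (σ (latticePoint ξ) * fourierCoef f t ξ) • M ξ) y := by
      simp only [hσ.mult_eq, Matrix.cons_val_zero, Matrix.cons_val_succ]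
      exact HasFDerivAt.fun_sum fun ξ _ => (hM ξ).const_mul _
    rw [hL.unique this, hσ.mult_eq]
    simp only [FunLike.coe_smul, Pi.smul_apply, FunLike.coe_sum, Finset.sum_apply, hM',
      Matrix.cons_val_zero, Matrix.cons_val_succ, smul_eq_mul]
    refine Finset.sum_congr rfl fun ξ _ => ?_
    rw [fourierCoef_pd_succ hU hf hx0]
    ring

lemma mult_pd_succ (hU : IsOpen U) {f : Field} (hf : SmoothPer U f) (σ : Freq → ℂ) (i : Fin 3)
    {x : Spacetime} (hx : x ∈ slab U) :
    mult σ (pd i.succ f) x = mult (fun ξ => σ ξ * (2 * Real.pi * Complex.I * ((ξ i : ℝ) : ℂ))) f x := by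
  simp only [mult_eq_tsum]
  refine tsum_congr fun ξ => ?_
  rw [fourierCoef_pd_succ hU hf hx]
  simp only [latticePoint]
  push_cast
  ring

lemma mult_sum (hU : IsOpen U) {ι : Type*} {s : Finset ι} {f : ι → Field} (c : ι → ℂ)
    (hf : ∀ i ∈ s, SmoothPer U (f i)) {σ : Freq → ℂ} (hσ : ModerateSymbol σ)
    {x : Spacetime} (hx : x ∈ slab U) :
    mult σ (fun x => ∑ i ∈ s, c i * f i x) x = ∑ i ∈ s, c i * mult σ (f i) x := by
  have hs (i : ι) (hi : i ∈ s) : Summable fun ξ => c i * (σ (latticePoint ξ) *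
      fourierCoef (f i) (x 0) ξ * chr ξ fun i => x i.succ) := by
    refine Summable.mul_left _ (Summable.of_norm ?_)
    simpa using (summable_mult hU (hf i hi) hσ (t := x 0) hx).norm
  simp only [mult_eq_tsum, ← tsum_mul_left]
  rw [← Summable.tsum_finsetSum hs]
  refine tsum_congr fun ξ => ?_
  have hc (i : ι) (hi : i ∈ s) : Continuous fun y => c i * f i (Matrix.vecCons (x 0) y) :=
    continuous_const.mul ((hf i hi).contPer.slice_continuous (t := x 0) hx)
  rw [fourierCoef_eq, coef_sum hc]
  simp only [coef_const_mul, ← fourierCoef_eq, Finset.mul_sum, Finset.sum_mul]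
  exact Finset.sum_congr rfl fun i _ => by ring

end

end MinimalSurface
end

noncomputable section

namespace MinimalSurface

open Filter Topology

/-! ### Rules of differentiation -/

section PdRules

variable {E : Type*} [NormedAddCommGroup E] [NormedSpace ℝ E] {x : Spacetime} (α : Fin 4)

lemma pd_add {f g : Spacetime → E} (hf : DifferentiableAt ℝ f x) (hg : DifferentiableAt ℝ g x) :
    pd α (fun x => f x + g x) x = pd α f x + pd α g x := by
  simp [pd, fderiv_fun_add hf hg]

lemma pd_sub {f g : Spacetime → E} (hf : DifferentiableAt ℝ f x) (hg : DifferentiableAt ℝ g x) :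
    pd α (fun x => f x - g x) x = pd α f x - pd α g x := by
  simp [pd, fderiv_fun_sub hf hg]

lemma pd_sum {ι : Type*} {s : Finset ι} {f : ι → Spacetime → E}
    (hf : ∀ i ∈ s, DifferentiableAt ℝ (f i) x) :
    pd α (fun x => ∑ i ∈ s, f i x) x = ∑ i ∈ s, pd α (f i) x := by
  simp [pd, fderiv_fun_sum hf]

lemma pd_smul {c : Spacetime → ℝ} {f : Spacetime → E} (hc : DifferentiableAt ℝ c x)
    (hf : DifferentiableAt ℝ f x) :
    pd α (fun x => c x • f x) x = c x • pd α f x + pd α c x • f x := by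
  simp [pd, fderiv_fun_smul hc hf]

lemma pd_mul {A : Type*} [NormedCommRing A] [NormedAlgebra ℝ A] {f g : Spacetime → A}
    (hf : DifferentiableAt ℝ f x) (hg : DifferentiableAt ℝ g x) :
    pd α (fun x => f x * g x) x = pd α f x * g x + f x * pd α g x := by
  simp [pd, fderiv_fun_mul hf hg]; ring

lemma pd_const_mul {A : Type*} [NormedCommRing A] [NormedAlgebra ℝ A] (c : A) {f : Spacetime → A}
    (hf : DifferentiableAt ℝ f x) : pd α (fun x => c * f x) x = c * pd α f x := by
  simp [pd, fderiv_const_mul hf]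

lemma pd_apply {ι : Type*} [Fintype ι] {f : Spacetime → ι → ℝ} (hf : DifferentiableAt ℝ f x)
    (i : ι) : pd α (fun x => f x i) x = pd α f x i := by
  have := (hasFDerivAt_pi'.mp hf.hasFDerivAt i).fderiv
  simp only [pd, this]
  rfl

lemma pd_ofReal {f : Spacetime → ℝ} (hf : DifferentiableAt ℝ f x) :
    pd α (fun x => (f x : ℂ)) x = pd α f x := by
  have := (Complex.ofRealCLM.hasFDerivAt.comp x hf.hasFDerivAt).fderiv
  simp only [pd]
  change fderiv ℝ (Complex.ofRealCLM ∘ f) x _ = _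
  rw [this]; rfl

lemma pd_comm {U : Set ℝ} (hU : IsOpen U) {f : Spacetime → E} (hf : ContDiffOn ℝ ∞ f (slab U))
    (hx : x ∈ slab U) (β : Fin 4) : pd α (pd β f) x = pd β (pd α f) x := by
  have hat := hf.contDiffAt (slab_mem_nhds hU hx)
  have hsymm := hat.isSymmSndFDerivAt (by simp; exact WithTop.coe_le_coe.mpr le_top)
  have hd : DifferentiableAt ℝ (fderiv ℝ f) x :=
    (hat.fderiv_right (m := 1) (by exact WithTop.coe_le_coe.mpr le_top)).differentiableAt (by simp)
  have e (α β : Fin 4) : pd α (pd β f) x =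
      fderiv ℝ (fderiv ℝ f) x (Pi.single α 1) (Pi.single β 1) := by
    have := (hd.hasFDerivAt.clm_apply
      (hasFDerivAt_const (Pi.single β (1 : ℝ) : Spacetime) x)).fderiv
    change fderiv ℝ (fun y => fderiv ℝ f y (Pi.single β 1)) x (Pi.single α 1) = _
    rw [this]
    simp
  rw [e, e, hsymm.eq]

end PdRules

/-! ### The Minkowski form -/

section Mink

variable {d : ℕ}

lemma mink_comm (v w : Fin (d + 4) → ℝ) : mink v w = mink w v := by
  simp only [mink]; exact Finset.sum_congr rfl fun A _ => by ring

lemma mink_sum_right {ι : Type*} (s : Finset ι) (v : Fin (d + 4) → ℝ) (c : ι → ℝ)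
    (w : ι → Fin (d + 4) → ℝ) : mink v (∑ i ∈ s, c i • w i) = ∑ i ∈ s, c i * mink v (w i) := by
  simp only [mink, Finset.sum_apply, Pi.smul_apply, smul_eq_mul, Finset.mul_sum]
  rw [Finset.sum_comm]
  exact Finset.sum_congr rfl fun i _ => Finset.sum_congr rfl fun A _ => by ring

lemma mink_add_right (v w z : Fin (d + 4) → ℝ) : mink v (w + z) = mink v w + mink v z := by
  simp only [mink, ← Finset.sum_add_distrib]
  exact Finset.sum_congr rfl fun A _ => by simp only [Pi.add_apply]; ring

lemma mink_sub_right (v w z : Fin (d + 4) → ℝ) : mink v (w - z) = mink v w - mink v z := by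
  simp only [mink, ← Finset.sum_sub_distrib]
  exact Finset.sum_congr rfl fun A _ => by simp only [Pi.sub_apply]; ring

lemma mink_smul_right (v : Fin (d + 4) → ℝ) (c : ℝ) (w : Fin (d + 4) → ℝ) :
    mink v (c • w) = c * mink v w := by
  simp only [mink, Finset.mul_sum]
  exact Finset.sum_congr rfl fun A _ => by simp only [Pi.smul_apply, smul_eq_mul]; ring

lemma mink_single_right (v : Fin (d + 4) → ℝ) (A : Fin (d + 4)) :
    mink v (Pi.single A 1) = (if A = 0 then -1 else 1) * v A := by
  simp only [mink]
  rw [Finset.sum_eq_single A]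
  · simp
  · intro B _ hB; simp [hB]
  · simp

lemma eq_zero_of_mink {v : Fin (d + 4) → ℝ} (h : ∀ w, mink v w = 0) : v = 0 := by
  ext A
  have := h (Pi.single A 1)
  rw [mink_single_right] at this
  split_ifs at this <;> simpa using this

lemma pd_mink {v w : Spacetime → Fin (d + 4) → ℝ} {x : Spacetime} (α : Fin 4)
    (hv : DifferentiableAt ℝ v x) (hw : DifferentiableAt ℝ w x) :
    pd α (fun x => mink (v x) (w x)) x = mink (pd α v x) (w x) + mink (v x) (pd α w x) := by
  have hv' (A : Fin (d + 4)) : DifferentiableAt ℝ (fun x => v x A) x := differentiableAt_pi.mp hv A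
  have hw' (A : Fin (d + 4)) : DifferentiableAt ℝ (fun x => w x A) x := differentiableAt_pi.mp hw A
  simp only [mink]
  rw [pd_sum α fun A _ => ((hv' A).const_mul _).fun_mul (hw' A), ← Finset.sum_add_distrib]
  refine Finset.sum_congr rfl fun A _ => ?_
  rw [pd_mul α ((hv' A).const_mul _) (hw' A), pd_const_mul α _ (hv' A), pd_apply α hv,
    pd_apply α hw]

lemma SmoothPer.mink {U : Set ℝ} {v w : Spacetime → Fin (d + 4) → ℝ} (hv : SmoothPer U v)
    (hw : SmoothPer U w) : SmoothPer U fun x => mink (v x) (w x) :=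
  SmoothPer.sum fun A _ => ((SmoothPer.const _).mul (hv.apply A)).mul (hw.apply A)

end Mink

lemma SmoothPer.det {U : Set ℝ} {n : Type*} [Fintype n] [DecidableEq n]
    {N : Spacetime → Matrix n n ℝ} (hN : ∀ i j, SmoothPer U fun x => N x i j) :
    SmoothPer U fun x => (N x).det := by
  simp only [Matrix.det_apply']
  exact SmoothPer.sum fun σ _ => (SmoothPer.const _).mul (SmoothPer.prod fun i _ => hN _ _)

lemma SmoothPer.matrix_inv {U : Set ℝ} {n : Type*} [Fintype n] [DecidableEq n]
    {N : Spacetime → Matrix n n ℝ} (hN : ∀ i j, SmoothPer U fun x => N x i j)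
    (h0 : ∀ x ∈ slab U, (N x).det ≠ 0) (i j : n) : SmoothPer U fun x => (N x)⁻¹ i j := by
  have : (fun x => (N x)⁻¹ i j) = fun x => (N x).det⁻¹ * (N x).adjugate i j := by
    ext x; simp [Matrix.inv_def]
  rw [this]
  refine ((SmoothPer.det hN).inv h0).mul ?_
  simp only [Matrix.adjugate_apply]
  refine SmoothPer.det fun k l => ?_
  by_cases hk : k = j
  · subst hk; simpa using SmoothPer.const _
  · simpa [Matrix.updateRow_ne hk] using hN k l

/-! ### Geometry of framed immersions -/

namespace FramedImmersion

variable {d : ℕ} {U : Set ℝ} (M : FramedImmersion d U)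

/-- `Y` itself is periodic only modulo integers. The jump across a period is continuous and integer
valued, hence locally constant, and differentiation removes it. -/
lemma smoothPer_pd_Y (hU : IsOpen U) (α : Fin 4) : SmoothPer U (pd α M.Y) where
  smooth := (M.smooth_Y.fderiv_of_isOpen (isOpen_slab hU) (m := ∞) (by simp)).clm_apply
    contDiffOn_const
  periodic x hx i := by
    have hshift : ContinuousOn (fun z => M.Y (z + Pi.single i.succ 1)) (slab U) :=
      M.smooth_Y.continuousOn.comp (by fun_prop) fun z hz => add_single_mem_slab hz i
    have hev : ∀ᶠ z in 𝓝 x, M.Y (z + Pi.single i.succ 1) =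
        M.Y z + (M.Y (x + Pi.single i.succ 1) - M.Y x) := by
      have hc : ContinuousAt (fun z => M.Y (z + Pi.single i.succ 1) - M.Y z) x :=
        ((hshift.sub M.smooth_Y.continuousOn).continuousAt (slab_mem_nhds hU hx))
      filter_upwards [hc.eventually (Metric.ball_mem_nhds _ one_pos), slab_mem_nhds hU hx]
        with z hz hzU
      obtain ⟨p, -, hp⟩ := M.descends_Y x hx i
      obtain ⟨q, -, hq⟩ := M.descends_Y z hzU i
      ext A
      have h1 := (dist_pi_lt_iff one_pos).mp (Metric.mem_ball.mp hz) A
      simp only [Pi.sub_apply, Pi.add_apply, hp, hq, add_sub_cancel_left] at h1 ⊢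
      rw [Int.dist_cast_real, ← Int.cast_one, Int.dist_eq, ← Int.cast_sub, ← Int.cast_abs,
        Int.cast_lt, Int.abs_lt_one_iff, sub_eq_zero] at h1
      rw [h1]
    simp only [pd]
    rw [← fderiv_comp_add_right, Filter.EventuallyEq.fderiv_eq hev, fderiv_add_const]

lemma smoothPer_e (A : Fin d) : SmoothPer U (M.e A) := ⟨M.smooth_e A, M.periodic_e A⟩

lemma g_eq (α β : Fin 4) (x : Spacetime) : M.g α β x = mink (pd α M.Y x) (pd β M.Y x) := rfl

lemma gram_comm (A B : Fin d) (x : Spacetime) : M.gram x A B = M.gram x B A := mink_comm _ _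

lemma det_metric_ne_zero {x : Spacetime} (hx : x ∈ slab U) : (inducedMetric M.Y x).det ≠ 0 := by
  obtain ⟨P, -, hP⟩ := M.timelike x hx
  intro h
  have := congrArg Matrix.det hP
  simp [h, Matrix.det_diagonal] at this

lemma eq_zero_of_metric {x : Spacetime} (hx : x ∈ slab U) {a : Fin 4 → ℝ}
    (h : ∀ β, ∑ α, a α * M.g β α x = 0) : a = 0 := by
  by_contra ha
  refine M.det_metric_ne_zero hx (Matrix.exists_mulVec_eq_zero_iff.mp ⟨a, ha, ?_⟩)
  ext β
  simp only [Matrix.mulVec, dotProduct, Pi.zero_apply, ← h β]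
  exact Finset.sum_congr rfl fun α _ => mul_comm _ _

/-- The four vectors ∂_αY and the d vectors e_A form a basis of ℝ^{d+4}, and the Minkowski form is
nondegenerate. For independence, pairing a relation with ∂_βY kills the normal vectors and leaves
the invertible matrix g; what remains is a relation among the e_A. -/
lemma eq_zero_of_orthogonal {x : Spacetime} (hx : x ∈ slab U) {v : Fin (d + 4) → ℝ}
    (ht : ∀ α, mink v (pd α M.Y x) = 0) (hn : ∀ A, mink v (M.e A x) = 0) : v = 0 := by
  have hli : LinearIndependent ℝ (Sum.elim (fun α => pd α M.Y x) fun A => M.e A x) := by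
    rw [Fintype.linearIndependent_iff]
    intro c hc
    simp only [Fintype.sum_sum_type, Sum.elim_inl, Sum.elim_inr] at hc
    have ha : (fun α => c (.inl α)) = 0 := by
      refine M.eq_zero_of_metric hx fun β => ?_
      have := congrArg (mink (pd β M.Y x)) hc
      rw [mink_add_right, mink_sum_right, mink_sum_right,
        Finset.sum_eq_zero (s := Finset.univ) (f := fun A => c (.inr A) * _) fun A _ => by
          rw [mink_comm, M.normal A β x hx, mul_zero]] at this
      simpa [mink, g_eq] using this
    have ha' (α : Fin 4) : c (.inl α) = 0 := congrFun ha α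
    simp only [ha', zero_smul, Finset.sum_const_zero, zero_add] at hc
    have hb := Fintype.linearIndependent_iff.mp (M.independent x hx) _ hc
    rintro (α | A)
    exacts [ha' α, hb A]
  have hspan := hli.span_eq_top_of_card_eq_finrank (by simp [add_comm])
  refine eq_zero_of_mink fun w => ?_
  have hw : w ∈ Submodule.span ℝ (Set.range
      (Sum.elim (fun α => pd α M.Y x) fun A => M.e A x)) := by rw [hspan]; trivial
  induction hw using Submodule.span_induction with
  | mem w hw => obtain ⟨α | A, rfl⟩ := hw; exacts [ht α, hn A]
  | zero => simp [mink]
  | add w z _ _ h1 h2 => rw [mink_add_right, h1, h2, add_zero]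
  | smul c w _ h => rw [mink_smul_right, h, mul_zero]

/-- A kernel vector of the Gram matrix gives a combination of the e_A orthogonal to tangent space
and frame alike, hence zero. The frame is not orthonormal, so this invertibility is what makes
`normalPart` the component of the orthogonal projection. -/
lemma det_gram_ne_zero {x : Spacetime} (hx : x ∈ slab U) : (M.gram x).det ≠ 0 := by
  intro h
  obtain ⟨c, hc, h0⟩ := Matrix.exists_mulVec_eq_zero_iff.mpr h
  refine hc ?_
  have hv : ∑ B, c B • M.e B x = 0 := by
    refine M.eq_zero_of_orthogonal hx (fun α => ?_) fun A => ?_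
    · rw [mink_comm, mink_sum_right]
      exact Finset.sum_eq_zero fun B _ => by rw [mink_comm, M.normal B α x hx, mul_zero]
    · rw [mink_comm, mink_sum_right]
      have := congrFun h0 A
      simp only [Matrix.mulVec, dotProduct, Pi.zero_apply] at this
      rw [← this]
      exact Finset.sum_congr rfl fun B _ => mul_comm _ _
  exact funext (Fintype.linearIndependent_iff.mp (M.independent x hx) _ hv)

lemma normalPart_add (A : Fin d) (x : Spacetime) (v w : Fin (d + 4) → ℝ) :
    M.normalPart A x (v + w) = M.normalPart A x v + M.normalPart A x w := by
  simp only [normalPart, mink_add_right, mul_add, Finset.sum_add_distrib]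

lemma normalPart_sum {ι : Type*} (s : Finset ι) (A : Fin d) (x : Spacetime) (c : ι → ℝ)
    (v : ι → Fin (d + 4) → ℝ) :
    M.normalPart A x (∑ i ∈ s, c i • v i) = ∑ i ∈ s, c i * M.normalPart A x (v i) := by
  simp only [normalPart, mink_sum_right, Finset.mul_sum]
  rw [Finset.sum_comm]
  exact Finset.sum_congr rfl fun i _ => Finset.sum_congr rfl fun C _ => by ring

lemma normalPart_pd_Y (A : Fin d) {x : Spacetime} (hx : x ∈ slab U) (α : Fin 4) :
    M.normalPart A x (pd α M.Y x) = 0 :=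
  Finset.sum_eq_zero fun C _ => by rw [M.normal C α x hx, mul_zero]

lemma normalPart_e (A B : Fin d) {x : Spacetime} (hx : x ∈ slab U) :
    M.normalPart A x (M.e B x) = if A = B then 1 else 0 := by
  have := congrFun (congrFun (Matrix.nonsing_inv_mul (M.gram x)
    (Ne.isUnit (M.det_gram_ne_zero hx))) A) B
  rw [Matrix.one_apply] at this
  rw [← this, Matrix.mul_apply]
  rfl

/-- The difference of the two sides is orthogonal to every ∂_βY and every e_B, because `gInv` and
the inverse Gram matrix undo the respective pairings. -/
lemma decomposition {x : Spacetime} (hx : x ∈ slab U) (V : Fin (d + 4) → ℝ) :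
    V = ∑ σ, (∑ ρ, M.gInv σ ρ x * mink (pd ρ M.Y x) V) • pd σ M.Y x +
      ∑ A, M.normalPart A x V • M.e A x := by
  rw [← sub_eq_zero]
  refine M.eq_zero_of_orthogonal hx (fun β => ?_) fun B => ?_
  · rw [mink_comm, mink_sub_right, mink_add_right, mink_sum_right, mink_sum_right,
      Finset.sum_eq_zero (s := Finset.univ) (f := fun A => M.normalPart A x V * _) fun A _ => by
          rw [mink_comm, M.normal A β x hx, mul_zero], add_zero, sub_eq_zero]
    have h := Matrix.mul_nonsing_inv (inducedMetric M.Y x) (Ne.isUnit (M.det_metric_ne_zero hx))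
    have h' (ρ : Fin 4) : ∑ σ, M.g β σ x * M.gInv σ ρ x = if β = ρ then 1 else 0 := by
      rw [← Matrix.one_apply, ← h, Matrix.mul_apply]; rfl
    simp only [Finset.sum_mul]
    rw [Finset.sum_comm]
    calc mink (pd β M.Y x) V
        = ∑ ρ, (if β = ρ then 1 else 0) * mink (pd ρ M.Y x) V := by simp
      _ = _ := by
        refine Finset.sum_congr rfl fun ρ _ => ?_
        rw [← h', Finset.sum_mul]
        exact Finset.sum_congr rfl fun σ _ => by rw [g_eq]; ring
  · rw [mink_comm, mink_sub_right, mink_add_right, mink_sum_right, mink_sum_right,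
      Finset.sum_eq_zero (s := Finset.univ) (f := fun σ => _ * mink (M.e B x) (pd σ M.Y x))
        fun σ _ => by rw [M.normal B σ x hx, mul_zero], zero_add, sub_eq_zero]
    have h := Matrix.mul_nonsing_inv (M.gram x) (Ne.isUnit (M.det_gram_ne_zero hx))
    have h' (C : Fin d) : ∑ A, M.gram x B A * (M.gram x)⁻¹ A C = if B = C then 1 else 0 := by
      rw [← Matrix.one_apply, ← h, Matrix.mul_apply]
    simp only [normalPart, Finset.sum_mul]
    rw [Finset.sum_comm]
    calc mink (M.e B x) V
        = ∑ C, (if B = C then 1 else 0) * mink (M.e C x) V := by simp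
      _ = _ := by
        refine Finset.sum_congr rfl fun C _ => ?_
        rw [← h', Finset.sum_mul]
        refine Finset.sum_congr rfl fun A _ => ?_
        simp only [gram, Matrix.of_apply]
        ring

lemma k_comm (hU : IsOpen U) (α β : Fin 4) (A : Fin d) {x : Spacetime} (hx : x ∈ slab U) :
    M.k α β A x = M.k β α A x := by
  simp only [k, pd_comm α hU M.smooth_Y hx β]

lemma smoothPer_g (hU : IsOpen U) (α β : Fin 4) : SmoothPer U (M.g α β) :=
  (M.smoothPer_pd_Y hU α).mink (M.smoothPer_pd_Y hU β)

lemma smoothPer_gInv (hU : IsOpen U) (α β : Fin 4) : SmoothPer U (M.gInv α β) :=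
  SmoothPer.matrix_inv (fun i j => M.smoothPer_g hU i j) (fun _ hx => M.det_metric_ne_zero hx) α β

lemma smoothPer_gram (A B : Fin d) : SmoothPer U fun x => M.gram x A B :=
  (M.smoothPer_e A).mink (M.smoothPer_e B)

lemma smoothPer_normalPart (A : Fin d) {V : Spacetime → Fin (d + 4) → ℝ} (hV : SmoothPer U V) :
    SmoothPer U fun x => M.normalPart A x (V x) :=
  SmoothPer.sum fun C _ => (SmoothPer.matrix_inv M.smoothPer_gram
    (fun _ hx => M.det_gram_ne_zero hx) A C).mul ((M.smoothPer_e C).mink hV)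

lemma smoothPer_k (hU : IsOpen U) (α β : Fin 4) (A : Fin d) : SmoothPer U (M.k α β A) :=
  M.smoothPer_normalPart A ((M.smoothPer_pd_Y hU β).pd hU α)

lemma smoothPer_conn (hU : IsOpen U) (α : Fin 4) (A B : Fin d) : SmoothPer U (M.conn α A B) :=
  M.smoothPer_normalPart A ((M.smoothPer_e B).pd hU α)

lemma smoothPer_kField (hU : IsOpen U) (p : KIdx d) : SmoothPer U (M.kField p) :=
  (M.smoothPer_k hU _ _ _).ofReal

lemma smoothPer_mField (p : MIdx d) : SmoothPer U (M.mField p) := (M.smoothPer_gram _ _).ofReal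

lemma smoothPer_connField (hU : IsOpen U) (α : Fin 4) (A B : Fin d) :
    SmoothPer U (M.connField α A B) := (M.smoothPer_conn hU _ _ _).ofReal

lemma smoothPer_gdgField (hU : IsOpen U) (μ ν κ l ρ : Fin 4) :
    SmoothPer U (M.gdgField μ ν κ l ρ) :=
  ((M.smoothPer_gInv hU μ ν).mul ((M.smoothPer_g hU l ρ).pd hU κ)).ofReal

lemma smoothPer_sourceField (hU : IsOpen U) (s : SIdx d) : SmoothPer U (M.sourceField s) := by
  rcases s with ⟨μ, ν, κ, l, ρ, p⟩ | ⟨α, A, B, p⟩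
  · exact (M.smoothPer_gdgField hU _ _ _ _ _).mul (M.smoothPer_kField hU p)
  · exact (M.smoothPer_connField hU _ _ _).mul (M.smoothPer_kField hU p)

/-! ### The Gauss formula and the Codazzi equation. -/

/-- The Christoffel symbols `Γ^σ_{αβ}`. -/
def christoffel (σ α β : Fin 4) (x : Spacetime) : ℝ :=
  ∑ ρ, M.gInv σ ρ x * (1 / 2 * (pd α (M.g ρ β) x + pd β (M.g ρ α) x - pd ρ (M.g α β) x))

lemma smoothPer_christoffel (hU : IsOpen U) (σ α β : Fin 4) :
    SmoothPer U (M.christoffel σ α β) :=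
  SmoothPer.sum fun ρ _ => (M.smoothPer_gInv hU σ ρ).mul ((SmoothPer.const _).mul
    ((((M.smoothPer_g hU ρ β).pd hU α).add ((M.smoothPer_g hU ρ α).pd hU β)).sub
      ((M.smoothPer_g hU α β).pd hU ρ)))

/-- The usual Christoffel computation: expand the three derivatives of g by the product rule and use
that second derivatives of Y commute. It identifies the tangential part of ∂_α∂_βY. -/
lemma mink_pd_pd_Y (hU : IsOpen U) (ρ α β : Fin 4) {x : Spacetime} (hx : x ∈ slab U) :
    mink (pd ρ M.Y x) (pd α (pd β M.Y) x) =
      1 / 2 * (pd α (M.g ρ β) x + pd β (M.g ρ α) x - pd ρ (M.g α β) x) := by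
  have h (κ l ρ : Fin 4) : pd κ (M.g l ρ) x =
      mink (pd κ (pd l M.Y) x) (pd ρ M.Y x) + mink (pd l M.Y x) (pd κ (pd ρ M.Y) x) :=
    pd_mink κ ((M.smoothPer_pd_Y hU l).differentiableAt hU hx)
      ((M.smoothPer_pd_Y hU ρ).differentiableAt hU hx)
  rw [h, h, h, pd_comm α hU M.smooth_Y hx ρ, pd_comm β hU M.smooth_Y hx ρ,
    pd_comm β hU M.smooth_Y hx α, mink_comm (pd ρ (pd α M.Y) x), mink_comm (pd ρ (pd β M.Y) x)]
  rw [mink_comm (pd α M.Y x)]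
  ring_nf

/-- The Gauss formula. -/
lemma pd_pd_Y (hU : IsOpen U) (α β : Fin 4) {x : Spacetime} (hx : x ∈ slab U) :
    pd α (pd β M.Y) x = ∑ σ, M.christoffel σ α β x • pd σ M.Y x +
      ∑ A, M.k α β A x • M.e A x := by
  conv_lhs => rw [M.decomposition hx (pd α (pd β M.Y) x)]
  simp only [M.mink_pd_pd_Y hU _ _ _ hx]
  rfl

/-- Differentiate the Gauss formula and project. Derivatives of Γ multiply tangent vectors and drop
out, ∂_γ∂_σY contributes k, and ∂_γe_B contributes ω. -/
lemma normalPart_third (hU : IsOpen U) (γ α β : Fin 4) (A : Fin d) {x : Spacetime}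
    (hx : x ∈ slab U) : M.normalPart A x (pd γ (pd α (pd β M.Y)) x) =
      ∑ σ, M.christoffel σ α β x * M.k γ σ A x + pd γ (M.k α β A) x +
        ∑ B, M.k α β B x * M.conn γ A B x := by
  have hΓ (σ : Fin 4) := (M.smoothPer_christoffel hU σ α β).differentiableAt hU hx
  have hY (σ : Fin 4) := (M.smoothPer_pd_Y hU σ).differentiableAt hU hx
  have hk (B : Fin d) := (M.smoothPer_k hU α β B).differentiableAt hU hx
  have he (B : Fin d) := (M.smoothPer_e B).differentiableAt hU hx
  rw [pd_congr hU (fun z hz => M.pd_pd_Y hU α β hz) γ hx,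
    pd_add γ (DifferentiableAt.fun_sum fun σ _ => (hΓ σ).fun_smul (hY σ))
      (DifferentiableAt.fun_sum fun B _ => (hk B).fun_smul (he B)),
    pd_sum γ fun σ _ => (hΓ σ).fun_smul (hY σ), pd_sum γ fun B _ => (hk B).fun_smul (he B)]
  simp only [pd_smul γ (hΓ _) (hY _), pd_smul γ (hk _) (he _), Finset.sum_add_distrib,
    normalPart_add, normalPart_sum, M.normalPart_pd_Y A hx, M.normalPart_e A _ hx, mul_zero,
    Finset.sum_const_zero, mul_ite, mul_one, Finset.sum_ite_eq, Finset.mem_univ, if_true, add_zero]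
  simp only [k, conn]
  ring

/-- The Codazzi equation. -/
lemma codazzi (hU : IsOpen U) (c α γ : Fin 4) (A : Fin d) {x : Spacetime} (hx : x ∈ slab U) :
    pd c (M.k α γ A) x - pd α (M.k c γ A) x =
      (∑ σ, M.christoffel σ c γ x * M.k α σ A x + ∑ B, M.k c γ B x * M.conn α A B x) -
      (∑ σ, M.christoffel σ α γ x * M.k c σ A x + ∑ B, M.k α γ B x * M.conn c A B x) := by
  have h1 := M.normalPart_third hU c α γ A hx
  have h2 := M.normalPart_third hU α c γ A hx
  -- ∂_c∂_α∂_γY = ∂_α∂_c∂_γY, so `h1` and `h2` evaluate the same normal component.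
  rw [pd_comm c hU (M.smoothPer_pd_Y hU γ).smooth hx α] at h1
  linarith

end FramedImmersion

end MinimalSurface
end

noncomputable section

namespace MinimalSurface

open Filter Topology

/-! ### The Codazzi equation in terms of the monomials `g·∂g·k` and `ω·k` -/

/-- The coefficients of `∑_σ Γ^σ_{αγ} k^A_{cσ} + ∑_B ω^A_{cB} k^B_{αγ}` as a combination of
monomials. -/
def codazziHalf {d : ℕ} (c α γ : Fin 4) (A : Fin d) (s : SIdx d) : ℝ :=
  (∑ σ : Fin 4, ∑ ν : Fin 4,
    ((Pi.single (.inl (σ, ν, α, ν, γ, (c, σ, A))) (1 / 2) : SIdx d → ℝ) s +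
      (Pi.single (.inl (σ, ν, γ, ν, α, (c, σ, A))) (1 / 2) : SIdx d → ℝ) s -
      (Pi.single (.inl (σ, ν, ν, α, γ, (c, σ, A))) (1 / 2) : SIdx d → ℝ) s)) +
  ∑ B : Fin d, (Pi.single (.inr (c, A, B, (α, γ, B))) 1 : SIdx d → ℝ) s

/-- The coefficients of `∂_c k^A_{αγ} - ∂_α k^A_{cγ}` as a combination of monomials. -/
def codazziCoef {d : ℕ} (c α γ : Fin 4) (A : Fin d) (s : SIdx d) : ℝ :=
  codazziHalf α c γ A s - codazziHalf c α γ A s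

/-- The Christoffel part contributes at most 16 · 3/2 = 24. The ω part contributes at most 1, since
the monomial determines B. The bound is therefore independent of `d`, as the constant of the final
estimate must be. -/
lemma abs_codazziHalf_le {d : ℕ} (c α γ : Fin 4) (A : Fin d) (s : SIdx d) :
    |codazziHalf c α γ A s| ≤ 25 := by
  have h1 (i : SIdx d) (c : ℝ) : |(Pi.single i c : SIdx d → ℝ) s| ≤ |c| := by
    rw [Pi.single_apply]; split_ifs <;> simp
  have h2 : |∑ B : Fin d, (Pi.single (.inr (c, A, B, (α, γ, B))) 1 : SIdx d → ℝ) s| ≤ 1 := by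
    rcases s with s | ⟨c', A', B', p⟩
    · simp
    · refine (Finset.abs_sum_le_sum_abs _ _).trans ?_
      calc _ ≤ ∑ B : Fin d, if B' = B then (1 : ℝ) else 0 := by
            refine Finset.sum_le_sum fun B _ => ?_
            rw [Pi.single_apply]
            split_ifs with h h' h'
            · simp
            · exact absurd (by simp at h; exact h.2.2.1) h'
            · simp
            · simp
        _ = 1 := by simp
  refine (abs_add_le _ _).trans ?_
  have h3 : |∑ σ : Fin 4, ∑ ν : Fin 4,
      ((Pi.single (.inl (σ, ν, α, ν, γ, (c, σ, A))) (1 / 2) : SIdx d → ℝ) s +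
      (Pi.single (.inl (σ, ν, γ, ν, α, (c, σ, A))) (1 / 2) : SIdx d → ℝ) s -
      (Pi.single (.inl (σ, ν, ν, α, γ, (c, σ, A))) (1 / 2) : SIdx d → ℝ) s)| ≤
      ∑ σ : Fin 4, ∑ ν : Fin 4, (3 / 2 : ℝ) := by
    refine (Finset.abs_sum_le_sum_abs _ _).trans (Finset.sum_le_sum fun σ _ => ?_)
    refine (Finset.abs_sum_le_sum_abs _ _).trans (Finset.sum_le_sum fun ν _ => ?_)
    refine (abs_sub _ _).trans ?_
    have e := abs_of_pos (show (0 : ℝ) < 1 / 2 by norm_num)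
    have a1 := h1 (.inl (σ, ν, α, ν, γ, (c, σ, A))) (1 / 2)
    have a2 := h1 (.inl (σ, ν, γ, ν, α, (c, σ, A))) (1 / 2)
    have a3 := h1 (.inl (σ, ν, ν, α, γ, (c, σ, A))) (1 / 2)
    have a4 := abs_add_le ((Pi.single (.inl (σ, ν, α, ν, γ, (c, σ, A))) (1 / 2) : SIdx d → ℝ) s)
      ((Pi.single (.inl (σ, ν, γ, ν, α, (c, σ, A))) (1 / 2) : SIdx d → ℝ) s)
    rw [e] at a1 a2 a3
    linarith
  have h4 : ∑ σ : Fin 4, ∑ ν : Fin 4, (3 / 2 : ℝ) = 24 := by norm_num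
  linarith

lemma abs_codazziCoef_le {d : ℕ} (c α γ : Fin 4) (A : Fin d) (s : SIdx d) :
    |codazziCoef c α γ A s| ≤ 50 := by
  have := abs_codazziHalf_le c α γ A s
  have := abs_codazziHalf_le α c γ A s
  exact (abs_sub _ _).trans (by linarith)

lemma sum_single_combination {ι : Type*} [Fintype ι] [DecidableEq ι] {m n : Type*} [Fintype m]
    [Fintype n] (a b c : m → m → ι) (e : n → ι) (q : ℝ) (F : ι → ℂ) :
    ∑ s, (((∑ σ, ∑ ν, ((Pi.single (a σ ν) q : ι → ℝ) s + (Pi.single (b σ ν) q : ι → ℝ) s -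
      (Pi.single (c σ ν) q : ι → ℝ) s)) + ∑ B, (Pi.single (e B) 1 : ι → ℝ) s : ℝ) : ℂ) * F s =
    ∑ σ, ∑ ν, (q * F (a σ ν) + q * F (b σ ν) - q * F (c σ ν)) + ∑ B, F (e B) := by
  have h1 (i : ι) (c : ℝ) : ∑ s, (((Pi.single i c : ι → ℝ) s : ℝ) : ℂ) * F s = c * F i := by
    rw [Finset.sum_eq_single i]
    · simp
    · intro j _ hj; simp [hj]
    · simp
  simp only [Complex.ofReal_add, Complex.ofReal_sum, Complex.ofReal_sub, add_mul,
    sub_mul, Finset.sum_mul, Finset.sum_add_distrib]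
  congr 1
  · rw [Finset.sum_comm]
    refine Finset.sum_congr rfl fun σ _ => ?_
    rw [Finset.sum_comm]
    simp only [Finset.sum_sub_distrib, Finset.sum_add_distrib, h1]
  · rw [Finset.sum_comm]
    refine Finset.sum_congr rfl fun B _ => ?_
    rw [h1]
    simp

namespace FramedImmersion

variable {d : ℕ} {U : Set ℝ} (M : FramedImmersion d U)

lemma sum_codazziHalf (c α γ : Fin 4) (A : Fin d) (x : Spacetime) :
    ∑ s, (codazziHalf c α γ A s : ℂ) * M.sourceField s x =
      ((∑ σ, M.christoffel σ α γ x * M.k c σ A x + ∑ B, M.k α γ B x * M.conn c A B x : ℝ) : ℂ) := by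
  refine (sum_single_combination (fun σ ν : Fin 4 => (.inl (σ, ν, α, ν, γ, (c, σ, A)) : SIdx d))
    (fun σ ν => .inl (σ, ν, γ, ν, α, (c, σ, A))) (fun σ ν => .inl (σ, ν, ν, α, γ, (c, σ, A)))
    (fun B : Fin d => .inr (c, A, B, (α, γ, B))) (1 / 2) fun s => M.sourceField s x).trans ?_
  rw [Complex.ofReal_add, Complex.ofReal_sum, Complex.ofReal_sum]
  congr 1
  · refine Finset.sum_congr rfl fun σ _ => ?_
    rw [christoffel, Finset.sum_mul, Complex.ofReal_sum]
    refine Finset.sum_congr rfl fun ν _ => ?_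
    simp only [sourceField, gdgField, kField]
    push_cast
    ring
  · refine Finset.sum_congr rfl fun B _ => ?_
    simp only [sourceField, connField, kField]
    push_cast
    ring

lemma codazzi_kField (hU : IsOpen U) (c α γ : Fin 4) (A : Fin d) {x : Spacetime}
    (hx : x ∈ slab U) : pd c (M.kField (α, γ, A)) x = pd α (M.kField (c, γ, A)) x +
      ∑ s, (codazziCoef c α γ A s : ℂ) * M.sourceField s x := by
  have e (c α : Fin 4) : pd c (M.kField (α, γ, A)) x = ((pd c (M.k α γ A) x : ℝ) : ℂ) :=
    pd_ofReal c ((M.smoothPer_k hU α γ A).differentiableAt hU hx)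
  simp only [codazziCoef, Complex.ofReal_sub, sub_mul, Finset.sum_sub_distrib, sum_codazziHalf]
  rw [e, e, ← Complex.ofReal_sub, ← M.codazzi hU c α γ A hx]
  push_cast
  ring

end FramedImmersion

/-! ### Dilated symbols -/

/-- Smooth functions supported in the annulus `1/16 ≤ |ξ| ≤ 8`. -/
structure IsAnnular (h : Freq → ℂ) : Prop where
  smooth : ContDiff ℝ ∞ h
  eq_zero_of_lt : ∀ ξ, ‖ξ‖ < 1 / 16 → h ξ = 0
  eq_zero_of_gt : ∀ ξ, 8 < ‖ξ‖ → h ξ = 0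

/-- The symbol `2^{rj} h(2^{-j} ξ)`. -/
def scaledSymbol (r : ℤ) (h : Freq → ℂ) (j : ℕ) (ξ : Freq) : ℂ :=
  (((2 : ℝ) ^ j) ^ r : ℝ) * h (((2 : ℝ) ^ j)⁻¹ • ξ)

lemma IsAnnular.hasCompactSupport {h : Freq → ℂ} (hh : IsAnnular h) : HasCompactSupport h := by
  refine HasCompactSupport.of_support_subset_isCompact (isCompact_closedBall (0 : Freq) 8)
    fun ξ hξ => ?_
  rw [mem_closedBall_zero_iff]
  by_contra h8
  exact hξ (hh.eq_zero_of_gt ξ (not_le.mp h8))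

lemma IsAnnular.isSymbolFamily {h : Freq → ℂ} (hh : IsAnnular h) (r : ℤ) :
    IsSymbolFamily r (scaledSymbol r h) where
  smooth j := contDiff_const.mul (hh.smooth.comp (contDiff_const_smul _))
  bound l := by
    obtain ⟨D, hD⟩ := ((hh.hasCompactSupport.iteratedFDeriv (𝕜 := ℝ) l).isCompact_range
      (hh.smooth.continuous_iteratedFDeriv (m := l) (by exact_mod_cast le_top))).isBounded.exists_norm_le
    have hD0 : 0 ≤ D := (norm_nonneg _).trans (hD _ ⟨0, rfl⟩)
    -- On the annulus 2^j ≤ 16(1 + |ξ|) and 1 + |ξ| ≤ 16 · 2^j. Hence a power of 2^j may be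
    -- exchanged for the same power of 1 + |ξ|, whatever the sign of the exponent.
    refine ⟨D * 16 ^ |r - l|, fun j ξ => ?_⟩
    have hj : (0 : ℝ) < 2 ^ j := by positivity
    have e : iteratedFDeriv ℝ l (scaledSymbol r h j) ξ =
        (((2 : ℝ) ^ j) ^ r * ((2 : ℝ) ^ j)⁻¹ ^ l) •
          iteratedFDeriv ℝ l h (((2 : ℝ) ^ j)⁻¹ • ξ) := by
      have h1 : scaledSymbol r h j = fun ξ => (((2 : ℝ) ^ j) ^ r : ℝ) •
          (fun ξ => h (((2 : ℝ) ^ j)⁻¹ • ξ)) ξ := by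
        ext ξ; simp [scaledSymbol]
      have h2 : ContDiff ℝ l fun ξ => h (((2 : ℝ) ^ j)⁻¹ • ξ) :=
        (hh.smooth.comp (contDiff_const_smul _)).of_le (by exact_mod_cast le_top)
      rw [h1, iteratedFDeriv_const_smul_apply' h2.contDiffAt,
        iteratedFDeriv_comp_const_smul _ (hh.smooth.of_le (by exact_mod_cast le_top)), smul_smul]
    have hn : ‖((2 : ℝ) ^ j)⁻¹ • ξ‖ = ‖ξ‖ / 2 ^ j := by
      rw [norm_smul, norm_inv, Real.norm_of_nonneg hj.le, inv_mul_eq_div]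
    rw [e, norm_smul, Real.norm_of_nonneg (by positivity)]
    by_cases hsupp : 1 / 16 ≤ ‖((2 : ℝ) ^ j)⁻¹ • ξ‖ ∧ ‖((2 : ℝ) ^ j)⁻¹ • ξ‖ ≤ 8
    · rw [hn, le_div_iff₀ hj, div_le_iff₀ hj] at hsupp
      have hpow : ((2 : ℝ) ^ j) ^ r * ((2 : ℝ) ^ j)⁻¹ ^ l = ((2 : ℝ) ^ j) ^ (r - l) := by
        rw [zpow_sub₀ hj.ne', zpow_natCast, inv_pow, div_eq_mul_inv]
      have h1 : (1 : ℝ) ≤ 2 ^ j := one_le_pow₀ (by norm_num)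
      have key : ((2 : ℝ) ^ j) ^ (r - l) ≤ 16 ^ |r - l| * (1 + ‖ξ‖) ^ (r - l) := by
        rcases le_total 0 (r - (l : ℤ)) with h | h
        · rw [abs_of_nonneg h, ← mul_zpow]
          exact zpow_le_zpow_left₀ h hj.le (by nlinarith)
        · rw [abs_of_nonpos h]
          have h2 : ((1 + ‖ξ‖) / 16) ^ (-(r - (l : ℤ))) ≤ ((2 : ℝ) ^ j) ^ (-(r - (l : ℤ))) :=
            zpow_le_zpow_left₀ (by omega) (by positivity) (by linarith)
          rw [zpow_neg, zpow_neg] at h2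
          have h3 := inv_anti₀ (by positivity) h2
          rw [inv_inv, inv_inv, div_zpow] at h3
          rwa [zpow_neg, inv_mul_eq_div]
      rw [hpow, mul_comm, mul_assoc]
      exact mul_le_mul (hD _ ⟨_, rfl⟩) key (by positivity) hD0
    · have : iteratedFDeriv ℝ l h (((2 : ℝ) ^ j)⁻¹ • ξ) = 0 := by
        by_contra hne
        have hmem := support_iteratedFDeriv_subset (𝕜 := ℝ) (f := h) l hne
        have hcl : IsClosed {ξ : Freq | 1 / 16 ≤ ‖ξ‖ ∧ ‖ξ‖ ≤ 8} :=
          (isClosed_le continuous_const continuous_norm).inter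
            (isClosed_le continuous_norm continuous_const)
        refine hsupp (closure_minimal (fun ξ hξ => ?_) hcl hmem)
        by_contra hcon
        rw [Set.mem_ofPred_eq, not_and_or, not_le, not_le] at hcon
        exact hξ (hcon.elim (hh.eq_zero_of_lt ξ) (hh.eq_zero_of_gt ξ))
      rw [this, norm_zero, mul_zero]
      positivity

lemma isSymbolFamily_one : IsSymbolFamily 0 fun _ _ => 1 where
  smooth _ := contDiff_const
  bound l := by
    refine ⟨1, fun j ξ => ?_⟩
    rcases Nat.eq_zero_or_pos l with rfl | hl
    · simp
    · rw [iteratedFDeriv_const_of_ne (by omega)]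
      simp only [Pi.zero_apply, norm_zero]
      positivity

lemma IsSymbolFamily.const_mul {r : ℤ} {σ : ℕ → Freq → ℂ} (h : IsSymbolFamily r σ) (c : ℂ) :
    IsSymbolFamily r fun j ξ => c * σ j ξ where
  smooth j := contDiff_const.mul (h.smooth j)
  bound l := by
    obtain ⟨C, hC⟩ := h.bound l
    refine ⟨‖c‖ * C, fun j ξ => ?_⟩
    have : iteratedFDeriv ℝ l (fun ξ => c * σ j ξ) ξ = c • iteratedFDeriv ℝ l (σ j) ξ :=
      iteratedFDeriv_const_smul_apply' (a := c)
        ((h.smooth j).of_le (by exact_mod_cast le_top)).contDiffAt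
    rw [this, norm_smul, mul_assoc]
    exact mul_le_mul_of_nonneg_left (hC j ξ) (norm_nonneg c)

/-- A bump function equal to `1` for `1/8 ≤ |ξ| ≤ 7` and supported in `1/16 ≤ |ξ| ≤ 8`. -/
def fatBump (ξ : Freq) : ℝ :=
  (⟨7, 8, by norm_num, by norm_num⟩ : ContDiffBump (0 : Freq)) ξ -
    (⟨1 / 16, 1 / 8, by norm_num, by norm_num⟩ : ContDiffBump (0 : Freq)) ξ

lemma contDiff_fatBump : ContDiff ℝ ∞ fatBump := (ContDiffBump.contDiff _).sub (ContDiffBump.contDiff _)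

lemma fatBump_eq_one {ξ : Freq} (h1 : 1 / 8 ≤ ‖ξ‖) (h2 : ‖ξ‖ ≤ 7) : fatBump ξ = 1 := by
  rw [fatBump, ContDiffBump.one_of_mem_closedBall _ (by simpa using h2),
    ContDiffBump.zero_of_le_dist _ (by simpa using h1), sub_zero]

lemma fatBump_eq_zero_of_le {ξ : Freq} (h : ‖ξ‖ ≤ 1 / 16) : fatBump ξ = 0 := by
  rw [fatBump, ContDiffBump.one_of_mem_closedBall _ (by simp; linarith),
    ContDiffBump.one_of_mem_closedBall _ (by simpa using h), sub_self]

lemma fatBump_eq_zero_of_ge {ξ : Freq} (h : 8 ≤ ‖ξ‖) : fatBump ξ = 0 := by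
  rw [fatBump, ContDiffBump.zero_of_le_dist _ (by simpa using h),
    ContDiffBump.zero_of_le_dist _ (by simp; linarith), sub_self]

lemma isAnnular_fatBump : IsAnnular fun ξ => (fatBump ξ : ℂ) where
  smooth := Complex.ofRealCLM.contDiff.comp contDiff_fatBump
  eq_zero_of_lt ξ h := by rw [fatBump_eq_zero_of_le h.le, Complex.ofReal_zero]
  eq_zero_of_gt ξ h := by rw [fatBump_eq_zero_of_ge h.le, Complex.ofReal_zero]

/-- The symbol `ξ_i / (2πi |ξ|²)` of `∂_i Δ⁻¹`, cut off to an annulus. -/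
def gradInvSymbol (i : Fin 3) (ξ : Freq) : ℂ :=
  (fatBump ξ / ‖ξ‖ ^ 2 * ξ i : ℝ) * (2 * Real.pi * Complex.I)⁻¹

lemma contDiff_of_vanish_near_zero {V E : Type*} [NormedAddCommGroup V] [NormedSpace ℝ V]
    [NormedAddCommGroup E] [NormedSpace ℝ E]
    {f : V → E} (h : ∀ ξ, ‖ξ‖ < 1 / 16 → f ξ = 0) (h' : ∀ ξ ≠ 0, ContDiffAt ℝ ∞ f ξ) :
    ContDiff ℝ ∞ f := by
  rw [contDiff_iff_contDiffAt]
  intro ξ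
  by_cases hξ : ξ = 0
  · subst hξ
    refine (contDiffAt_const (c := (0 : E))).congr_of_eventuallyEq ?_
    filter_upwards [Metric.ball_mem_nhds (0 : V) (show (0 : ℝ) < 1 / 16 by norm_num)]
      with η hη using h η (by simpa using hη)
  · exact h' ξ hξ

lemma isAnnular_gradInvSymbol (i : Fin 3) : IsAnnular (gradInvSymbol i) where
  smooth := by
    refine ContDiff.mul (Complex.ofRealCLM.contDiff.comp ?_) contDiff_const
    refine contDiff_of_vanish_near_zero (fun ξ h => ?_) fun ξ h => ?_
    · show fatBump ξ / ‖ξ‖ ^ 2 * ξ i = 0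
      simp [fatBump_eq_zero_of_le h.le]
    · refine ContDiffAt.mul (contDiff_fatBump.contDiffAt.div ?_ ?_) ?_
      · exact (contDiff_norm_sq ℝ).contDiffAt
      · simpa using h
      · exact (EuclideanSpace.proj (𝕜 := ℝ) i).contDiff.contDiffAt
  eq_zero_of_lt ξ h := by simp [gradInvSymbol, fatBump_eq_zero_of_le h.le]
  eq_zero_of_gt ξ h := by simp [gradInvSymbol, fatBump_eq_zero_of_ge h.le]

/-- The order `0` symbol of `∂_a ∂_i Δ⁻¹`, cut off to an annulus. -/
def rieszSymbol (a i : Fin 3) (ξ : Freq) : ℂ :=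
  gradInvSymbol i ξ * (2 * Real.pi * Complex.I * (ξ a : ℝ))

lemma IsAnnular.mul_smooth {h f : Freq → ℂ} (hh : IsAnnular h) (hf : ContDiff ℝ ∞ f) :
    IsAnnular fun ξ => h ξ * f ξ where
  smooth := hh.smooth.mul hf
  eq_zero_of_lt ξ hξ := by rw [hh.eq_zero_of_lt ξ hξ, zero_mul]
  eq_zero_of_gt ξ hξ := by rw [hh.eq_zero_of_gt ξ hξ, zero_mul]

lemma isAnnular_rieszSymbol (a i : Fin 3) : IsAnnular (rieszSymbol a i) :=
  (isAnnular_gradInvSymbol i).mul_smooth (contDiff_const.mul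
    (Complex.ofRealCLM.contDiff.comp (EuclideanSpace.proj (𝕜 := ℝ) a).contDiff))

/-- The factor ξ_a equals 2^j times its rescaled value, which cancels the prefactor 2^{-j}: a
spatial derivative raises the order from −1 to 0. -/
lemma scaledSymbol_gradInv_mul (a i : Fin 3) (j : ℕ) (ξ : Freq) :
    scaledSymbol (-1) (gradInvSymbol i) j ξ * (2 * Real.pi * Complex.I * (ξ a : ℝ)) =
      scaledSymbol 0 (rieszSymbol a i) j ξ := by
  simp only [scaledSymbol, rieszSymbol, zpow_neg, zpow_one, zpow_zero, PiLp.smul_apply, smul_eq_mul]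
  push_cast
  ring

/-- Where the cut-off equals 1 this is ∑ η_i²/|η|² = 1, that is, ∑_i ∂_i∂_iΔ⁻¹ is the identity. -/
lemma sum_rieszSymbol {j : ℕ} {ξ : Freq} (h1 : 1 / 8 ≤ ‖ξ‖ / 2 ^ j) (h2 : ‖ξ‖ / 2 ^ j ≤ 7) :
    ∑ i, scaledSymbol 0 (rieszSymbol i i) j ξ = 1 := by
  have hj : (0 : ℝ) < 2 ^ j := by positivity
  simp only [scaledSymbol, zpow_zero, Complex.ofReal_one, one_mul]
  have hn : ‖((2 : ℝ) ^ j)⁻¹ • ξ‖ = ‖ξ‖ / 2 ^ j := by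
    rw [norm_smul, norm_inv, Real.norm_of_nonneg hj.le, inv_mul_eq_div]
  rw [← hn] at h1 h2
  generalize ((2 : ℝ) ^ j)⁻¹ • ξ = η at h1 h2
  have hpi : (2 * Real.pi * Complex.I : ℂ) ≠ 0 := Complex.two_pi_I_ne_zero
  have e (i : Fin 3) : rieszSymbol i i η = ((η i ^ 2 / ‖η‖ ^ 2 : ℝ) : ℂ) := by
    rw [rieszSymbol, gradInvSymbol, fatBump_eq_one h1 h2]
    push_cast
    field_simp
  simp only [e]
  rw [← Complex.ofReal_sum, ← Finset.sum_div]
  have : ‖η‖ ^ 2 = ∑ i, η i ^ 2 := by simp [EuclideanSpace.norm_sq_eq]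
  rw [← this, div_self (by positivity), Complex.ofReal_one]

/-! ### Supports of the Littlewood--Paley symbols -/

section LPSymbol

variable {φ : ℝ → ℝ}

lemma lpSymbol_support (hφ : IsCutoff φ) {j : ℕ} (hj : 1 ≤ j) {ξ : Freq} (h : lpSymbol φ j ξ ≠ 0) :
    3 / 4 ≤ ‖ξ‖ / 2 ^ j ∧ ‖ξ‖ / 2 ^ j ≤ 7 / 4 := by
  rw [lpSymbol, if_neg (by omega), mul_div_assoc] at h
  have h0 : 0 ≤ ‖ξ‖ / 2 ^ j := by positivity
  constructor
  · by_contra hlt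
    rw [hφ.eq_one _ (by linarith), hφ.eq_one _ (by linarith)] at h
    simp at h
  · by_contra hlt
    rw [hφ.eq_zero _ (by linarith), hφ.eq_zero _ (by linarith)] at h
    simp at h

lemma finiteSymbol_lpSymbol (hφ : IsCutoff φ) (j : ℕ) : FiniteSymbol (lpSymbol φ j) := by
  refine FiniteSymbol.of_support (R := 2 * 2 ^ j) fun ξ hξ => ?_
  have hj : (0 : ℝ) < 2 ^ j := by positivity
  by_cases h : j = 0
  · subst h
    rw [lpSymbol, if_pos rfl, hφ.eq_zero _ (by simp at hξ; linarith), Complex.ofReal_zero]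
  · by_contra hne
    have := (lpSymbol_support hφ (by omega) hne).2
    rw [div_le_iff₀ hj] at this
    linarith

/-- Changing the dyadic index by at most 2 costs a factor 4 in the support bounds 3/4 and 7/4, which
stays inside the region where `fatBump` equals 1. All multipliers can thus be normalised at the
single scale 2^{j'}. -/
lemma lpSymbol_support_near (hφ : IsCutoff φ) {j j' : ℕ} (hj : 1 ≤ j) (h1 : j ≤ j' + 2) (h2 : j' ≤ j + 2) {ξ : Freq}
    (h : lpSymbol φ j ξ ≠ 0) : 1 / 8 ≤ ‖ξ‖ / 2 ^ j' ∧ ‖ξ‖ / 2 ^ j' ≤ 7 := by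
  have hs := lpSymbol_support hφ hj h
  have e1 : (2 : ℝ) ^ j ≤ 4 * 2 ^ j' := by
    calc (2 : ℝ) ^ j ≤ 2 ^ (j' + 2) := pow_le_pow_right₀ (by norm_num) h1
      _ = _ := by ring
  have e2 : (2 : ℝ) ^ j' ≤ 4 * 2 ^ j := by
    calc (2 : ℝ) ^ j' ≤ 2 ^ (j + 2) := pow_le_pow_right₀ (by norm_num) h2
      _ = _ := by ring
  have p1 : (0 : ℝ) < 2 ^ j := by positivity
  have p2 : (0 : ℝ) < 2 ^ j' := by positivity
  rw [le_div_iff₀ p1, div_le_iff₀ p1] at hs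
  rw [le_div_iff₀ p2, div_le_iff₀ p2]
  constructor <;> linarith

end LPSymbol

end MinimalSurface
end

noncomputable section

namespace MinimalSurface

open Filter Topology

/-! ### Potentials of frequency localised solutions of the Codazzi equation -/

lemma IsAnnular.finiteSymbol {h : Freq → ℂ} (hh : IsAnnular h) (r : ℤ) (j : ℕ) :
    FiniteSymbol (scaledSymbol r h j) := by
  refine FiniteSymbol.of_support (R := 8 * 2 ^ j) fun ξ hξ => ?_
  have hj : (0 : ℝ) < 2 ^ j := by positivity
  rw [scaledSymbol, hh.eq_zero_of_gt _ ?_, mul_zero]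
  rw [norm_smul, norm_inv, Real.norm_of_nonneg hj.le, inv_mul_eq_div, lt_div_iff₀ hj]
  exact hξ

/-- The symbol of `∂_i Δ⁻¹` near frequency `2^j`. -/
abbrev gradInv (i : Fin 3) (j : ℕ) : Freq → ℂ := scaledSymbol (-1) (gradInvSymbol i) j

lemma finiteSymbol_gradInv (i : Fin 3) (j : ℕ) : FiniteSymbol (gradInv i j) :=
  (isAnnular_gradInvSymbol i).finiteSymbol _ _

/-! ### Algebra of multipliers and Littlewood–Paley projections. -/

section

variable {U : Set ℝ}

lemma mult_congr_symbol {σ τ : Freq → ℂ} (h : ∀ ξ, σ ξ = τ ξ) (f : Field) : mult σ f = mult τ f := by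
  rw [funext h]

lemma mult_const_mul (c : ℂ) (σ : Freq → ℂ) (f : Field) :
    mult (fun ξ => c * σ ξ) f = fun x => c * mult σ f x := by
  ext x
  simp only [mult_eq_tsum, ← tsum_mul_left, mul_assoc]

lemma fourierCoef_const_mul (c : ℂ) (f : Field) (t : ℝ) (ξ : Fin 3 → ℤ) :
    fourierCoef (fun x => c * f x) t ξ = c * fourierCoef f t ξ := by
  simp only [fourierCoef_eq, coef_const_mul]

lemma mult_field_const_mul (c : ℂ) (σ : Freq → ℂ) (f : Field) :
    mult σ (fun x => c * f x) = fun x => c * mult σ f x := by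
  ext x
  simp only [mult_eq_tsum, ← tsum_mul_left, fourierCoef_const_mul]
  exact tsum_congr fun ξ => by ring

lemma FiniteSymbol.mult_sum_symbol {ι : Type*} {s : Finset ι} {σ : ι → Freq → ℂ}
    (h : ∀ i ∈ s, FiniteSymbol (σ i)) (f : Field) (x : Spacetime) :
    mult (fun ξ => ∑ i ∈ s, σ i ξ) f x = ∑ i ∈ s, mult (σ i) f x := by
  simp only [mult_eq_tsum, Finset.sum_mul]
  refine Summable.tsum_finsetSum fun i hi => ?_
  refine summable_of_hasFiniteSupport ((h i hi).subset fun ξ hξ h0 => hξ ?_)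
  simp [h0]

lemma mult_add (hU : IsOpen U) {f g : Field} (hf : SmoothPer U f) (hg : SmoothPer U g)
    {σ : Freq → ℂ} (hσ : ModerateSymbol σ) {x : Spacetime} (hx : x ∈ slab U) :
    mult σ (fun x => f x + g x) x = mult σ f x + mult σ g x := by
  have := mult_sum hU (s := Finset.univ) (f := ![f, g]) (fun _ => 1)
    (fun i _ => by fin_cases i <;> assumption) hσ hx
  simpa using this

variable {φ : ℝ → ℝ} (hφ : IsCutoff φ)

lemma SmoothPer.LP (hφ : IsCutoff φ) (hU : IsOpen U) {f : Field} (hf : SmoothPer U f) (j : ℕ) :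
    SmoothPer U (LP φ j f) := hf.mult hU (finiteSymbol_lpSymbol hφ j)

lemma SmoothPer.congr_LP (hφ : IsCutoff φ) (hU : IsOpen U) {f : Field} (hf : SmoothPer U f)
    {σ : Freq → ℂ} (hσ : ModerateSymbol σ) (j : ℕ) :
    SmoothPer U (MinimalSurface.LP φ j (MinimalSurface.mult σ f)) :=
  (hf.mult hU ((finiteSymbol_lpSymbol hφ j).mul_right σ)).congr
    fun _ hx => mult_mult hU hf hσ _ hx

lemma pd_LP_mult (hφ : IsCutoff φ) (hU : IsOpen U) {f : Field} (hf : SmoothPer U f)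
    {σ : Freq → ℂ} (hσ : ModerateSymbol σ) (j : ℕ) (α : Fin 4) {x : Spacetime} (hx : x ∈ slab U) :
    pd α (LP φ j (mult σ f)) x = mult (fun ξ => lpSymbol φ j ξ * σ ξ) (pd α f) x := by
  have h : Set.EqOn (LP φ j (mult σ f)) (mult (fun ξ => lpSymbol φ j ξ * σ ξ) f) (slab U) :=
    fun z hz => mult_mult hU hf hσ (lpSymbol φ j) hz
  rw [pd_congr hU h α hx, pd_mult hU hf ((finiteSymbol_lpSymbol hφ j).mul_right σ) α hx]

lemma LP_mult_one (hU : IsOpen U) {f : Field} (hf : SmoothPer U f) (j : ℕ) {x : Spacetime}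
    (hx : x ∈ slab U) : LP φ j (mult (fun _ => 1) f) x = LP φ j f x :=
  mult_congr_on (fun _ hz => mult_one hU hf hz) _ hx

/-- A factor `2^{j'}` can be moved to the symbol. -/
lemma LP_mult_fatBump (hφ : IsCutoff φ) (hU : IsOpen U) {f : Field} (hf : SmoothPer U f)
    {j j' : ℕ} (hj : 1 ≤ j) (h1 : j ≤ j' + 2) (h2 : j' ≤ j + 2) {x : Spacetime} (hx : x ∈ slab U) :
    LP φ j (mult (scaledSymbol (-1) (fun ξ => fatBump ξ) j') f) x =
      ((2 : ℂ) ^ j')⁻¹ * LP φ j f x := by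
  have hp : (0 : ℝ) < 2 ^ j' := by positivity
  rw [LP, mult_mult hU hf (isAnnular_fatBump.finiteSymbol _ _).moderate _ hx]
  have : ∀ ξ, lpSymbol φ j ξ * scaledSymbol (-1) (fun ξ => (fatBump ξ : ℂ)) j' ξ =
      ((2 : ℂ) ^ j')⁻¹ * lpSymbol φ j ξ := fun ξ => by
    by_cases h : lpSymbol φ j ξ = 0
    · simp [h]
    · obtain ⟨h3, h4⟩ := lpSymbol_support_near hφ hj h1 h2 h
      have hn : ‖((2 : ℝ) ^ j')⁻¹ • ξ‖ = ‖ξ‖ / 2 ^ j' := by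
        rw [norm_smul, norm_inv, Real.norm_of_nonneg hp.le, inv_mul_eq_div]
      rw [scaledSymbol, fatBump_eq_one (by rwa [hn]) (by rwa [hn])]
      push_cast
      rw [zpow_neg, zpow_one]
      ring
  rw [mult_congr_symbol this, mult_const_mul]
  rfl

lemma mult_scaledSymbol_zero (h : Freq → ℂ) (j : ℕ) (f : Field) :
    mult (scaledSymbol 0 h j) f = fun x => (2 : ℂ) ^ j * mult (scaledSymbol (-1) h j) f x := by
  rw [← mult_const_mul]
  refine mult_congr_symbol (fun ξ => ?_) f
  have : (2 : ℂ) ^ j ≠ 0 := pow_ne_zero _ two_ne_zero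
  simp only [scaledSymbol, zpow_zero, zpow_neg, zpow_one]
  push_cast
  field_simp

end

namespace FramedImmersion

variable {d : ℕ} {U : Set ℝ} (M : FramedImmersion d U)

/-- The summands of the potential of `P_j k^B_{αγ}`. -/
def potTerm (φ : ℝ → ℝ) (j' j : ℕ) (γ : Fin 4) (B : Fin d) (i : Fin 3) : Field :=
  LP φ j (mult (gradInv i j') (M.kField (i.succ, γ, B)))

/-- The potential of `P_j k^B_{αγ}`. -/
def pot (φ : ℝ → ℝ) (j' j : ℕ) (γ : Fin 4) (B : Fin d) : Field :=
  fun x => ∑ i, M.potTerm φ j' j γ B i x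

/-- The constituents of the error term in `P_j k^B_{αγ} = ∂_α Φ_γ + E_{αγ}`. -/
def errTerm (φ : ℝ → ℝ) (j' j : ℕ) (i : Fin 3) (s : SIdx d) : Field :=
  LP φ j (mult (gradInv i j') (M.sourceField s))

/-- The error term in `P_j k^B_{αγ} = ∂_α Φ_γ + E_{αγ}`. -/
def potErr (φ : ℝ → ℝ) (j' j : ℕ) (α γ : Fin 4) (B : Fin d) : Field :=
  fun x => ∑ i : Fin 3, ∑ s, (codazziCoef i.succ α γ B s : ℂ) * M.errTerm φ j' j i s x

variable {φ : ℝ → ℝ}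

lemma smoothPer_potTerm (hφ : IsCutoff φ) (hU : IsOpen U) (j' j : ℕ) (γ : Fin 4) (B : Fin d)
    (i : Fin 3) : SmoothPer U (M.potTerm φ j' j γ B i) :=
  SmoothPer.congr_LP hφ hU (M.smoothPer_kField hU _) (finiteSymbol_gradInv i j').moderate j

lemma smoothPer_pot (hφ : IsCutoff φ) (hU : IsOpen U) (j' j : ℕ) (γ : Fin 4) (B : Fin d) :
    SmoothPer U (M.pot φ j' j γ B) :=
  SmoothPer.sum fun i _ => M.smoothPer_potTerm hφ hU j' j γ B i

lemma smoothPer_errTerm (hφ : IsCutoff φ) (hU : IsOpen U) (j' j : ℕ) (i : Fin 3) (s : SIdx d) :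
    SmoothPer U (M.errTerm φ j' j i s) :=
  SmoothPer.congr_LP hφ hU (M.smoothPer_sourceField hU s) (finiteSymbol_gradInv i j').moderate j

lemma smoothPer_potErr (hφ : IsCutoff φ) (hU : IsOpen U) (j' j : ℕ) (α γ : Fin 4) (B : Fin d) :
    SmoothPer U (M.potErr φ j' j α γ B) :=
  SmoothPer.sum fun i _ => SmoothPer.sum fun s _ =>
    (SmoothPer.const _).mul (M.smoothPer_errTerm hφ hU j' j i s)

lemma smoothPer_projK (hφ : IsCutoff φ) (hU : IsOpen U) (j : ℕ) (α γ : Fin 4) (B : Fin d) :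
    SmoothPer U (M.projK φ j α γ B) := SmoothPer.LP hφ hU (M.smoothPer_kField hU _) j

lemma projK_comm (hU : IsOpen U) (j : ℕ) (α γ : Fin 4) (B : Fin d) {x : Spacetime}
    (hx : x ∈ slab U) : M.projK φ j α γ B x = M.projK φ j γ α B x :=
  mult_congr_on (fun z hz => by simp only [kField]; rw [M.k_comm hU α γ B hz]) _ hx

/-- Frequency localised Codazzi equation. -/
lemma pd_projK (hφ : IsCutoff φ) (hU : IsOpen U) (j : ℕ) (c α γ : Fin 4) (B : Fin d)
    {x : Spacetime} (hx : x ∈ slab U) :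
    pd c (M.projK φ j α γ B) x = pd α (M.projK φ j c γ B) x +
      ∑ s, (codazziCoef c α γ B s : ℂ) * LP φ j (M.sourceField s) x := by
  have hfin := finiteSymbol_lpSymbol hφ j
  simp only [projK, LP]
  rw [pd_mult hU (M.smoothPer_kField hU _) hfin c hx, pd_mult hU (M.smoothPer_kField hU _) hfin α hx,
    mult_congr_on (fun z hz => M.codazzi_kField hU c α γ B hz) _ hx,
    mult_add hU ((M.smoothPer_kField hU _).pd hU α) (SmoothPer.sum fun s _ =>
      (SmoothPer.const _).mul (M.smoothPer_sourceField hU s)) hfin.moderate hx,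
    mult_sum hU _ (fun s _ => M.smoothPer_sourceField hU s) hfin.moderate hx]

/-- The frequency localised second fundamental form is a gradient up to an error. -/
lemma projK_eq (hφ : IsCutoff φ) (hU : IsOpen U) {j j' : ℕ} (hj : 1 ≤ j) (h1 : j ≤ j' + 2)
    (h2 : j' ≤ j + 2) (α γ : Fin 4) (B : Fin d) {x : Spacetime} (hx : x ∈ slab U) :
    M.projK φ j α γ B x = pd α (M.pot φ j' j γ B) x + M.potErr φ j' j α γ B x := by
  have hfin := finiteSymbol_lpSymbol hφ j
  have hk := M.smoothPer_kField hU
  have hs := M.smoothPer_sourceField hU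
  -- The identity ∑_i ∂_i∂_iΔ⁻¹ = 1 is inserted on the support of P_j.
  have e1 : ∀ ξ, lpSymbol φ j ξ = ∑ i, lpSymbol φ j ξ * scaledSymbol 0 (rieszSymbol i i) j' ξ := by
    intro ξ
    by_cases h : lpSymbol φ j ξ = 0
    · simp [h]
    · obtain ⟨h3, h4⟩ := lpSymbol_support_near hφ hj h1 h2 h
      rw [← Finset.mul_sum, sum_rieszSymbol h3 h4, _root_.mul_one]
  have e2 (i : Fin 3) : mult (fun ξ => lpSymbol φ j ξ * scaledSymbol 0 (rieszSymbol i i) j' ξ)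
      (M.kField (α, γ, B)) x = pd α (M.potTerm φ j' j γ B i) x +
        ∑ s, (codazziCoef i.succ α γ B s : ℂ) * M.errTerm φ j' j i s x := by
    have hmod := (finiteSymbol_gradInv i j').moderate
    have hfin2 : FiniteSymbol fun ξ => lpSymbol φ j ξ * gradInv i j' ξ := hfin.mul_right _
    have e3 : ∀ ξ, lpSymbol φ j ξ * scaledSymbol 0 (rieszSymbol i i) j' ξ =
        (lpSymbol φ j ξ * gradInv i j' ξ) * (2 * Real.pi * Complex.I * (ξ i : ℝ)) := fun ξ => by
      rw [← scaledSymbol_gradInv_mul, ← mul_assoc (lpSymbol φ j ξ)]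
    -- One factor of the symbol is read as ∂_i acting on k_{αγ}, and Codazzi exchanges ∂_i k_{αγ}
    -- for ∂_α k_{iγ}. The derivative ∂_α then comes out of the multiplier, for α = 0 as well.
    rw [mult_congr_symbol e3, ← mult_pd_succ hU (hk _) (fun ξ => lpSymbol φ j ξ * gradInv i j' ξ) i hx,
      mult_congr_on (fun z hz => M.codazzi_kField hU i.succ α γ B hz) _ hx,
      mult_add hU ((hk _).pd hU α) (SmoothPer.sum fun s _ => (SmoothPer.const _).mul (hs s))
        hfin2.moderate hx,
      mult_sum hU _ (fun s _ => hs s) hfin2.moderate hx, potTerm, pd_LP_mult hφ hU (hk _) hmod j α hx]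
    have e4 (s : SIdx d) : M.errTerm φ j' j i s x =
        mult (fun ξ => lpSymbol φ j ξ * gradInv i j' ξ) (M.sourceField s) x := by
      rw [errTerm, LP, mult_mult hU (hs s) hmod _ hx]
    simp only [e4]
  rw [projK, LP, mult_congr_symbol e1, FiniteSymbol.mult_sum_symbol fun i _ => hfin.mul_right _]
  have e5 : pd α (M.pot φ j' j γ B) x = ∑ i, pd α (M.potTerm φ j' j γ B i) x :=
    pd_sum α fun i _ => (M.smoothPer_potTerm hφ hU j' j γ B i).differentiableAt hU hx
  simp only [e2, Finset.sum_add_distrib, potErr, e5]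

/-- A spatial derivative of the potential is a multiplier of order `0` applied to `k`. -/
lemma pd_succ_potTerm (hφ : IsCutoff φ) (hU : IsOpen U) (j j' : ℕ) (a : Fin 3) (γ : Fin 4)
    (B : Fin d) (i : Fin 3) {x : Spacetime} (hx : x ∈ slab U) :
    pd a.succ (M.potTerm φ j' j γ B i) x =
      LP φ j (mult (scaledSymbol 0 (rieszSymbol a i) j') (M.kField (i.succ, γ, B))) x := by
  have hk := M.smoothPer_kField hU
  rw [potTerm, pd_LP_mult hφ hU (hk _) (finiteSymbol_gradInv i j').moderate j _ hx,
    mult_pd_succ hU (hk _) _ a hx, LP,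
    mult_mult hU (hk _) ((isAnnular_rieszSymbol a i).finiteSymbol 0 j').moderate _ hx]
  simp only [mul_assoc, ← scaledSymbol_gradInv_mul]

/-- The null structure of the wedge product. -/
lemma wedge_potential (hφ : IsCutoff φ) (hU : IsOpen U) {j₁ j₂ j' : ℕ} (hj : 1 ≤ j₁)
    (h1 : j₁ ≤ j' + 2) (h2 : j' ≤ j₁ + 2) (a b γ δ : Fin 4) (A B : Fin d) {x : Spacetime}
    (hx : x ∈ slab U) :
    M.projK φ j₁ a γ B x * M.projK φ j₂ b δ A x - M.projK φ j₂ a δ A x * M.projK φ j₁ b γ B x =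
      pd a (fun x => M.pot φ j' j₁ γ B x * M.projK φ j₂ b δ A x) x -
      pd b (fun x => M.pot φ j' j₁ γ B x * M.projK φ j₂ a δ A x) x +
      M.pot φ j' j₁ γ B x * (∑ s, (codazziCoef b a δ A s : ℂ) * LP φ j₂ (M.sourceField s) x) +
      M.potErr φ j' j₁ a γ B x * M.projK φ j₂ b δ A x -
      M.potErr φ j' j₁ b γ B x * M.projK φ j₂ a δ A x := by
  have d1 := (M.smoothPer_pot hφ hU j' j₁ γ B).differentiableAt hU hx
  have d2 (b : Fin 4) := (M.smoothPer_projK hφ hU j₂ b δ A).differentiableAt hU hx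
  -- Only the factor with index γ is written as gradient plus error. The terms where a derivative
  -- falls on Φ reproduce the null form, and those where it falls on the other factor form a curl,
  -- evaluated by the localised Codazzi equation.
  rw [pd_mul a d1 (d2 b), pd_mul b d1 (d2 a), M.projK_eq hφ hU hj h1 h2 a γ B hx,
    M.projK_eq hφ hU hj h1 h2 b γ B hx, M.pd_projK hφ hU j₂ b a δ A hx]
  ring

end FramedImmersion

end MinimalSurface
end

noncomputable section

namespace MinimalSurface

open Filter Topology

/-! ### Bilinear terms -/

lemma IsSymbolFamily.moderate {r : ℤ} (hr : r ≤ 0) {σ : ℕ → Freq → ℂ} (h : IsSymbolFamily r σ)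
    (j : ℕ) : ModerateSymbol (σ j) := by
  obtain ⟨C, hC⟩ := h.bound 0
  refine .of_bounded (C := C) fun ξ => ?_
  have h1 := hC j ξ
  rw [norm_iteratedFDeriv_zero] at h1
  have h0 : (0 : ℝ) < (1 + ‖ξ‖) ^ (r - ((0 : ℕ) : ℤ)) := by positivity
  have hC0 : 0 ≤ C := by
    by_contra hneg
    nlinarith [norm_nonneg (σ j ξ), mul_neg_of_neg_of_pos (not_le.mp hneg) h0]
  refine h1.trans (mul_le_of_le_one_right hC0 ?_)
  exact zpow_le_one_of_nonpos₀ (by linarith [norm_nonneg ξ]) (by simpa using hr)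

/-- Needs no differentiability, in contrast to `pd_const_mul`, so constants can be moved through
whole lists of terms. -/
lemma pd_const_mul' (α : Fin 4) (c : ℂ) (f : Field) :
    pd α (fun x => c * f x) = fun x => c * pd α f x := by
  ext x
  have := congrFun (fderiv_const_smul_field (𝕜 := ℝ) (f := f) c) x
  simp only [pd]
  change fderiv ℝ (c • f) x _ = _
  rw [this]
  simp

lemma pd_list_sum {ι : Type*} (α : Fin 4) (L : List ι) {f : ι → Field} {x : Spacetime}
    (hf : ∀ τ ∈ L, DifferentiableAt ℝ (f τ) x) :
    pd α (fun x => (L.map fun τ => f τ x).sum) x = (L.map fun τ => pd α (f τ) x).sum ∧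
      DifferentiableAt ℝ (fun x => (L.map fun τ => f τ x).sum) x := by
  induction L with
  | nil => simp [pd]
  | cons τ L ih =>
    obtain ⟨h1, h2⟩ := ih fun τ hτ => hf τ (List.mem_cons_of_mem _ hτ)
    have h3 := hf τ List.mem_cons_self
    simp only [List.map_cons, List.sum_cons]
    exact ⟨by rw [pd_add α h3 h2, h1], h3.add h2⟩

lemma sum_mul_sum_mul {ι κ : Type*} [Fintype ι] [Fintype κ] (p : ι → ℂ) (c q : κ → ℂ) :
    (∑ i, p i) * (∑ s, c s * q s) = ∑ i, ∑ s, c s * (q s * p i) := by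
  rw [Finset.sum_mul]
  refine Finset.sum_congr rfl fun i _ => ?_
  rw [Finset.mul_sum]
  exact Finset.sum_congr rfl fun s _ => by ring

/-- The frequency of the first factor of a bilinear term. -/
def freq (sw : Bool) (j' j'' : ℕ) : ℕ := if sw then j'' else j'

namespace BiTerm

variable {ι₁ ι₂ : Type} {r₁ r₂ : ℤ}

/-- Multiplication of a bilinear term by a constant. -/
def smul (c : ℂ) (τ : BiTerm ι₁ ι₂ r₁ r₂) : BiTerm ι₁ ι₂ r₁ r₂ :=
  { τ with A := fun j ξ => c * τ.A j ξ, order_A := τ.order_A.const_mul c }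

lemma eval_smul (c : ℂ) (τ : BiTerm ι₁ ι₂ r₁ r₂) (φ : ℝ → ℝ) (u : ι₁ → Field) (v : ι₂ → Field)
    (j' j'' : ℕ) : (τ.smul c).eval φ u v j' j'' = fun x => c * τ.eval φ u v j' j'' x := by
  ext x
  simp only [eval, smul, mult_const_mul, LP, mult_field_const_mul]
  exact mul_assoc _ _ _

lemma eval_eq (τ : BiTerm ι₁ ι₂ r₁ r₂) (φ : ℝ → ℝ) (u : ι₁ → Field) (v : ι₂ → Field)
    (j' j'' : ℕ) (x : Spacetime) : τ.eval φ u v j' j'' x =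
      LP φ (freq τ.swap j' j'') (mult (τ.A j') (u τ.fst)) x *
        LP φ (freq (!τ.swap) j' j'') (mult (τ.B j') (v τ.snd)) x := by
  unfold eval freq
  cases τ.swap <;> rfl

lemma smoothPer_eval (τ : BiTerm ι₁ ι₂ r₁ r₂) (hr₁ : r₁ ≤ 0) (hr₂ : r₂ ≤ 0) {φ : ℝ → ℝ}
    (hφ : IsCutoff φ) {U : Set ℝ} (hU : IsOpen U) {u : ι₁ → Field} {v : ι₂ → Field}
    (hu : ∀ i, SmoothPer U (u i)) (hv : ∀ i, SmoothPer U (v i)) (j' j'' : ℕ) :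
    SmoothPer U (τ.eval φ u v j' j'') :=
  (SmoothPer.congr_LP hφ hU (hu _) (τ.order_A.moderate hr₁ j') _).mul
    (SmoothPer.congr_LP hφ hU (hv _) (τ.order_B.moderate hr₂ j') _)

end BiTerm

/-- The quantities depending on a framed immersion and two frequencies. -/
abbrev BiFun (d : ℕ) := ∀ U : Set ℝ, FramedImmersion d U → ℕ → ℕ → Field

/-- The families of fields entering the schematic expressions. -/
abbrev FieldFamily (d : ℕ) (ι : Type) := ∀ U : Set ℝ, FramedImmersion d U → ι → Field

/-- Equality on `U × 𝕋³` for all framed immersions and all frequencies `j' > 2`,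
`j'' = j' + J`. -/
def SlabEq (d : ℕ) (J : ℤ) (F G : BiFun d) : Prop :=
  ∀ U, IsOpen U → ∀ (M : FramedImmersion d U) (j' j'' : ℕ), 2 < j' → (j'' : ℤ) = j' + J →
    ∀ x ∈ slab U, F U M j' j'' x = G U M j' j'' x

/-- `G` is a finite sum of bilinear terms. -/
def BiRep (φ : ℝ → ℝ) (J : ℤ) {d : ℕ} {ι₁ ι₂ : Type} (u : FieldFamily d ι₁)
    (v : FieldFamily d ι₂) (r₁ r₂ : ℤ) (G : BiFun d) : Prop :=
  ∃ L : List (BiTerm ι₁ ι₂ r₁ r₂), SlabEq d J G fun U M j' j'' x =>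
    (L.map fun τ => τ.eval φ (u U M) (v U M) j' j'' x).sum

namespace BiRep

variable {φ : ℝ → ℝ} {J : ℤ} {d : ℕ} {ι₁ ι₂ : Type} {u : FieldFamily d ι₁} {v : FieldFamily d ι₂}
  {r₁ r₂ : ℤ} {F G : BiFun d}

lemma congr (hG : BiRep φ J u v r₁ r₂ G) (h : SlabEq d J F G) : BiRep φ J u v r₁ r₂ F := by
  obtain ⟨L, hL⟩ := hG
  exact ⟨L, fun U hU M j' j'' hj hJ x hx => (h U hU M j' j'' hj hJ x hx).trans
    (hL U hU M j' j'' hj hJ x hx)⟩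

lemma of_term (τ : BiTerm ι₁ ι₂ r₁ r₂) (h : SlabEq d J G fun U M j' j'' =>
    τ.eval φ (u U M) (v U M) j' j'') : BiRep φ J u v r₁ r₂ G :=
  ⟨[τ], fun U hU M j' j'' hj hJ x hx => by simpa using h U hU M j' j'' hj hJ x hx⟩

lemma add (hF : BiRep φ J u v r₁ r₂ F) (hG : BiRep φ J u v r₁ r₂ G) :
    BiRep φ J u v r₁ r₂ fun U M j' j'' x => F U M j' j'' x + G U M j' j'' x := by
  obtain ⟨L, hL⟩ := hF
  obtain ⟨L', hL'⟩ := hG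
  refine ⟨L ++ L', fun U hU M j' j'' hj hJ x hx => ?_⟩
  simp only [hL U hU M j' j'' hj hJ x hx, hL' U hU M j' j'' hj hJ x hx, List.map_append,
    List.sum_append]

lemma const_mul (c : ℂ) (hG : BiRep φ J u v r₁ r₂ G) :
    BiRep φ J u v r₁ r₂ fun U M j' j'' x => c * G U M j' j'' x := by
  obtain ⟨L, hL⟩ := hG
  refine ⟨L.map (BiTerm.smul c), fun U hU M j' j'' hj hJ x hx => ?_⟩
  simp only [hL U hU M j' j'' hj hJ x hx, List.map_map, Function.comp_def, BiTerm.eval_smul,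
    List.sum_map_mul_left]

lemma sum {ι : Type*} (s : Finset ι) {G : ι → BiFun d} (h : ∀ i ∈ s, BiRep φ J u v r₁ r₂ (G i)) :
    BiRep φ J u v r₁ r₂ fun U M j' j'' x => ∑ i ∈ s, G i U M j' j'' x := by
  classical
  induction s using Finset.induction_on with
  | empty => exact ⟨[], fun U _ M j' j'' _ _ x _ => by simp⟩
  | insert i s hi ih =>
    simp only [Finset.sum_insert hi]
    exact (h i (Finset.mem_insert_self _ _)).add (ih fun k hk => h k (Finset.mem_insert_of_mem hk))

end BiRep

section Terms

variable {φ : ℝ → ℝ} (hφ : IsCutoff φ) {J : ℤ} {d : ℕ} (sw : Bool)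

/-- The components of `k` as a family of fields. -/
abbrev kFam (d : ℕ) : FieldFamily d (KIdx d) := fun _ M => M.kField

/-- The monomials `g·∂g·k`, `ω·k` as a family of fields. -/
abbrev sFam (d : ℕ) : FieldFamily d (SIdx d) := fun _ M => M.sourceField

/-- From j' > 2 and J ≥ −2 both frequencies are at least 1. This excludes the low frequency block
P_0, on which the gradient could not be inverted. -/
lemma freq_bounds (hJ₁ : -2 ≤ J) (hJ₂ : J ≤ 2) {j' j'' : ℕ} (hj : 2 < j')
    (h : (j'' : ℤ) = j' + J) :
    1 ≤ freq sw j' j'' ∧ freq sw j' j'' ≤ j' + 2 ∧ j' ≤ freq sw j' j'' + 2 := by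
  unfold freq; split_ifs <;> omega

lemma BiRep.pot_pot (i l : Fin 3) (γ δ : Fin 4) (B A : Fin d) :
    BiRep φ J (kFam d) (kFam d) (-1) (-1) fun _ M j' j'' x =>
      M.potTerm φ j' (freq sw j' j'') γ B i x * M.potTerm φ j' (freq (!sw) j' j'') δ A l x :=
  .of_term ⟨sw, (i.succ, γ, B), (l.succ, δ, A), _, _, (isAnnular_gradInvSymbol i).isSymbolFamily _,
    (isAnnular_gradInvSymbol l).isSymbolFamily _⟩ fun U hU M j' j'' hj hJ x hx => by
    simp only [BiTerm.eval_eq]; rfl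

lemma BiRep.err_pot (i l : Fin 3) (s : SIdx d) (δ : Fin 4) (A : Fin d) :
    BiRep φ J (sFam d) (kFam d) (-1) (-1) fun _ M j' j'' x =>
      M.errTerm φ j' (freq sw j' j'') i s x * M.potTerm φ j' (freq (!sw) j' j'') δ A l x :=
  .of_term ⟨sw, s, (l.succ, δ, A), _, _, (isAnnular_gradInvSymbol i).isSymbolFamily _,
    (isAnnular_gradInvSymbol l).isSymbolFamily _⟩ fun U hU M j' j'' hj hJ x hx => by
    simp only [BiTerm.eval_eq]; rfl

lemma BiRep.err_proj (i : Fin 3) (s : SIdx d) (β δ : Fin 4) (A : Fin d) :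
    BiRep φ J (sFam d) (kFam d) (-1) 0 fun _ M j' j'' x =>
      M.errTerm φ j' (freq sw j' j'') i s x * M.projK φ (freq (!sw) j' j'') β δ A x :=
  .of_term ⟨sw, s, (β, δ, A), _, _, (isAnnular_gradInvSymbol i).isSymbolFamily _,
    isSymbolFamily_one⟩ fun U hU M j' j'' hj hJ x hx => by
    simp only [BiTerm.eval_eq, LP_mult_one hU (M.smoothPer_kField hU _) _ hx]; rfl

/-- The bilinear term `P_{j₁}(⟨D⟩⁻¹ k) · P_{j₂} k`. -/
def potProjTerm (i : Fin 3) (γ : Fin 4) (B : Fin d) (β δ : Fin 4) (A : Fin d) :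
    BiTerm (KIdx d) (KIdx d) (-1) 0 :=
  ⟨sw, (i.succ, γ, B), (β, δ, A), gradInv i, fun _ _ => 1,
    (isAnnular_gradInvSymbol i).isSymbolFamily _, isSymbolFamily_one⟩

lemma potProjTerm_eval (i : Fin 3) (γ : Fin 4) (B : Fin d) (β δ : Fin 4) (A : Fin d) {U : Set ℝ}
    (hU : IsOpen U) (M : FramedImmersion d U) (j' j'' : ℕ) {x : Spacetime} (hx : x ∈ slab U) :
    (potProjTerm sw i γ B β δ A).eval φ M.kField M.kField j' j'' x =
      M.potTerm φ j' (freq sw j' j'') γ B i x * M.projK φ (freq (!sw) j' j'') β δ A x := by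
  simp only [BiTerm.eval_eq, potProjTerm,
    LP_mult_one hU (M.smoothPer_kField hU _) _ hx]
  rfl

lemma BiRep.pot_proj (i : Fin 3) (γ : Fin 4) (B : Fin d) (β δ : Fin 4) (A : Fin d) :
    BiRep φ J (kFam d) (kFam d) (-1) 0 fun _ M j' j'' x =>
      M.potTerm φ j' (freq sw j' j'') γ B i x * M.projK φ (freq (!sw) j' j'') β δ A x :=
  .of_term (potProjTerm sw i γ B β δ A) fun _ hU M j' j'' _ _ _ hx =>
    (potProjTerm_eval sw i γ B β δ A hU M j' j'' hx).symm

lemma BiRep.pot_dpot (hφ : IsCutoff φ) (i a l : Fin 3) (γ δ : Fin 4) (B A : Fin d) :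
    BiRep φ J (kFam d) (kFam d) (-1) 0 fun _ M j' j'' x =>
      M.potTerm φ j' (freq sw j' j'') γ B i x *
        pd a.succ (M.potTerm φ j' (freq (!sw) j' j'') δ A l) x :=
  .of_term ⟨sw, (i.succ, γ, B), (l.succ, δ, A), _, _, (isAnnular_gradInvSymbol i).isSymbolFamily _,
    (isAnnular_rieszSymbol a l).isSymbolFamily _⟩ fun U hU M j' j'' hj hJ x hx => by
    simp only [BiTerm.eval_eq, M.pd_succ_potTerm hφ hU _ _ a δ A l hx]; rfl

/-- The inverse derivative changes sides. Multiplying the source by 2^{-j'}, realised by the order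
−1 symbol of `fatBump`, and the potential by 2^{j'} leaves the product unchanged, while the
potential becomes a multiplier of order 0 applied to k. -/
lemma BiRep.source_pot (hφ : IsCutoff φ) (hJ₁ : -2 ≤ J) (hJ₂ : J ≤ 2) (s : SIdx d) (l : Fin 3)
    (δ : Fin 4) (A : Fin d) : BiRep φ J (sFam d) (kFam d) (-1) 0 fun _ M j' j'' x =>
      LP φ (freq sw j' j'') (M.sourceField s) x * M.potTerm φ j' (freq (!sw) j' j'') δ A l x :=
  .of_term ⟨sw, s, (l.succ, δ, A), _, _, isAnnular_fatBump.isSymbolFamily _,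
    (isAnnular_gradInvSymbol l).isSymbolFamily _⟩ fun U hU M j' j'' hj hJ x hx => by
    obtain ⟨b1, b2, b3⟩ := freq_bounds sw hJ₁ hJ₂ hj hJ
    have h := LP_mult_fatBump hφ hU (M.smoothPer_sourceField hU s) b1 b2 b3 hx
    have h2 : (2 : ℂ) ^ j' ≠ 0 := pow_ne_zero _ two_ne_zero
    simp only [BiTerm.eval_eq]
    rw [h, mult_scaledSymbol_zero, LP,
      LP, mult_field_const_mul]
    simp only [FramedImmersion.potTerm, LP, gradInv]
    field_simp

end Terms

/-! ### Schemes with one derivative -/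

/-- `F` is given by a scheme with one derivative. -/
def OneRep (φ : ℝ → ℝ) (J : ℤ) {d : ℕ} (F : BiFun d) : Prop :=
  ∃ S : OneDerivScheme d, SlabEq d J F fun _ M j' j'' => S.eval M φ j' j''

namespace OneRep

variable {φ : ℝ → ℝ} {J : ℤ} {d : ℕ} {F G : BiFun d}

lemma congr (hG : OneRep φ J G) (h : SlabEq d J F G) : OneRep φ J F := by
  obtain ⟨L, hL⟩ := hG
  exact ⟨L, fun U hU M j' j'' hj hJ x hx => (h U hU M j' j'' hj hJ x hx).trans
    (hL U hU M j' j'' hj hJ x hx)⟩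

lemma add (hF : OneRep φ J F) (hG : OneRep φ J G) :
    OneRep φ J fun U M j' j'' x => F U M j' j'' x + G U M j' j'' x := by
  obtain ⟨S, hS⟩ := hF
  obtain ⟨S', hS'⟩ := hG
  refine ⟨⟨S.main ++ S'.main, fun τ hτ => (List.mem_append.mp hτ).elim (S.main_snd τ)
    (S'.main_snd τ), S.err ++ S'.err⟩, fun U hU M j' j'' hj hJ x hx => ?_⟩
  simp only [hS U hU M j' j'' hj hJ x hx, hS' U hU M j' j'' hj hJ x hx, OneDerivScheme.eval,
    List.map_append, List.sum_append]
  ring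

lemma neg (hF : OneRep φ J F) : OneRep φ J fun U M j' j'' x => -F U M j' j'' x := by
  obtain ⟨S, hS⟩ := hF
  refine ⟨⟨S.main.map fun τ => (τ.1, τ.2.smul (-1)), fun τ hτ => ?_, S.err.map (BiTerm.smul (-1))⟩,
    fun U hU M j' j'' hj hJ x hx => ?_⟩
  · obtain ⟨τ', hτ', rfl⟩ := List.mem_map.mp hτ
    exact S.main_snd τ' hτ'
  · simp only [hS U hU M j' j'' hj hJ x hx, OneDerivScheme.eval, List.map_map, Function.comp_def,
      BiTerm.eval_smul, pd_const_mul', List.sum_map_mul_left]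
    ring

lemma sub (hF : OneRep φ J F) (hG : OneRep φ J G) :
    OneRep φ J fun U M j' j'' x => F U M j' j'' x - G U M j' j'' x := by
  simpa only [sub_eq_add_neg] using hF.add hG.neg

lemma sum {ι : Type*} (s : Finset ι) {G : ι → BiFun d} (h : ∀ i ∈ s, OneRep φ J (G i)) :
    OneRep φ J fun U M j' j'' x => ∑ i ∈ s, G i U M j' j'' x := by
  classical
  induction s using Finset.induction_on with
  | empty => exact ⟨⟨[], by simp, []⟩, fun U _ M j' j'' _ _ x _ => by simp [OneDerivScheme.eval]⟩
  | insert i s hi ih =>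
    simp only [Finset.sum_insert hi]
    exact (h i (Finset.mem_insert_self _ _)).add (ih fun k hk => h k (Finset.mem_insert_of_mem hk))

lemma of_err (hG : BiRep φ J (sFam d) (kFam d) (-1) 0 G) : OneRep φ J G := by
  obtain ⟨L, hL⟩ := hG
  exact ⟨⟨[], by simp, L⟩, fun U hU M j' j'' hj hJ x hx => by
    simpa [OneDerivScheme.eval] using hL U hU M j' j'' hj hJ x hx⟩

lemma of_main (a : Fin 3) (sw : Bool) (i : Fin 3) (γ : Fin 4) (B : Fin d) (β δ : Fin 4)
    (A : Fin d) : OneRep φ J fun _ M j' j'' x => pd a.succ (fun z =>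
      M.potTerm φ j' (freq sw j' j'') γ B i z * M.projK φ (freq (!sw) j' j'') β δ A z) x :=
  ⟨⟨[(a, potProjTerm sw i γ B β δ A)], by simp [potProjTerm], []⟩,
    fun U hU M j' j'' _ _ x hx => by
      simp only [OneDerivScheme.eval, List.map_cons, List.map_nil, List.sum_cons, List.sum_nil,
        add_zero]
      exact pd_congr hU (fun z hz => (potProjTerm_eval sw i γ B β δ A hU M j' j'' hz).symm) _ hx⟩

/-- The basic null form. -/
lemma nullForm (hφ : IsCutoff φ) (hJ₁ : -2 ≤ J) (hJ₂ : J ≤ 2) (sw : Bool) (a b : Fin 3)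
    (γ δ : Fin 4) (A B : Fin d) : OneRep φ J fun _ M j' j'' x =>
      M.projK φ (freq sw j' j'') a.succ γ B x * M.projK φ (freq (!sw) j' j'') b.succ δ A x -
      M.projK φ (freq (!sw) j' j'') a.succ δ A x * M.projK φ (freq sw j' j'') b.succ γ B x := by
  have main (a b : Fin 3) : OneRep φ J fun _ M j' j'' x => pd a.succ (fun x =>
      M.pot φ j' (freq sw j' j'') γ B x * M.projK φ (freq (!sw) j' j'') b.succ δ A x) x := by
    refine (OneRep.sum (d := d) Finset.univ fun i _ => of_main a sw i γ B b.succ δ A).congr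
      fun U hU M j' j'' hj hJ x hx => ?_
    simp only [FramedImmersion.pot, Finset.sum_mul]
    exact pd_sum _ fun i _ => ((M.smoothPer_potTerm hφ hU _ _ _ _ _).mul
      (M.smoothPer_projK hφ hU _ _ _ _)).differentiableAt hU hx
  have err (a b : Fin 3) : OneRep φ J fun _ M j' j'' x =>
      M.potErr φ j' (freq sw j' j'') a.succ γ B x *
        M.projK φ (freq (!sw) j' j'') b.succ δ A x := by
    refine (of_err (BiRep.sum (d := d) Finset.univ fun i _ => BiRep.sum Finset.univ fun s _ =>
      (BiRep.err_proj sw i s b.succ δ A).const_mul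
        (codazziCoef i.succ a.succ γ B s : ℂ))).congr fun U hU M j' j'' hj hJ x hx => ?_
    simp only [FramedImmersion.potErr, Finset.sum_mul, mul_assoc]
  have src : OneRep φ J fun _ M j' j'' x => M.pot φ j' (freq sw j' j'') γ B x *
      (∑ s, (codazziCoef b.succ a.succ δ A s : ℂ) *
        LP φ (freq (!sw) j' j'') (M.sourceField s) x) := by
    refine (of_err (BiRep.sum (d := d) Finset.univ fun i _ => BiRep.sum Finset.univ fun s _ =>
      (BiRep.source_pot (!sw) hφ hJ₁ hJ₂ s i γ B).const_mul
        (codazziCoef b.succ a.succ δ A s : ℂ))).congr fun U hU M j' j'' hj hJ x hx => ?_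
    simp only [FramedImmersion.pot, Bool.not_not]
    exact sum_mul_sum_mul _ _ _
  refine (((((main a b).sub (main b a)).add src).add (err a b)).sub (err b a)).congr
    fun U hU M j' j'' hj hJ x hx => ?_
  obtain ⟨b1, b2, b3⟩ := freq_bounds sw hJ₁ hJ₂ hj hJ
  exact M.wedge_potential hφ hU b1 b2 b3 a.succ b.succ γ δ A B hx

/-- The first product of one wedge pairs with the second product of the wedge in the opposite order.
Symmetrisation is thus exactly what produces null forms, one for each assignment of the two
frequencies. -/
lemma hhWedge (hφ : IsCutoff φ) (hJ₁ : -2 ≤ J) (hJ₂ : J ≤ 2) (a b : Fin 3) (γ δ : Fin 4)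
    (A B : Fin d) : OneRep φ J fun _ M j' j'' x =>
      M.hhWedge φ j' j'' A B a.succ b.succ γ δ x := by
  refine ((nullForm hφ hJ₁ hJ₂ false a b γ δ A B).add
    (nullForm hφ hJ₁ hJ₂ true a b γ δ A B)).congr fun U hU M j' j'' hj hJ x hx => ?_
  simp only [FramedImmersion.hhWedge, wedge, freq]
  simp
  ring

end OneRep

end MinimalSurface
end

noncomputable section

namespace MinimalSurface

open Filter Topology

/-! ### Schemes with two derivatives -/

/-- The quantities depending on a framed immersion and three frequencies. -/
abbrev TriFun (d : ℕ) := ∀ U : Set ℝ, FramedImmersion d U → ℕ → ℕ → ℕ → Field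

/-- Equality on `U × 𝕋³` for all framed immersions and all frequencies `j₃`, `j' > 2`,
`j'' = j' + J`. -/
def SlabEq₃ (d : ℕ) (J : ℤ) (F G : TriFun d) : Prop :=
  ∀ U, IsOpen U → ∀ (M : FramedImmersion d U) (j₃ j' j'' : ℕ), 2 < j' → (j'' : ℤ) = j' + J →
    ∀ x ∈ slab U, F U M j₃ j' j'' x = G U M j₃ j' j'' x

/-- `F` is given by a scheme with two derivatives, which are spatial if `sp` holds. -/
def TwoRep (φ : ℝ → ℝ) (J : ℤ) (sp : Prop) {d : ℕ} (F : TriFun d) : Prop :=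
  ∃ S : TwoDerivScheme d, (sp → S.IsSpatial) ∧
    SlabEq₃ d J F fun _ M j₃ j' j'' => S.eval M φ j₃ j' j''

namespace TwoRep

variable {φ : ℝ → ℝ} {J : ℤ} {sp : Prop} {d : ℕ} {F G : TriFun d} {H : BiFun d}

lemma congr (hG : TwoRep φ J sp G) (h : SlabEq₃ d J F G) : TwoRep φ J sp F := by
  obtain ⟨S, hs, hS⟩ := hG
  exact ⟨S, hs, fun U hU M j₃ j' j'' hj hJ x hx => (h U hU M j₃ j' j'' hj hJ x hx).trans
    (hS U hU M j₃ j' j'' hj hJ x hx)⟩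

lemma add (hF : TwoRep φ J sp F) (hG : TwoRep φ J sp G) :
    TwoRep φ J sp fun U M j₃ j' j'' x => F U M j₃ j' j'' x + G U M j₃ j' j'' x := by
  obtain ⟨S, hs, hS⟩ := hF
  obtain ⟨S', hs', hS'⟩ := hG
  refine ⟨⟨S.main ++ S'.main, S.derErr ++ S'.derErr, S.dm ++ S'.dm, S.ddm ++ S'.ddm,
    S.err ++ S'.err⟩, fun h => ⟨?_, ?_, ?_⟩, fun U hU M j₃ j' j'' hj hJ x hx => ?_⟩
  · exact fun τ hτ => (List.mem_append.mp hτ).elim ((hs h).1 τ) ((hs' h).1 τ)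
  · exact fun τ hτ => (List.mem_append.mp hτ).elim ((hs h).2.1 τ) ((hs' h).2.1 τ)
  · exact fun τ hτ => (List.mem_append.mp hτ).elim ((hs h).2.2 τ) ((hs' h).2.2 τ)
  · simp only [hS U hU M j₃ j' j'' hj hJ x hx, hS' U hU M j₃ j' j'' hj hJ x hx,
      TwoDerivScheme.eval, List.map_append, List.sum_append]
    ring

lemma neg (hF : TwoRep φ J sp F) : TwoRep φ J sp fun U M j₃ j' j'' x => -F U M j₃ j' j'' x := by
  obtain ⟨S, hs, hS⟩ := hF
  refine ⟨⟨S.main.map fun (i, β, c, τ) => (i, β, c, τ.smul (-1)),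
    S.derErr.map fun (i, c, τ) => (i, c, τ.smul (-1)),
    S.dm.map fun (β, c, τ) => (β, c, τ.smul (-1)),
    S.ddm.map fun (i, β, c, τ) => (i, β, c, τ.smul (-1)),
    S.err.map fun (c, τ) => (c, τ.smul (-1))⟩, fun h => ⟨fun τ hτ => ?_, fun τ hτ => ?_,
    fun τ hτ => ?_⟩, fun U hU M j₃ j' j'' hj hJ x hx => ?_⟩
  · obtain ⟨τ', hτ', rfl⟩ := List.mem_map.mp hτ
    exact (hs h).1 τ' hτ'
  · obtain ⟨τ', hτ', rfl⟩ := List.mem_map.mp hτ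
    exact (hs h).2.1 τ' hτ'
  · obtain ⟨τ', hτ', rfl⟩ := List.mem_map.mp hτ
    exact (hs h).2.2 τ' hτ'
  · simp only [hS U hU M j₃ j' j'' hj hJ x hx, TwoDerivScheme.eval, List.map_map,
      Function.comp_def, BiTerm.eval_smul, mul_left_comm _ (-1 : ℂ), pd_const_mul',
      List.sum_map_mul_left]
    ring

lemma sub (hF : TwoRep φ J sp F) (hG : TwoRep φ J sp G) :
    TwoRep φ J sp fun U M j₃ j' j'' x => F U M j₃ j' j'' x - G U M j₃ j' j'' x := by
  simpa only [sub_eq_add_neg] using hF.add hG.neg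

lemma sum {ι : Type*} (s : Finset ι) {G : ι → TriFun d} (h : ∀ i ∈ s, TwoRep φ J sp (G i)) :
    TwoRep φ J sp fun U M j₃ j' j'' x => ∑ i ∈ s, G i U M j₃ j' j'' x := by
  classical
  induction s using Finset.induction_on with
  | empty =>
    exact ⟨⟨[], [], [], [], []⟩, fun _ => ⟨by simp, by simp, by simp⟩,
      fun U _ M j₃ j' j'' _ _ x _ => by simp [TwoDerivScheme.eval]⟩
  | insert i s hi ih =>
    simp only [Finset.sum_insert hi]
    exact (h i (Finset.mem_insert_self _ _)).add (ih fun k hk => h k (Finset.mem_insert_of_mem hk))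

variable (c : MIdx d)

lemma of_main (hφ : IsCutoff φ) (i : Fin 3) {β : Fin 4} (hβ : sp → β ≠ 0)
    (hH : BiRep φ J (kFam d) (kFam d) (-1) (-1) H) : TwoRep φ J sp fun U M j₃ j' j'' x =>
      pd i.succ (pd β fun z => LP φ j₃ (M.mField c) z * H U M j' j'' z) x := by
  obtain ⟨L, hL⟩ := hH
  refine ⟨⟨L.map fun τ => (i, β, c, τ), [], [], [], []⟩, fun h => ⟨?_, by simp, by simp⟩,
    fun U hU M j₃ j' j'' hj hJ x hx => ?_⟩
  · intro τ hτ
    obtain ⟨τ', -, rfl⟩ := List.mem_map.mp hτ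
    exact hβ h
  · have hs (τ : BiTerm (KIdx d) (KIdx d) (-1) (-1)) : SmoothPer U fun z =>
        LP φ j₃ (M.mField c) z * τ.eval φ M.kField M.kField j' j'' z :=
      (SmoothPer.LP hφ hU (M.smoothPer_mField c) j₃).mul (τ.smoothPer_eval (by norm_num)
        (by norm_num) hφ hU (M.smoothPer_kField hU) (M.smoothPer_kField hU) j' j'')
    have e1 : Set.EqOn (fun z => LP φ j₃ (M.mField c) z * H U M j' j'' z) (fun z =>
        (L.map fun τ => LP φ j₃ (M.mField c) z * τ.eval φ M.kField M.kField j' j'' z).sum)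
        (slab U) := fun z hz => by
      simp only [hL U hU M j' j'' hj hJ z hz, List.sum_map_mul_left]
    have e2 : Set.EqOn (pd β fun z => LP φ j₃ (M.mField c) z * H U M j' j'' z) (fun z =>
        (L.map fun τ => pd β (fun z =>
          LP φ j₃ (M.mField c) z * τ.eval φ M.kField M.kField j' j'' z) z).sum)
        (slab U) := fun z hz => by
      rw [pd_congr hU e1 β hz, (pd_list_sum β L fun τ _ => (hs τ).differentiableAt hU hz).1]
    beta_reduce
    rw [pd_congr hU e2 _ hx,
      (pd_list_sum _ L fun τ _ => ((hs τ).pd hU β).differentiableAt hU hx).1]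
    simp [TwoDerivScheme.eval, Function.comp_def]

lemma of_derErr (hφ : IsCutoff φ) (i : Fin 3)
    (hH : BiRep φ J (sFam d) (kFam d) (-1) (-1) H) : TwoRep φ J sp fun U M j₃ j' j'' x =>
      pd i.succ (fun z => LP φ j₃ (M.mField c) z * H U M j' j'' z) x := by
  obtain ⟨L, hL⟩ := hH
  refine ⟨⟨[], L.map fun τ => (i, c, τ), [], [], []⟩, fun h => ⟨by simp, by simp, by simp⟩,
    fun U hU M j₃ j' j'' hj hJ x hx => ?_⟩
  have hs (τ : BiTerm (SIdx d) (KIdx d) (-1) (-1)) : SmoothPer U fun z =>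
      LP φ j₃ (M.mField c) z * τ.eval φ M.sourceField M.kField j' j'' z :=
    (SmoothPer.LP hφ hU (M.smoothPer_mField c) j₃).mul (τ.smoothPer_eval (by norm_num)
      (by norm_num) hφ hU (M.smoothPer_sourceField hU) (M.smoothPer_kField hU) j' j'')
  have e1 : Set.EqOn (fun z => LP φ j₃ (M.mField c) z * H U M j' j'' z) (fun z =>
      (L.map fun τ => LP φ j₃ (M.mField c) z * τ.eval φ M.sourceField M.kField j' j'' z).sum)
      (slab U) := fun z hz => by
    simp only [hL U hU M j' j'' hj hJ z hz, List.sum_map_mul_left]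
  beta_reduce
  rw [pd_congr hU e1 _ hx, (pd_list_sum _ L fun τ _ => (hs τ).differentiableAt hU hx).1]
  simp [TwoDerivScheme.eval, Function.comp_def]

lemma of_dm {β : Fin 4} (hβ : sp → β ≠ 0) (hH : BiRep φ J (kFam d) (kFam d) (-1) 0 H) :
    TwoRep φ J sp fun U M j₃ j' j'' x =>
      pd β (LP φ j₃ (M.mField c)) x * H U M j' j'' x := by
  obtain ⟨L, hL⟩ := hH
  refine ⟨⟨[], [], L.map fun τ => (β, c, τ), [], []⟩, fun h => ⟨by simp, ?_, by simp⟩,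
    fun U hU M j₃ j' j'' hj hJ x hx => ?_⟩
  · intro τ hτ
    obtain ⟨τ', -, rfl⟩ := List.mem_map.mp hτ
    exact hβ h
  · simp [TwoDerivScheme.eval, Function.comp_def, hL U hU M j' j'' hj hJ x hx,
      List.sum_map_mul_left]

lemma of_ddm (i : Fin 3) {β : Fin 4} (hβ : sp → β ≠ 0)
    (hH : BiRep φ J (kFam d) (kFam d) (-1) (-1) H) : TwoRep φ J sp fun U M j₃ j' j'' x =>
      pd i.succ (pd β (LP φ j₃ (M.mField c))) x * H U M j' j'' x := by
  obtain ⟨L, hL⟩ := hH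
  refine ⟨⟨[], [], [], L.map fun τ => (i, β, c, τ), []⟩, fun h => ⟨by simp, by simp, ?_⟩,
    fun U hU M j₃ j' j'' hj hJ x hx => ?_⟩
  · intro τ hτ
    obtain ⟨τ', -, rfl⟩ := List.mem_map.mp hτ
    exact hβ h
  · simp [TwoDerivScheme.eval, Function.comp_def, hL U hU M j' j'' hj hJ x hx,
      List.sum_map_mul_left]

lemma of_err (hH : BiRep φ J (sFam d) (kFam d) (-1) 0 H) : TwoRep φ J sp fun U M j₃ j' j'' x =>
      LP φ j₃ (M.mField c) x * H U M j' j'' x := by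
  obtain ⟨L, hL⟩ := hH
  refine ⟨⟨[], [], [], [], L.map fun τ => (c, τ)⟩, fun h => ⟨by simp, by simp, by simp⟩,
    fun U hU M j₃ j' j'' hj hJ x hx => ?_⟩
  simp [TwoDerivScheme.eval, Function.comp_def, hL U hU M j' j'' hj hJ x hx,
      List.sum_map_mul_left]

end TwoRep

/-! ### Bilinear expressions in the potentials -/

lemma sum_smul_mul_sum {ι κ μ : Type*} [Fintype ι] [Fintype κ] [Fintype μ] (c e : ι → κ → ℂ)
    (p : μ → ℂ) :
    (∑ i, ∑ s, c i s * e i s) * ∑ l, p l = ∑ l, ∑ i, ∑ s, c i s * (e i s * p l) := by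
  rw [Finset.mul_sum]
  refine Finset.sum_congr rfl fun l _ => ?_
  rw [Finset.sum_mul]
  refine Finset.sum_congr rfl fun i _ => ?_
  rw [Finset.sum_mul]
  exact Finset.sum_congr rfl fun s _ => by ring

lemma sum_smul_mul {ι κ : Type*} [Fintype ι] [Fintype κ] (c e : ι → κ → ℂ)
    (p : ℂ) : (∑ i, ∑ s, c i s * e i s) * p = ∑ i, ∑ s, c i s * (e i s * p) := by
  rw [Finset.sum_mul]
  refine Finset.sum_congr rfl fun i _ => ?_
  rw [Finset.sum_mul]
  exact Finset.sum_congr rfl fun s _ => by ring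

lemma sum_mul_sum' {ι κ : Type*} [Fintype ι] [Fintype κ] (p : ι → ℂ) (q : κ → ℂ) :
    (∑ i, p i) * ∑ l, q l = ∑ i, ∑ l, p i * q l := Finset.sum_mul_sum _ _ _ _

namespace BiRep

variable {φ : ℝ → ℝ} {J : ℤ} {d : ℕ} (sw : Bool) (α β γ δ : Fin 4) (A B : Fin d)

lemma Pot_Pot : BiRep φ J (kFam d) (kFam d) (-1) (-1) fun _ M j' j'' x =>
    M.pot φ j' (freq sw j' j'') γ B x * M.pot φ j' (freq (!sw) j' j'') δ A x :=
  (BiRep.sum (d := d) Finset.univ fun i _ => BiRep.sum Finset.univ fun l _ =>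
    pot_pot sw i l γ δ B A).congr fun _ _ _ _ _ _ _ _ _ => sum_mul_sum' _ _

lemma Pot_proj : BiRep φ J (kFam d) (kFam d) (-1) 0 fun _ M j' j'' x =>
    M.pot φ j' (freq sw j' j'') γ B x * M.projK φ (freq (!sw) j' j'') β δ A x :=
  (BiRep.sum (d := d) Finset.univ fun i _ => pot_proj sw i γ B β δ A).congr
    fun _ _ _ _ _ _ _ _ _ => Finset.sum_mul _ _ _

lemma Pot_dPot (hφ : IsCutoff φ) (a : Fin 3) :
    BiRep φ J (kFam d) (kFam d) (-1) 0 fun _ M j' j'' x =>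
      M.pot φ j' (freq sw j' j'') γ B x * pd a.succ (M.pot φ j' (freq (!sw) j' j'') δ A) x :=
  (BiRep.sum (d := d) Finset.univ fun i _ => BiRep.sum Finset.univ fun l _ =>
    pot_dpot sw hφ i a l γ δ B A).congr fun U hU M j' j'' hj hJ x hx => by
      beta_reduce
      rw [← sum_mul_sum' (fun i => M.potTerm φ j' (freq sw j' j'') γ B i x)]
      congr 1
      exact pd_sum _ fun l _ => (M.smoothPer_potTerm hφ hU _ _ _ _ _).differentiableAt hU hx

lemma Err_Pot : BiRep φ J (sFam d) (kFam d) (-1) (-1) fun _ M j' j'' x =>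
    M.potErr φ j' (freq sw j' j'') α γ B x * M.pot φ j' (freq (!sw) j' j'') δ A x :=
  (BiRep.sum (d := d) Finset.univ fun l _ => BiRep.sum Finset.univ fun i _ =>
    BiRep.sum Finset.univ fun s _ => (err_pot sw i l s δ A).const_mul
      (codazziCoef i.succ α γ B s : ℂ)).congr
    fun _ _ _ _ _ _ _ _ _ => sum_smul_mul_sum _ _ _

lemma Err_proj : BiRep φ J (sFam d) (kFam d) (-1) 0 fun _ M j' j'' x =>
    M.potErr φ j' (freq sw j' j'') α γ B x * M.projK φ (freq (!sw) j' j'') β δ A x :=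
  (BiRep.sum (d := d) Finset.univ fun i _ =>
    BiRep.sum Finset.univ fun s _ => (err_proj sw i s β δ A).const_mul
      (codazziCoef i.succ α γ B s : ℂ)).congr
    fun _ _ _ _ _ _ _ _ _ => sum_smul_mul _ _ _

lemma source_Pot (hφ : IsCutoff φ) (hJ₁ : -2 ≤ J) (hJ₂ : J ≤ 2) :
    BiRep φ J (sFam d) (kFam d) (-1) 0 fun _ M j' j'' x =>
      M.pot φ j' (freq (!sw) j' j'') δ A x *
        ∑ s, (codazziCoef α β γ B s : ℂ) * LP φ (freq sw j' j'') (M.sourceField s) x :=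
  (BiRep.sum (d := d) Finset.univ fun i _ => BiRep.sum Finset.univ fun s _ =>
      (source_pot sw hφ hJ₁ hJ₂ s i δ A).const_mul (codazziCoef α β γ B s : ℂ)).congr
    fun _ _ _ _ _ _ _ _ _ => sum_mul_sum_mul _ _ _

end BiRep

/-- The Leibniz rule for a second derivative of a product of a weight and two potentials. -/
lemma leibniz_potentials {U : Set ℝ} (hU : IsOpen U) (a δ : Fin 4)
    {m P Q E F u v : Field} (hm : SmoothPer U m) (hP : SmoothPer U P) (hQ : SmoothPer U Q)
    (hE : SmoothPer U E) (hF : SmoothPer U F) (hu : SmoothPer U u) (hv : SmoothPer U v)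
    (hPE : ∀ z ∈ slab U, u z = pd δ P z + E z) (hQF : ∀ z ∈ slab U, v z = pd δ Q z + F z)
    {x : Spacetime} (hx : x ∈ slab U) :
    pd a (pd δ fun z => m z * (P z * Q z)) x + pd a (fun z => m z * (E z * Q z)) x +
      pd a (fun z => m z * (F z * P z)) x - pd a (pd δ m) x * (P x * Q x) -
      pd δ m x * (Q x * pd a P x) - pd δ m x * (P x * pd a Q x) - pd a m x * (Q x * u x) -
      pd a m x * (P x * v x) =
    m x * (pd a u x * Q x + u x * pd a Q x + pd a P x * v x + P x * pd a v x) := by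
  -- Gradients of the potentials are replaced by u − E and v − F already after the first derivative.
  -- The errors then remain under the outer derivative, as in the terms of type `derErr`, and are
  -- never differentiated alone.
  have e1 : Set.EqOn (pd δ fun z => m z * (P z * Q z)) (fun z => pd δ m z * (P z * Q z) +
      (m z * (u z * Q z) + m z * (P z * v z)) -
      (m z * (E z * Q z) + m z * (F z * P z))) (slab U) := fun z hz => by
    rw [pd_mul δ (hm.differentiableAt hU hz) ((hP.mul hQ).differentiableAt hU hz),
      pd_mul δ (hP.differentiableAt hU hz) (hQ.differentiableAt hU hz)]
    simp only [hPE z hz, hQF z hz]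
    ring
  have hm' := hm.pd hU δ
  have dm := hm.differentiableAt hU hx
  have dm' := hm'.differentiableAt hU hx
  have dP := hP.differentiableAt hU hx
  have dQ := hQ.differentiableAt hU hx
  have du := hu.differentiableAt hU hx
  have dv := hv.differentiableAt hU hx
  rw [pd_congr hU e1 a hx,
    pd_sub a (((hm'.mul (hP.mul hQ)).add ((hm.mul (hu.mul hQ)).add (hm.mul
      (hP.mul hv)))).differentiableAt hU hx)
      (((hm.mul (hE.mul hQ)).add (hm.mul (hF.mul hP))).differentiableAt hU hx),
    pd_add a ((hm'.mul (hP.mul hQ)).differentiableAt hU hx)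
      (((hm.mul (hu.mul hQ)).add (hm.mul (hP.mul hv))).differentiableAt hU hx),
    pd_add a ((hm.mul (hu.mul hQ)).differentiableAt hU hx)
      ((hm.mul (hP.mul hv)).differentiableAt hU hx),
    pd_add a ((hm.mul (hE.mul hQ)).differentiableAt hU hx)
      ((hm.mul (hF.mul hP)).differentiableAt hU hx),
    pd_mul a dm' ((hP.mul hQ).differentiableAt hU hx),
    pd_mul a dm ((hu.mul hQ).differentiableAt hU hx),
    pd_mul a dm ((hP.mul hv).differentiableAt hU hx), pd_mul a dP dQ, pd_mul a du dQ,
    pd_mul a dP dv]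
  ring

namespace TwoRep

variable {φ : ℝ → ℝ} {J : ℤ} {sp : Prop} {d : ℕ}

/-- The second derivative terms, for potentials `Φ_b` of `P_{j'} k^B` and `Ψ_γ` of
`P_{j''} k^A`. -/
lemma leibniz (hφ : IsCutoff φ) (hJ₁ : -2 ≤ J) (hJ₂ : J ≤ 2) (c : MIdx d) (a : Fin 3)
    {δ : Fin 4} (hδ : sp → δ ≠ 0) (β γ : Fin 4) (A B : Fin d) :
    TwoRep φ J sp fun _ M j₃ j' j'' x => LP φ j₃ (M.mField c) x *
      (pd a.succ (M.projK φ j' δ β B) x * M.pot φ j' j'' γ A x +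
        M.projK φ j' δ β B x * pd a.succ (M.pot φ j' j'' γ A) x +
        pd a.succ (M.pot φ j' j' β B) x * M.projK φ j'' δ γ A x +
        M.pot φ j' j' β B x * pd a.succ (M.projK φ j'' δ γ A) x) := by
  -- The outer direction is always spatial; only δ can be the time direction and needs the condition
  -- from `sp`.
  have ha : sp → a.succ ≠ 0 := fun _ => Fin.succ_ne_zero a
  refine ((((((((of_main c hφ a hδ (BiRep.Pot_Pot false β γ A B)).add
    (of_derErr c hφ a (BiRep.Err_Pot false δ β γ A B))).add
    (of_derErr c hφ a (BiRep.Err_Pot true δ γ β B A))).sub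
    (of_ddm c a hδ (BiRep.Pot_Pot false β γ A B))).sub
    (of_dm c hδ (BiRep.Pot_dPot true γ β B A hφ a))).sub
    (of_dm c hδ (BiRep.Pot_dPot false β γ A B hφ a))).sub
    (of_dm c ha (BiRep.Pot_proj true δ γ β B A))).sub
    (of_dm c ha (BiRep.Pot_proj false δ β γ A B))).congr
    fun U hU M j₃ j' j'' hj hJ x hx => ?_
  obtain ⟨b1, b2, b3⟩ := freq_bounds false hJ₁ hJ₂ hj hJ
  obtain ⟨c1, c2, c3⟩ := freq_bounds true hJ₁ hJ₂ hj hJ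
  exact (leibniz_potentials hU a.succ δ (SmoothPer.LP hφ hU (M.smoothPer_mField c) j₃)
    (M.smoothPer_pot hφ hU j' j' β B) (M.smoothPer_pot hφ hU j' j'' γ A)
    (M.smoothPer_potErr hφ hU j' j' δ β B) (M.smoothPer_potErr hφ hU j' j'' δ γ A)
    (M.smoothPer_projK hφ hU j' δ β B) (M.smoothPer_projK hφ hU j'' δ γ A)
    (fun z hz => M.projK_eq hφ hU b1 b2 b3 δ β B hz)
    (fun z hz => M.projK_eq hφ hU c1 c2 c3 δ γ A hz) hx).symm

/-- The null structure for fixed normal indices. -/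
lemma curvature (hφ : IsCutoff φ) (hJ₁ : -2 ≤ J) (hJ₂ : J ≤ 2) (c : MIdx d) (a b : Fin 3)
    {γ δ : Fin 4} (hγ : sp → γ ≠ 0) (hδ : sp → δ ≠ 0) (A B : Fin d) :
    TwoRep φ J sp fun _ M j₃ j' j'' x => LP φ j₃ (M.mField c) x *
      (M.projK φ j' a.succ γ B x * M.projK φ j'' b.succ δ A x +
        M.projK φ j'' a.succ γ A x * M.projK φ j' b.succ δ B x -
        M.projK φ j'' a.succ δ A x * M.projK φ j' b.succ γ B x -
        M.projK φ j' a.succ δ B x * M.projK φ j'' b.succ γ A x) := by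
  have err (α β α' β' : Fin 4) : TwoRep φ J sp fun _ M j₃ j' j'' x => LP φ j₃ (M.mField c) x *
      (M.potErr φ j' j'' α β A x * M.projK φ j' α' β' B x) :=
    of_err c (BiRep.Err_proj true α α' β β' B A)
  have src (β δ : Fin 4) : TwoRep φ J sp fun _ M j₃ j' j'' x => LP φ j₃ (M.mField c) x *
      (M.pot φ j' j'' δ A x *
        ∑ s, (codazziCoef a.succ b.succ β B s : ℂ) * LP φ j' (M.sourceField s) x) :=
    of_err c (BiRep.source_Pot false a.succ b.succ β δ A B hφ hJ₁ hJ₂)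
  -- These are the four terms ∂_a∂_δ(Φ_bΨ_γ) + ∂_b∂_γ(Φ_aΨ_δ) − ∂_a∂_γ(Φ_bΨ_δ) − ∂_b∂_δ(Φ_aΨ_γ),
  -- with Φ and Ψ the potentials of P_{j'}k^B and P_{j''}k^A. The corrections `src` come from the
  -- curls of P_{j'}k^B, and `err` from replacing ∂_aΨ, ∂_bΨ by P_{j''}k^A.
  refine ((((((leibniz hφ hJ₁ hJ₂ c a hδ b.succ γ A B).add
    (leibniz hφ hJ₁ hJ₂ c b hγ a.succ δ A B)).sub
    (leibniz hφ hJ₁ hJ₂ c a hγ b.succ δ A B)).sub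
    (leibniz hφ hJ₁ hJ₂ c b hδ a.succ γ A B)).sub
    ((src δ γ).sub (src γ δ))).add
    (((err a.succ γ δ b.succ).add (err b.succ δ γ a.succ)).sub
      ((err a.succ δ γ b.succ).add (err b.succ γ δ a.succ)))).congr
    fun U hU M j₃ j' j'' hj hJ x hx => ?_
  obtain ⟨c1, c2, c3⟩ := freq_bounds true hJ₁ hJ₂ hj hJ
  have eQ (a : Fin 3) (β : Fin 4) := M.projK_eq hφ hU c1 c2 c3 a.succ β A hx
  have hP (α β : Fin 4) := M.projK_comm (φ := φ) hU j' α β B hx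
  have hQ (α β : Fin 4) := M.projK_comm (φ := φ) hU j'' α β A hx
  have pP (a α β : Fin 4) : pd a (M.projK φ j' α β B) x = pd a (M.projK φ j' β α B) x :=
    pd_congr hU (fun z hz => M.projK_comm hU j' α β B hz) a hx
  have pQ (a α β : Fin 4) : pd a (M.projK φ j'' α β A) x = pd a (M.projK φ j'' β α A) x :=
    pd_congr hU (fun z hz => M.projK_comm hU j'' α β A hz) a hx
  have cod (β : Fin 4) := M.pd_projK hφ hU j' a.succ b.succ β B hx
  simp only [freq, if_true] at eQ
  beta_reduce
  -- Terms containing P_{j''}k_{γδ} or its derivatives cancel in pairs by symmetry in γ, δ (`pQ`,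
  -- `hQ`). Derivatives of P_{j'}k multiply Ψ and combine into curls (`pP`, `cod`). The remaining
  -- products are matched through `eQ` and the symmetry `hP`.
  linear_combination LP φ j₃ (M.mField c) x *
    (M.pot φ j' j'' γ A x * (pP b.succ δ a.succ - pP a.succ δ b.succ - cod δ) +
      M.pot φ j' j'' δ A x * (pP a.succ γ b.succ - pP b.succ γ a.succ + cod γ) -
      M.pot φ j' j' b.succ B x * pQ a.succ δ γ + M.pot φ j' j' a.succ B x * pQ b.succ δ γ -
      (pd a.succ (M.pot φ j' j' b.succ B) x - pd b.succ (M.pot φ j' j' a.succ B) x) * hQ δ γ +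
      M.projK φ j' δ b.succ B x * eQ a γ - M.projK φ j'' a.succ γ A x * hP δ b.succ +
      M.projK φ j' γ a.succ B x * eQ b δ - M.projK φ j'' b.succ δ A x * hP γ a.succ -
      M.projK φ j' γ b.succ B x * eQ a δ + M.projK φ j'' a.succ δ A x * hP γ b.succ -
      M.projK φ j' δ a.succ B x * eQ b γ + M.projK φ j'' b.succ γ A x * hP δ a.succ)

/-- By symmetry of m(e) the indices A and B may be interchanged in one of the two null forms.
Afterwards every P_{j'}k carries B and every P_{j''}k carries A, so `curvature` applies for each
pair of normal indices. -/
lemma contracted (hφ : IsCutoff φ) (hJ₁ : -2 ≤ J) (hJ₂ : J ≤ 2) (a b : Fin 3)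
    {γ δ : Fin 4} (hγ : sp → γ ≠ 0) (hδ : sp → δ ≠ 0) :
    TwoRep φ J sp fun _ (M : FramedImmersion d _) j₃ j' j'' x => ∑ A, ∑ B,
      LP φ j₃ (M.mField (A, B)) x * M.hhWedge φ j' j'' A B a.succ b.succ γ δ x := by
  refine (TwoRep.sum (d := d) Finset.univ fun A _ => TwoRep.sum Finset.univ fun B _ =>
    curvature hφ hJ₁ hJ₂ (A, B) a b hγ hδ A B).congr fun U hU M j₃ j' j'' hj hJ x hx => ?_
  have hm (A B : Fin d) : LP φ j₃ (M.mField (A, B)) x = LP φ j₃ (M.mField (B, A)) x :=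
    mult_congr_on (fun z hz => by simp only [FramedImmersion.mField]; rw [M.gram_comm]) _ hx
  have hswap (f : Fin d → Fin d → ℂ) : ∑ A, ∑ B, LP φ j₃ (M.mField (A, B)) x * f A B =
      ∑ A, ∑ B, LP φ j₃ (M.mField (A, B)) x * f B A := by
    rw [Finset.sum_comm]
    exact Finset.sum_congr rfl fun A _ => Finset.sum_congr rfl fun B _ => by rw [hm]
  have h1 := hswap fun A B => M.projK φ j'' a.succ γ B x * M.projK φ j' b.succ δ A x -
    M.projK φ j' a.succ δ A x * M.projK φ j'' b.succ γ B x
  have h2 (A B : Fin d) : LP φ j₃ (M.mField (A, B)) x * M.hhWedge φ j' j'' A B a.succ b.succ γ δ x =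
      LP φ j₃ (M.mField (A, B)) x * (M.projK φ j' a.succ γ B x * M.projK φ j'' b.succ δ A x -
        M.projK φ j'' a.succ δ A x * M.projK φ j' b.succ γ B x) +
      LP φ j₃ (M.mField (A, B)) x * (M.projK φ j'' a.succ γ B x * M.projK φ j' b.succ δ A x -
        M.projK φ j' a.succ δ A x * M.projK φ j'' b.succ γ B x) := by
    simp only [FramedImmersion.hhWedge, wedge]; ring
  simp only [h2, Finset.sum_add_distrib]
  rw [h1]
  simp only [← Finset.sum_add_distrib]
  exact Finset.sum_congr rfl fun A _ => Finset.sum_congr rfl fun B _ => by ring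

end TwoRep

end MinimalSurface
end

noncomputable section

namespace MinimalSurface

open Filter Topology

/-! ### Convolution bounds on time slices -/

/-- The slice `f(t, ·)` is a function on the torus with an absolutely convergent Fourier series. -/
structure AbsFourier (f : Field) (t : ℝ) : Prop where
  continuous : Continuous fun y : Space => f (Matrix.vecCons t y)
  periodic : IsPeriodic fun y : Space => f (Matrix.vecCons t y)
  summable : Summable (fourierCoef f t)

section

variable {U : Set ℝ} {f : Field} {t : ℝ}

lemma SmoothPer.absFourier_mult (hU : IsOpen U) (hf : SmoothPer U f) {σ : Freq → ℂ}
    (hσ : ModerateSymbol σ) (ht : t ∈ U) : AbsFourier (MinimalSurface.mult σ f) t where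
  continuous := (contPer_mult hU hf hσ).slice_continuous ht
  periodic := (contPer_mult hU hf hσ).slice_periodic ht
  summable := (summable_mult hU hf hσ ht).congr fun ξ => (fourierCoef_mult hU hf hσ ht ξ).symm

lemma SmoothPer.absFourier (hU : IsOpen U) (hf : SmoothPer U f) (ht : t ∈ U) :
    AbsFourier f t where
  continuous := hf.contPer.slice_continuous ht
  periodic := hf.contPer.slice_periodic ht
  summable := (summable_mult hU hf (σ := fun _ => 1) (.of_bounded (C := 1) fun _ => by simp)
    ht).congr fun ξ => one_mul _

lemma AbsFourier.hasSum (hf : AbsFourier f t) (y : Space) :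
    HasSum (fun ξ => fourierCoef f t ξ * chr ξ y) (f (Matrix.vecCons t y)) := by
  have h := hf.summable
  simp only [funext (fourierCoef_eq f t)] at h ⊢
  exact hasSum_coef hf.continuous hf.periodic h y

end

/-- A continuous periodic function is bounded by its essential supremum over the unit cube. -/
lemma IsPeriodic.enorm_le_eLpNorm_top {v : Space → ℂ} (hp : IsPeriodic v) (hc : Continuous v)
    (y : Space) : ‖v y‖ₑ ≤ eLpNorm v ⊤ (volume.restrict unitCube) := by
  by_contra! hlt
  set c := eLpNorm v ⊤ (volume.restrict unitCube)
  let O : Set Space := {z | c < ‖v z‖ₑ}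
  have hO : IsOpen O := isOpen_lt continuous_const hc.enorm
  have hper : IsPeriodic (O.indicator (1 : Space → ℝ≥0∞)) := fun z i => by
    have : (z + Pi.single i 1 ∈ O) ↔ z ∈ O := by simp only [O, Set.mem_ofPred_eq, hp z i]
    by_cases h : z ∈ O
    · simp [Set.indicator_of_mem h, Set.indicator_of_mem (this.mpr h)]
    · rw [Set.indicator_of_notMem h, Set.indicator_of_notMem (mt this.mp h)]
  have h0 : ∫⁻ z in unitCube, O.indicator (1 : Space → ℝ≥0∞) z = 0 := by
    rw [lintegral_indicator_one hO.measurableSet]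
    have := ae_le_eLpNormEssSup (f := v) (μ := volume.restrict unitCube)
    rw [ae_iff] at this
    simpa [O, c, eLpNorm_exponent_top] using this
  -- The superlevel set is periodic and null in the unit cube, hence null in the unit cube centred
  -- at y. But it is open and contains y.
  rw [← hper.setLIntegral_Icc (y - fun _ => 1 / 2), lintegral_indicator_one hO.measurableSet,
    Measure.restrict_apply hO.measurableSet] at h0
  refine (IsOpen.measure_pos (μ := volume) (hO.inter (isOpen_set_pi Set.finite_univ
    (s := fun i => Set.Ioo (y i - 1 / 2) (y i + 1 / 2)) fun i _ => isOpen_Ioo))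
    ⟨y, hlt, by simp [Set.mem_pi]⟩).ne' (measure_mono_null ?_ h0)
  refine Set.inter_subset_inter_right _ fun z hz => ?_
  simp only [Set.mem_pi, Set.mem_univ, Set.mem_Ioo, forall_const] at hz
  refine ⟨fun i => (hz i).1.le, fun i => ?_⟩
  have := (hz i).2.le
  simp only [Pi.add_apply, Pi.sub_apply, Pi.one_apply]
  linarith

/-- The parameter space of the kernels: one frequency variable more than `Freq`. -/
abbrev Freq₄ := EuclideanSpace ℝ (Fin 4)

/-- On the lattice, `σ` is the Fourier transform of a complex measure of mass at most `B`; the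
measure is given as an image of an absolutely continuous one. -/
def HasKernel (σ : Freq → ℂ) (B : ℝ≥0∞) : Prop :=
  ∃ (K : Freq₄ → ℂ) (S : Freq₄ → Space), Integrable K ∧ Measurable S ∧ ∫⁻ z, ‖K z‖ₑ ≤ B ∧
    ∀ ξ, σ (latticePoint ξ) = ∫ z, K z * chr (-ξ) (S z)

namespace HasKernel

variable {σ : Freq → ℂ} {B : ℝ≥0∞} {f : Field} {t : ℝ}

lemma congr (h : HasKernel σ B) {τ : Freq → ℂ} (hτ : ∀ ξ, τ ξ = σ ξ) : HasKernel τ B := by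
  rwa [funext hτ]

lemma const_mul (h : HasKernel σ B) (c : ℂ) : HasKernel (fun ξ => c * σ ξ) (‖c‖ₑ * B) := by
  obtain ⟨K, S, hK, hS, hB, hσ⟩ := h
  refine ⟨fun z => c * K z, S, hK.const_mul c, hS, ?_, fun ξ => ?_⟩
  · simp only [enorm_mul]
    rw [lintegral_const_mul' _ _ enorm_ne_top]
    gcongr
  · simp only [hσ, mul_assoc, integral_const_mul]

lemma mono (h : HasKernel σ B) {B' : ℝ≥0∞} (hB : B ≤ B') : HasKernel σ B' := by
  obtain ⟨K, S, hK, hS, hB', hσ⟩ := h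
  exact ⟨K, S, hK, hS, hB'.trans hB, hσ⟩

/-- Inserting the integral for σ into the absolutely convergent Fourier series and exchanging sum
and integral gives σ(D)f = ∫ K(z) f(· − S(z)) dz, a superposition of translates. -/
lemma enorm_mult_le (h : HasKernel σ B) : ∃ (K : Freq₄ → ℂ) (S : Freq₄ → Space), Integrable K ∧
    Measurable S ∧ ∫⁻ z, ‖K z‖ₑ ≤ B ∧ ∀ (f : Field) (t : ℝ), AbsFourier f t → ∀ y,
      ‖mult σ f (Matrix.vecCons t y)‖ₑ ≤ ∫⁻ z, ‖K z‖ₑ * ‖f (Matrix.vecCons t (y - S z))‖ₑ := by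
  obtain ⟨K, S, hK, hS, hB, hσ⟩ := h
  refine ⟨K, S, hK, hS, hB, fun f t hf y => ?_⟩
  have hm (ξ : Fin 3 → ℤ) : Integrable fun z => K z * (fourierCoef f t ξ * chr ξ (y - S z)) := by
    refine hK.mul_bdd (c := ‖fourierCoef f t ξ‖) ?_ (.of_forall fun z => by simp)
    exact (((continuous_chr ξ).measurable.comp (measurable_const.sub hS)).const_mul
      _).aestronglyMeasurable
  have key : mult σ f (Matrix.vecCons t y) = ∫ z, K z * f (Matrix.vecCons t (y - S z)) := by
    have e1 (z : Freq₄) : K z * f (Matrix.vecCons t (y - S z)) =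
        ∑' ξ, K z * (fourierCoef f t ξ * chr ξ (y - S z)) := by
      rw [tsum_mul_left, (hf.hasSum _).tsum_eq]
    rw [mult_vecCons]
    simp only [e1]
    rw [← integral_tsum_of_summable_integral_norm hm]
    · refine tsum_congr fun ξ => ?_
      rw [hσ, mul_right_comm, ← integral_mul_const, ← integral_mul_const]
      exact integral_congr_ae (.of_forall fun z => by simp only [chr_sub_right]; ring)
    · simp only [norm_mul, norm_chr, mul_one, integral_mul_const]
      exact hf.summable.norm.mul_left _
  rw [key]
  refine (enorm_integral_le_lintegral_enorm _).trans (le_of_eq ?_)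
  simp only [enorm_mul]

lemma sliceNorm_top_le (h : HasKernel σ B) (hf : AbsFourier f t) :
    sliceNorm ⊤ (mult σ f) t ≤ B * sliceNorm ⊤ f t := by
  obtain ⟨K, S, hK, hS, hB, hle⟩ := h.enorm_mult_le
  have hB' : ∀ y, ‖mult σ f (Matrix.vecCons t y)‖ₑ ≤ B * sliceNorm ⊤ f t := fun y => by
    refine (hle f t hf y).trans ?_
    calc ∫⁻ z, ‖K z‖ₑ * ‖f (Matrix.vecCons t (y - S z))‖ₑ
        ≤ ∫⁻ z, ‖K z‖ₑ * sliceNorm ⊤ f t := lintegral_mono fun z => by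
          gcongr
          exact hf.periodic.enorm_le_eLpNorm_top hf.continuous _
      _ = (∫⁻ z, ‖K z‖ₑ) * sliceNorm ⊤ f t := lintegral_mul_const'' _ hK.1.enorm
      _ ≤ B * sliceNorm ⊤ f t := by gcongr
  rw [sliceNorm, eLpNorm_exponent_top]
  exact essSup_le_of_ae_le _ (.of_forall hB')

/-- Young's inequality: Jensen for the measure |K| dz at each point, then Tonelli and the
translation invariance of integrals of periodic functions. -/
lemma sliceNorm_le (h : HasKernel σ B) (hf : AbsFourier f t) {q : ℝ} (hq : 1 ≤ q) :
    sliceNorm (ENNReal.ofReal q) (mult σ f) t ≤ B * sliceNorm (ENNReal.ofReal q) f t := by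
  obtain ⟨K, S, hK, hS, hB, hle⟩ := h.enorm_mult_le
  have hq0 : 0 < q := one_pos.trans_le hq
  have hqe : ENNReal.ofReal q ≠ 0 := by simpa using hq0
  simp only [sliceNorm, eLpNorm_eq_lintegral_rpow_enorm_toReal hqe ENNReal.ofReal_ne_top,
    ENNReal.toReal_ofReal hq0.le]
  have hfm : Measurable fun p : Space × Freq₄ => ‖f (Matrix.vecCons t (p.1 - S p.2))‖ₑ :=
    (hf.continuous.measurable.comp (measurable_fst.sub (hS.comp measurable_snd))).enorm
  have hprod : AEMeasurable (fun p : Space × Freq₄ =>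
      ‖K p.2‖ₑ * ‖f (Matrix.vecCons t (p.1 - S p.2))‖ₑ ^ q)
      ((volume.restrict unitCube).prod volume) :=
    (hK.1.enorm.comp_snd).mul (hfm.pow_const q).aemeasurable
  have h1 (y : Space) : ‖mult σ f (Matrix.vecCons t y)‖ₑ ^ q ≤
      B ^ (q - 1) * ∫⁻ z, ‖K z‖ₑ * ‖f (Matrix.vecCons t (y - S z))‖ₑ ^ q := by
    let g : Freq₄ → ℂ := fun z => f (Matrix.vecCons t (y - S z))
    have hg : Measurable g := hf.continuous.measurable.comp (measurable_const.sub hS)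
    -- Comparison of the L¹ and L^q norms for the finite measure |K| dz.
    have h := eLpNorm'_le_eLpNorm'_mul_rpow_measure_univ one_pos hq
      (hg.aestronglyMeasurable (μ := volume.withDensity fun z => ‖K z‖ₑ))
    rw [eLpNorm'_eq_lintegral_enorm, eLpNorm'_eq_lintegral_enorm,
      lintegral_withDensity_eq_lintegral_mul₀ hK.1.enorm (hg.enorm.pow_const _).aemeasurable,
      lintegral_withDensity_eq_lintegral_mul₀ hK.1.enorm (hg.enorm.pow_const _).aemeasurable,
      withDensity_apply _ MeasurableSet.univ, Measure.restrict_univ] at h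
    simp only [Pi.mul_apply, ENNReal.rpow_one, one_div_one] at h
    calc ‖mult σ f (Matrix.vecCons t y)‖ₑ ^ q ≤ (∫⁻ z, ‖K z‖ₑ * ‖g z‖ₑ) ^ q := by
          gcongr; exact hle f t hf y
      _ ≤ ((∫⁻ z, ‖K z‖ₑ * ‖g z‖ₑ ^ q) ^ (1 / q) * (∫⁻ z, ‖K z‖ₑ) ^ (1 - 1 / q)) ^ q := by
          gcongr
      _ = (∫⁻ z, ‖K z‖ₑ * ‖g z‖ₑ ^ q) * (∫⁻ z, ‖K z‖ₑ) ^ (q - 1) := by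
          rw [ENNReal.mul_rpow_of_nonneg _ _ hq0.le, ← ENNReal.rpow_mul, ← ENNReal.rpow_mul,
            one_div_mul_cancel hq0.ne', ENNReal.rpow_one, sub_mul, one_div_mul_cancel hq0.ne',
            one_mul]
      _ ≤ B ^ (q - 1) * ∫⁻ z, ‖K z‖ₑ * ‖g z‖ₑ ^ q := by
          rw [mul_comm]
          gcongr
  have h2 : ∫⁻ y in unitCube, ∫⁻ z, ‖K z‖ₑ * ‖f (Matrix.vecCons t (y - S z))‖ₑ ^ q ≤
      B * ∫⁻ y in unitCube, ‖f (Matrix.vecCons t y)‖ₑ ^ q := by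
    rw [lintegral_lintegral_swap]
    · have e (z : Freq₄) : ∫⁻ y in unitCube, ‖K z‖ₑ * ‖f (Matrix.vecCons t (y - S z))‖ₑ ^ q =
          ‖K z‖ₑ * ∫⁻ y in unitCube, ‖f (Matrix.vecCons t y)‖ₑ ^ q := by
        rw [lintegral_const_mul' _ _ enorm_ne_top]
        congr 1
        exact IsPeriodic.setLIntegral_sub (v := fun y => ‖f (Matrix.vecCons t y)‖ₑ ^ q)
          (fun y i => by simpa using congrArg (‖·‖ₑ ^ q) (hf.periodic y i)) (S z)
      simp only [e]
      rw [lintegral_mul_const'' _ hK.1.enorm]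
      gcongr
    · exact hprod
  have hBq : B ^ (q - 1) * B = B ^ q := by
    conv_lhs => rw [← ENNReal.rpow_one B, ← ENNReal.rpow_mul, one_mul]
    rw [← ENNReal.rpow_add_of_nonneg _ _ (by linarith) zero_le_one, sub_add_cancel]
  calc (∫⁻ y in unitCube, ‖mult σ f (Matrix.vecCons t y)‖ₑ ^ q) ^ (1 / q)
      ≤ (B ^ q * ∫⁻ y in unitCube, ‖f (Matrix.vecCons t y)‖ₑ ^ q) ^ (1 / q) := by
        gcongr
        calc ∫⁻ y in unitCube, ‖mult σ f (Matrix.vecCons t y)‖ₑ ^ q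
            ≤ ∫⁻ y in unitCube, B ^ (q - 1) *
                ∫⁻ z, ‖K z‖ₑ * ‖f (Matrix.vecCons t (y - S z))‖ₑ ^ q := lintegral_mono h1
          _ = B ^ (q - 1) * ∫⁻ y in unitCube,
                ∫⁻ z, ‖K z‖ₑ * ‖f (Matrix.vecCons t (y - S z))‖ₑ ^ q :=
              lintegral_const_mul'' _ hprod.lintegral_prod_right'
          _ ≤ B ^ (q - 1) * (B * ∫⁻ y in unitCube, ‖f (Matrix.vecCons t y)‖ₑ ^ q) := by gcongr
          _ = B ^ q * ∫⁻ y in unitCube, ‖f (Matrix.vecCons t y)‖ₑ ^ q := by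
              rw [← mul_assoc, hBq]
    _ = B * (∫⁻ y in unitCube, ‖f (Matrix.vecCons t y)‖ₑ ^ q) ^ (1 / q) := by
        rw [ENNReal.mul_rpow_of_nonneg _ _ (by positivity), ← ENNReal.rpow_mul,
          mul_one_div_cancel hq0.ne', ENNReal.rpow_one]

end HasKernel

end MinimalSurface
end

noncomputable section

namespace MinimalSurface

open Filter Topology

/-! ### Kernels of smooth symbols -/

/-- The point `(η, ξ)`. -/
def consFreq (η : ℝ) (ξ : Freq) : Freq₄ := WithLp.toLp 2 (Matrix.vecCons η fun i => ξ i)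

/-- The last three components. -/
def tailFreq (w : Freq₄) : Freq := WithLp.toLp 2 fun i => w i.succ

@[simp] lemma consFreq_zero (η : ℝ) (ξ : Freq) : consFreq η ξ 0 = η := rfl

@[simp] lemma consFreq_succ (η : ℝ) (ξ : Freq) (i : Fin 3) : consFreq η ξ i.succ = ξ i := rfl

@[simp] lemma tailFreq_consFreq (η : ℝ) (ξ : Freq) : tailFreq (consFreq η ξ) = ξ := rfl

lemma norm_sq_freq₄ (w : Freq₄) : ‖w‖ ^ 2 = w 0 ^ 2 + ‖tailFreq w‖ ^ 2 := by
  simp [EuclideanSpace.norm_sq_eq, Fin.sum_univ_succ, tailFreq]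

lemma norm_tailFreq_le (w : Freq₄) : ‖tailFreq w‖ ≤ ‖w‖ :=
  (sq_le_sq₀ (norm_nonneg _) (norm_nonneg _)).mp (by
    have := norm_sq_freq₄ w; nlinarith [sq_nonneg (w 0)])

lemma contDiff_tailFreq : ContDiff ℝ ∞ tailFreq :=
  contDiff_euclidean.mpr fun i => (EuclideanSpace.proj (𝕜 := ℝ) i.succ).contDiff

/-- The kernel bound for dilations and slices of a test function. -/
lemma HasKernel.exists_of_testFunction {F : Freq₄ → ℂ} (hF : ContDiff ℝ ∞ F)
    (hs : HasCompactSupport F) :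
    ∃ B : ℝ≥0, ∀ η r : ℝ, HasKernel (fun ξ => F (consFreq η (r • ξ))) B := by
  open scoped FourierTransform in
  obtain ⟨k, hk⟩ : ∃ k : SchwartzMap Freq₄ ℂ, ∀ w, F w = 𝓕 (k : Freq₄ → ℂ) w := by
    refine ⟨𝓕⁻ (hs.toSchwartzMap hF), fun w => ?_⟩
    rw [← SchwartzMap.fourier_coe, FourierTransform.fourier_fourierInv_eq]
    rfl
  have hki : Integrable k := k.integrable
  -- One Schwartz kernel on ℝ⁴ serves all η and r. Fixing η multiplies it by a phase in z_0, and
  -- dilating by r rescales the translation vector, so the mass does not depend on η or r.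
  refine ⟨(∫⁻ z, ‖k z‖ₑ).toNNReal, fun η r => ⟨fun z => k z *
    Complex.exp ((-(2 * Real.pi * (z 0 * η)) : ℝ) * Complex.I),
    fun z i => r * z i.succ, ?_, ?_, ?_, fun ξ => ?_⟩⟩
  · refine hki.mul_bdd (c := 1) ?_ (.of_forall fun z => ?_)
    · exact Continuous.aestronglyMeasurable (by fun_prop)
    · exact (Complex.norm_exp_ofReal_mul_I _).le
  · exact Continuous.measurable (by fun_prop)
  · rw [ENNReal.coe_toNNReal hki.2.ne]
    refine lintegral_mono fun z => ?_
    rw [enorm_mul, ← ofReal_norm (Complex.exp _), Complex.norm_exp_ofReal_mul_I]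
    simp
  · beta_reduce
    rw [hk, Real.fourier_eq']
    refine integral_congr_ae (.of_forall fun z => ?_)
    simp only [smul_eq_mul]
    rw [mul_comm, mul_assoc (k z)]
    congr 1
    simp only [chr, ← Complex.exp_add]
    congr 1
    have : inner ℝ z (consFreq η (r • latticePoint ξ)) =
        z 0 * η + ∑ i : Fin 3, (ξ i : ℝ) * (r * z i.succ) := by
      simp only [PiLp.inner_apply, Fin.sum_univ_succ (n := 3), consFreq_zero, consFreq_succ]
      congr 1
      · simp [mul_comm]
      · exact Finset.sum_congr rfl fun i _ => by simp [latticePoint]; ring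
    rw [this]
    push_cast
    simp only [Pi.neg_apply, Int.cast_neg, neg_mul, Finset.sum_neg_distrib]
    ring

lemma hasCompactSupport_of_norm {V E : Type*} [NormedAddCommGroup V] [ProperSpace V]
    [Zero E] {F : V → E} {R : ℝ} (h : ∀ w, R < ‖w‖ → F w = 0) : HasCompactSupport F :=
  HasCompactSupport.intro (isCompact_closedBall (0 : V) R) fun w hw => h w (by simpa using hw)

lemma norm_le_of_coords {w : Freq₄} {a b : ℝ} (ha : |w 0| ≤ a) (hb : ‖tailFreq w‖ ≤ b) :
    ‖w‖ ≤ a + b := by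
  have h1 := norm_sq_freq₄ w
  have h2 := abs_nonneg (w 0)
  rw [← sq_abs (w 0)] at h1
  nlinarith [norm_nonneg w, norm_nonneg (tailFreq w), sq_nonneg (‖w‖ - a - b),
    mul_nonneg (h2.trans ha) ((norm_nonneg _).trans hb)]

/-- Kernel bound for a product of test functions of `η` and `ξ`, divided by a power of the norm. -/
lemma HasKernel.exists_of_product {θ : ℝ → ℝ} {h : Freq → ℂ} {Rθ Rh : ℝ} (hθ : ContDiff ℝ ∞ θ)
    (hh : ContDiff ℝ ∞ h) (hθR : ∀ z, Rθ < |z| → θ z = 0) (hhR : ∀ ξ, Rh < ‖ξ‖ → h ξ = 0)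
    {s : ℝ} (h0 : s = 0 ∨ ∀ w : Freq₄, ‖w‖ < 1 / 16 → (θ (w 0) : ℂ) * h (tailFreq w) = 0) :
    ∃ B : ℝ≥0, ∀ η r : ℝ, HasKernel (fun ξ => θ η * h (r • ξ) *
      (((η ^ 2 + ‖r • ξ‖ ^ 2) ^ (-s / 2) : ℝ) : ℂ)) B := by
  set F : Freq₄ → ℂ := fun w => θ (w 0) * h (tailFreq w) * (((‖w‖ ^ 2) ^ (-s / 2) : ℝ) : ℂ)
  have hc : ContDiff ℝ ∞ fun w : Freq₄ => (θ (w 0) : ℂ) * h (tailFreq w) :=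
    (Complex.ofRealCLM.contDiff.comp (hθ.comp (EuclideanSpace.proj (𝕜 := ℝ)
      (0 : Fin 4)).contDiff)).mul (hh.comp contDiff_tailFreq)
  have hF : ContDiff ℝ ∞ F := by
    rcases h0 with rfl | h0
    · simpa [F] using hc
    -- The power of the norm is singular only at the origin, near which the product of cut-offs
    -- vanishes.
    · refine contDiff_of_vanish_near_zero (fun w hw => by simp only [F, h0 w hw, zero_mul])
        fun w hw => hc.contDiffAt.mul (Complex.ofRealCLM.contDiff.contDiffAt.comp w ?_)
      exact ((contDiff_norm_sq ℝ).contDiffAt).rpow_const_of_ne (by positivity)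
  obtain ⟨B, hB⟩ := HasKernel.exists_of_testFunction hF (hasCompactSupport_of_norm
    (R := Rθ + Rh) fun w hw => by
      by_cases h1 : Rθ < |w 0|
      · simp only [F, hθR _ h1, Complex.ofReal_zero, zero_mul]
      by_cases h2 : Rh < ‖tailFreq w‖
      · simp only [F, hhR _ h2, zero_mul, mul_zero]
      · exact absurd hw (not_lt.mpr (norm_le_of_coords (not_lt.mp h1) (not_lt.mp h2))))
  exact ⟨B, fun η r => (hB η r).congr fun ξ => by simp [F, norm_sq_freq₄]⟩

/-- Kernel bound for the dilations of a test function. -/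
lemma HasKernel.exists_of_dilation {h : Freq → ℂ} {R : ℝ} (hh : ContDiff ℝ ∞ h)
    (hR : ∀ ξ, R < ‖ξ‖ → h ξ = 0) : ∃ B : ℝ≥0, ∀ r : ℝ, HasKernel (fun ξ => h (r • ξ)) B := by
  let θ : ContDiffBump (0 : ℝ) := ⟨1, 2, by norm_num, by norm_num⟩
  obtain ⟨B, hB⟩ := HasKernel.exists_of_product (θ := θ) (Rθ := 2) (s := 0) θ.contDiff hh
    (fun z hz => θ.zero_of_le_dist (by simpa using hz.le)) hR (.inl rfl)
  refine ⟨B, fun r => (hB 0 r).congr fun ξ => ?_⟩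
  rw [θ.one_of_mem_closedBall (by simp [θ])]
  simp

lemma IsAnnular.exists_hasKernel {h : Freq → ℂ} (hh : IsAnnular h) : ∃ B : ℝ≥0, ∀ (r : ℤ) (j : ℕ),
    HasKernel (scaledSymbol r h j) (ENNReal.ofReal ((2 ^ j) ^ r) * B) := by
  obtain ⟨B, hB⟩ := HasKernel.exists_of_dilation hh.smooth hh.eq_zero_of_gt
  refine ⟨B, fun r j => ((hB _).const_mul (((2 : ℝ) ^ j) ^ r : ℝ)).mono (le_of_eq ?_)⟩
  rw [← ofReal_norm, Complex.norm_real, Real.norm_of_nonneg (by positivity)]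

/-! ### Littlewood--Paley kernels -/

section LPKernel

variable {φ : ℝ → ℝ}

lemma contDiff_radial (hφ : IsCutoff φ) : ContDiff ℝ ∞ fun ξ : Freq => φ ‖ξ‖ := by
  have : ContDiff ℝ ∞ fun ξ : Freq => φ ‖ξ‖ - 1 := by
    refine contDiff_of_vanish_near_zero (fun ξ hξ => ?_) fun ξ hξ =>
      (hφ.smooth.contDiffAt.comp ξ (contDiffAt_norm ℝ hξ)).sub contDiffAt_const
    rw [hφ.eq_one _ (by linarith), sub_self]
  simpa using this.add (contDiff_const (c := (1 : ℝ)))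

/-- The unscaled symbol of `P_j`. -/
def lpProfile (φ : ℝ → ℝ) (j : ℕ) (ξ : Freq) : ℂ :=
  if j = 0 then ((φ ‖ξ‖ : ℝ) : ℂ) else ((φ ‖ξ‖ - φ (2 * ‖ξ‖) : ℝ) : ℂ)

lemma lpSymbol_eq (φ : ℝ → ℝ) (j : ℕ) (ξ : Freq) :
    lpSymbol φ j ξ = lpProfile φ j (((2 : ℝ) ^ j)⁻¹ • ξ) := by
  have hn : ‖((2 : ℝ) ^ j)⁻¹ • ξ‖ = ‖ξ‖ / 2 ^ j := by
    rw [norm_smul, norm_inv, Real.norm_of_nonneg (by positivity), inv_mul_eq_div]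
  rcases eq_or_ne j 0 with rfl | h
  · simp [lpSymbol, lpProfile]
  · simp [lpSymbol, lpProfile, h, hn, mul_div_assoc]

/-- Up to dilation only two symbols occur, so uniformity in j reduces to the maximum, or sum, of two
constants. -/
lemma lpProfile_cases (φ : ℝ → ℝ) (j : ℕ) :
    (j = 0 ∧ lpProfile φ j = lpProfile φ 0) ∨ (j ≠ 0 ∧ lpProfile φ j = lpProfile φ 1) := by
  rcases eq_or_ne j 0 with rfl | h
  · exact .inl ⟨rfl, rfl⟩
  · exact .inr ⟨h, funext fun ξ => by simp [lpProfile, h]⟩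

lemma contDiff_lpProfile (hφ : IsCutoff φ) (j : ℕ) : ContDiff ℝ ∞ (lpProfile φ j) := by
  have h1 := contDiff_radial hφ
  have h2 : ContDiff ℝ ∞ fun ξ : Freq => φ (2 * ‖ξ‖) := by
    have := h1.comp (contDiff_const_smul (𝕜 := ℝ) (F := Freq) (2 : ℝ))
    simpa [Function.comp_def, norm_smul] using this
  unfold lpProfile
  split_ifs
  · exact Complex.ofRealCLM.contDiff.comp h1
  · exact Complex.ofRealCLM.contDiff.comp (h1.sub h2)

lemma lpProfile_eq_zero (hφ : IsCutoff φ) (j : ℕ) {ξ : Freq} (hξ : 2 < ‖ξ‖) :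
    lpProfile φ j ξ = 0 := by
  simp [lpProfile, hφ.eq_zero ‖ξ‖ (by linarith), hφ.eq_zero (2 * ‖ξ‖) (by linarith)]

lemma lpProfile_one_eq_zero (hφ : IsCutoff φ) {ξ : Freq} (hξ : ‖ξ‖ ≤ 3 / 4) :
    lpProfile φ 1 ξ = 0 := by
  simp [lpProfile, hφ.eq_one ‖ξ‖ (by linarith), hφ.eq_one (2 * ‖ξ‖) (by linarith)]

lemma exists_hasKernel_lpSymbol (hφ : IsCutoff φ) :
    ∃ B : ℝ≥0, ∀ j, HasKernel (lpSymbol φ j) B := by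
  have h (i : ℕ) := HasKernel.exists_of_dilation (contDiff_lpProfile hφ i)
    (fun ξ hξ => lpProfile_eq_zero hφ i hξ)
  obtain ⟨B₀, h₀⟩ := h 0
  obtain ⟨B₁, h₁⟩ := h 1
  refine ⟨max B₀ B₁, fun j => ?_⟩
  simp only [funext (lpSymbol_eq φ j)]
  rcases lpProfile_cases φ j with ⟨-, e⟩ | ⟨-, e⟩ <;> rw [e]
  · exact (h₀ _).mono (by exact_mod_cast le_max_left _ _)
  · exact (h₁ _).mono (by exact_mod_cast le_max_right _ _)

/-- The kernels of `P_j ∂_a`. -/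
lemma exists_hasKernel_lpSymbol_deriv (hφ : IsCutoff φ) : ∃ B : ℝ≥0, ∀ (j : ℕ) (a : Fin 3),
    HasKernel (fun ξ => lpSymbol φ j ξ * (2 * Real.pi * Complex.I * ((ξ a : ℝ) : ℂ)))
      (ENNReal.ofReal (2 ^ j) * B) := by
  have h (i : ℕ) (a : Fin 3) := HasKernel.exists_of_dilation (R := 2)
    (h := fun ξ => lpProfile φ i ξ * (2 * Real.pi * Complex.I * ((ξ a : ℝ) : ℂ)))
    ((contDiff_lpProfile hφ i).mul (contDiff_const.mul
      (Complex.ofRealCLM.contDiff.comp (EuclideanSpace.proj (𝕜 := ℝ) a).contDiff)))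
    (fun ξ hξ => by rw [lpProfile_eq_zero hφ i hξ, zero_mul])
  choose B hB using h
  refine ⟨∑ a, (B 0 a + B 1 a), fun j a => ?_⟩
  have key (i : ℕ) (hi : i ≤ 1) (e : lpProfile φ j = lpProfile φ i) :
      HasKernel (fun ξ => lpSymbol φ j ξ * (2 * Real.pi * Complex.I * ((ξ a : ℝ) : ℂ)))
        (ENNReal.ofReal (2 ^ j) * (∑ a, (B 0 a + B 1 a) : ℝ≥0)) := by
    refine (((hB i a ((2 : ℝ) ^ j)⁻¹).const_mul ((2 : ℝ) ^ j : ℝ)).congr fun ξ => ?_).mono ?_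
    · rw [lpSymbol_eq, e, PiLp.smul_apply, smul_eq_mul]
      have : ((2 : ℂ) ^ j) ≠ 0 := pow_ne_zero _ two_ne_zero
      push_cast
      field_simp
    · rw [← ofReal_norm, Complex.norm_real, Real.norm_of_nonneg (by positivity)]
      gcongr
      refine le_trans ?_ (Finset.single_le_sum (f := fun a => B 0 a + B 1 a)
        (fun _ _ => zero_le) (Finset.mem_univ a))
      interval_cases i
      · exact le_self_add
      · exact le_add_self
  rcases lpProfile_cases φ j with ⟨-, e⟩ | ⟨-, e⟩
  · exact key 0 zero_le_one e
  · exact key 1 le_rfl e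

/-- The kernels of `P_j ⟨D⟩^{-s}`. -/
lemma exists_hasKernel_lpSymbol_bracket (hφ : IsCutoff φ) (s : ℝ) : ∃ B : ℝ≥0, ∀ j : ℕ,
    HasKernel (fun ξ => lpSymbol φ j ξ * (((1 + ‖ξ‖ ^ 2) ^ (-s / 2) : ℝ) : ℂ))
      (ENNReal.ofReal (2 ^ (-s * j)) * B) := by
  -- The extra frequency variable makes the inhomogeneous bracket homogeneous: 1 + |ξ|² = 2^{2j}(η²
  -- + |2^{-j}ξ|²) with η = 2^{-j}. For j = 0 one has η = 1, and `θ₀` keeps away from the origin,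
  -- where the profile does not vanish. For j > 0 the profile itself vanishes near 0, and `θ₁`
  -- equals 1 at η = 2^{-j}.
  let θ₀ : ContDiffBump (1 : ℝ) := ⟨1 / 4, 1 / 2, by norm_num, by norm_num⟩
  let θ₁ : ContDiffBump (0 : ℝ) := ⟨1, 2, by norm_num, by norm_num⟩
  obtain ⟨B₀, h₀⟩ := HasKernel.exists_of_product (θ := θ₀) (Rθ := 2) (s := s) θ₀.contDiff
    (contDiff_lpProfile hφ 0) (fun z hz => θ₀.zero_of_le_dist (by
      rw [Real.dist_eq]
      have := abs_sub_abs_le_abs_sub z 1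
      simp only [abs_one] at this
      show (1 / 2 : ℝ) ≤ _
      linarith)) (fun ξ hξ => lpProfile_eq_zero hφ 0 hξ) (.inr fun w hw => by
        rw [θ₀.zero_of_le_dist, Complex.ofReal_zero, zero_mul]
        have := PiLp.norm_apply_le w 0
        rw [Real.norm_eq_abs] at this
        have h2 := le_abs_self (w 0)
        rw [Real.dist_eq, abs_sub_comm]
        show (1 / 2 : ℝ) ≤ _
        exact le_trans (by linarith) (le_abs_self (1 - w 0)))
  obtain ⟨B₁, h₁⟩ := HasKernel.exists_of_product (θ := θ₁) (Rθ := 2) (s := s) θ₁.contDiff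
    (contDiff_lpProfile hφ 1) (fun z hz => θ₁.zero_of_le_dist (by simpa using hz.le))
    (fun ξ hξ => lpProfile_eq_zero hφ 1 hξ) (.inr fun w hw => by
      rw [lpProfile_one_eq_zero hφ ((norm_tailFreq_le w).trans (by linarith)), mul_zero])
  refine ⟨max B₀ B₁, fun j => ?_⟩
  rcases lpProfile_cases φ j with ⟨rfl, -⟩ | ⟨hj, e⟩
  · refine ((h₀ 1 1).congr fun ξ => ?_).mono ?_
    · rw [θ₀.one_of_mem_closedBall (by simp [θ₀]), lpSymbol_eq]
      simp
    · simp
  · refine (((h₁ ((2 : ℝ) ^ j)⁻¹ ((2 : ℝ) ^ j)⁻¹).const_mul ((2 ^ (-s * j) : ℝ) : ℂ)).congr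
      fun ξ => ?_).mono ?_
    · have hp : (0 : ℝ) < 2 ^ j := by positivity
      rw [θ₁.one_of_mem_closedBall (by
        simp only [θ₁, Metric.mem_closedBall, dist_zero_right, norm_inv, Real.norm_of_nonneg hp.le]
        exact inv_le_one_of_one_le₀ (one_le_pow₀ one_le_two)), lpSymbol_eq, e,
        Complex.ofReal_one, one_mul, mul_left_comm, ← Complex.ofReal_mul]
      congr 3
      rw [norm_smul, mul_pow, norm_inv, Real.norm_of_nonneg hp.le, ← mul_one_add,
        Real.mul_rpow (by positivity) (by positivity), ← mul_assoc,
        show ((2 : ℝ) ^ j)⁻¹ ^ 2 = 2 ^ (-2 * j : ℝ) by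
          rw [mul_comm, Real.rpow_mul zero_le_two, Real.rpow_natCast, Real.rpow_neg hp.le,
            inv_pow]
          norm_num,
        ← Real.rpow_mul zero_le_two, ← Real.rpow_add two_pos]
      ring_nf
      simp
    · rw [← ofReal_norm, Complex.norm_real, Real.norm_of_nonneg (by positivity)]
      gcongr
      exact le_max_right _ _

end LPKernel

end MinimalSurface
end

noncomputable section

namespace MinimalSurface

open Filter Topology

/-! ### Bernstein's inequality -/

lemma star_chr (ξ : Fin 3 → ℤ) (y : Space) : star (chr ξ y) = chr (-ξ) y := by
  rw [chr_neg, chr, Complex.star_def, ← Complex.exp_conj]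
  congr 1
  simp [Complex.conj_ofReal, map_ofNat]

lemma integrable_unitCube {f : Space → ℂ} (hf : Continuous f) :
    Integrable f (volume.restrict unitCube) :=
  hf.continuousOn.integrableOn_compact isCompact_Icc

lemma continuous_trigSum (F : Finset (Fin 3 → ℤ)) (c : (Fin 3 → ℤ) → ℂ) :
    Continuous fun z => ∑ ξ ∈ F, c ξ * chr (-ξ) z :=
  continuous_finsetSum _ fun _ _ => continuous_const.mul (continuous_chr _)

/-- Parseval's identity for trigonometric polynomials. -/
lemma lintegral_trigSum_sq (F : Finset (Fin 3 → ℤ)) (c : (Fin 3 → ℤ) → ℂ) :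
    ∫⁻ z in unitCube, ‖∑ ξ ∈ F, c ξ * chr (-ξ) z‖ₑ ^ 2 = ENNReal.ofReal (∑ ξ ∈ F, ‖c ξ‖ ^ 2) := by
  have hc := continuous_trigSum F c
  have h1 : ∫ z in unitCube, ‖∑ ξ ∈ F, c ξ * chr (-ξ) z‖ ^ 2 = ∑ ξ ∈ F, ‖c ξ‖ ^ 2 := by
    have e (z : Space) : ((‖∑ ξ ∈ F, c ξ * chr (-ξ) z‖ ^ 2 : ℝ) : ℂ) =
        ∑ ξ ∈ F, ∑ η ∈ F, c ξ * star (c η) * (chr η z * chr (-ξ) z) := by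
      rw [Complex.ofReal_pow, ← Complex.mul_conj', ← Complex.star_def, star_sum,
        Finset.sum_mul_sum]
      refine Finset.sum_congr rfl fun ξ _ => Finset.sum_congr rfl fun η _ => ?_
      rw [star_mul', star_chr, neg_neg]
      ring
    apply Complex.ofReal_injective
    rw [← integral_complex_ofReal]
    simp only [e]
    rw [integral_finsetSum _ fun ξ _ => integrable_unitCube (by
      refine continuous_finsetSum _ fun η _ => continuous_const.mul ?_
      exact (continuous_chr _).mul (continuous_chr _)), Complex.ofReal_sum]
    refine Finset.sum_congr rfl fun ξ hξ => ?_
    have hi (η : Fin 3 → ℤ) : Integrable (fun z => c ξ * star (c η) * (chr η z * chr (-ξ) z))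
        (volume.restrict unitCube) :=
      integrable_unitCube (continuous_const.mul ((continuous_chr _).mul (continuous_chr _)))
    rw [integral_finsetSum _ fun η _ => hi η]
    have e2 (η : Fin 3 → ℤ) : ∫ z in unitCube, c ξ * star (c η) * (chr η z * chr (-ξ) z) =
        if η = ξ then c ξ * star (c η) else 0 := by
      rw [integral_const_mul]
      have := coef_chr η ξ
      rw [coef] at this
      rw [this]
      split_ifs <;> simp
    simp only [e2, Finset.sum_ite_eq', hξ, if_true]
    rw [Complex.star_def, Complex.mul_conj', Complex.ofReal_pow]
  rw [← h1, ofReal_integral_eq_lintegral_ofReal]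
  · refine lintegral_congr fun z => ?_
    rw [ENNReal.ofReal_pow (norm_nonneg _), ofReal_norm]
  · exact (hc.norm.pow 2).continuousOn.integrableOn_compact isCompact_Icc
  · exact .of_forall fun z => by positivity

/-- The sum is ∫ v·T for a trigonometric polynomial T. Hölder with exponents 3/2 and 3 applies, and
‖T‖₃³ ≤ ‖T‖_∞‖T‖₂² ≤ n³b · n³b² by counting frequencies and Parseval. -/
lemma enorm_sum_coef_le {v : Space → ℂ} (hv : Continuous v) {F : Finset (Fin 3 → ℤ)}
    {c : (Fin 3 → ℤ) → ℂ} {b n : ℝ} (hb : ∀ ξ ∈ F, ‖c ξ‖ ≤ b) (hb0 : 0 ≤ b) (hn : 0 ≤ n)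
    (hF : (F.card : ℝ) ≤ n ^ 3) : ‖∑ ξ ∈ F, c ξ * coef v ξ‖ₑ ≤
      ENNReal.ofReal (n ^ 2 * b) * eLpNorm v (ENNReal.ofReal (3 / 2)) (volume.restrict unitCube) := by
  set T : Space → ℂ := fun z => ∑ ξ ∈ F, c ξ * chr (-ξ) z
  have hT : Continuous T := continuous_trigSum F c
  have h1 : ∑ ξ ∈ F, c ξ * coef v ξ = ∫ z in unitCube, v z * T z := by
    have hi (ξ : Fin 3 → ℤ) : Integrable (fun z => c ξ * (v z * chr (-ξ) z))
        (volume.restrict unitCube) :=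
      integrable_unitCube (continuous_const.mul (hv.mul (continuous_chr _)))
    simp only [coef, ← integral_const_mul]
    rw [← integral_finsetSum _ fun ξ _ => hi ξ]
    refine integral_congr_ae (.of_forall fun z => ?_)
    simp only [T, Finset.mul_sum]
    exact Finset.sum_congr rfl fun ξ _ => by ring
  have h2 : ∫⁻ z in unitCube, ‖T z‖ₑ ^ (3 : ℝ) ≤ ENNReal.ofReal ((n ^ 2 * b) ^ 3) := by
    have hTb (z : Space) : ‖T z‖ₑ ≤ ENNReal.ofReal (n ^ 3 * b) := by
      rw [← ofReal_norm]
      refine ENNReal.ofReal_le_ofReal ((norm_sum_le _ _).trans ?_)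
      calc ∑ ξ ∈ F, ‖c ξ * chr (-ξ) z‖ ≤ ∑ ξ ∈ F, b :=
            Finset.sum_le_sum fun ξ hξ => by simpa using hb ξ hξ
        _ ≤ n ^ 3 * b := by rw [Finset.sum_const, nsmul_eq_mul]; gcongr
    calc ∫⁻ z in unitCube, ‖T z‖ₑ ^ (3 : ℝ)
        ≤ ∫⁻ z in unitCube, ENNReal.ofReal (n ^ 3 * b) * ‖T z‖ₑ ^ 2 := lintegral_mono fun z => by
          rw [show (3 : ℝ) = (3 : ℕ) by norm_num, ENNReal.rpow_natCast, pow_succ']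
          gcongr
          exact hTb z
      _ = ENNReal.ofReal (n ^ 3 * b) * ENNReal.ofReal (∑ ξ ∈ F, ‖c ξ‖ ^ 2) := by
          rw [lintegral_const_mul' _ _ ENNReal.ofReal_ne_top, lintegral_trigSum_sq]
      _ ≤ ENNReal.ofReal ((n ^ 2 * b) ^ 3) := by
          rw [← ENNReal.ofReal_mul (by positivity)]
          refine ENNReal.ofReal_le_ofReal ?_
          calc n ^ 3 * b * ∑ ξ ∈ F, ‖c ξ‖ ^ 2 ≤ n ^ 3 * b * (n ^ 3 * b ^ 2) := by
                gcongr
                calc ∑ ξ ∈ F, ‖c ξ‖ ^ 2 ≤ ∑ ξ ∈ F, b ^ 2 :=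
                      Finset.sum_le_sum fun ξ hξ => by gcongr; exact hb ξ hξ
                  _ ≤ n ^ 3 * b ^ 2 := by rw [Finset.sum_const, nsmul_eq_mul]; gcongr
            _ = (n ^ 2 * b) ^ 3 := by ring
  rw [h1]
  calc ‖∫ z in unitCube, v z * T z‖ₑ ≤ ∫⁻ z in unitCube, ‖v z‖ₑ * ‖T z‖ₑ := by
        simpa only [enorm_mul] using enorm_integral_le_lintegral_enorm (fun z => v z * T z)
    _ ≤ (∫⁻ z in unitCube, ‖v z‖ₑ ^ (3 / 2 : ℝ)) ^ (1 / (3 / 2 : ℝ)) *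
          (∫⁻ z in unitCube, ‖T z‖ₑ ^ (3 : ℝ)) ^ (1 / (3 : ℝ)) :=
        ENNReal.lintegral_mul_le_Lp_mul_Lq _ (Real.holderConjugate_iff.mpr (by norm_num))
          hv.enorm.aemeasurable hT.enorm.aemeasurable
    _ ≤ (∫⁻ z in unitCube, ‖v z‖ₑ ^ (3 / 2 : ℝ)) ^ (1 / (3 / 2 : ℝ)) *
          ENNReal.ofReal (n ^ 2 * b) := by
        gcongr
        calc _ ≤ (ENNReal.ofReal ((n ^ 2 * b) ^ 3)) ^ (1 / (3 : ℝ)) := by gcongr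
          _ = ENNReal.ofReal (n ^ 2 * b) := by
            rw [ENNReal.ofReal_rpow_of_nonneg (by positivity) (by norm_num), ← Real.rpow_natCast,
              ← Real.rpow_mul (by positivity)]
            norm_num
    _ = _ := by
        rw [mul_comm, eLpNorm_eq_lintegral_rpow_enorm_toReal (by simp) ENNReal.ofReal_ne_top,
          ENNReal.toReal_ofReal (by norm_num)]

lemma HasKernel.enorm_le {σ : Freq → ℂ} {B : ℝ≥0∞} (h : HasKernel σ B) (ξ : Fin 3 → ℤ) :
    ‖σ (latticePoint ξ)‖ₑ ≤ B := by
  obtain ⟨K, S, hK, hS, hB, hσ⟩ := h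
  rw [hσ]
  refine (enorm_integral_le_lintegral_enorm _).trans ((lintegral_mono fun z => ?_).trans hB)
  rw [enorm_mul, ← ofReal_norm (chr _ _), norm_chr, ENNReal.ofReal_one, mul_one]

lemma HasKernel.norm_le {σ : Freq → ℂ} {B : ℝ≥0} (h : HasKernel σ B) (ξ : Fin 3 → ℤ) :
    ‖σ (latticePoint ξ)‖ ≤ B := by
  have := h.enorm_le ξ
  rw [enorm_eq_nnnorm, ENNReal.coe_le_coe] at this
  exact_mod_cast this

section Estimates

variable {φ : ℝ → ℝ}

lemma card_lpSymbol_le (hφ : IsCutoff φ) (j : ℕ) :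
    ((finiteSymbol_lpSymbol hφ j).toFinset.card : ℝ) ≤ (8 * 2 ^ j) ^ 3 := by
  have hsub : (finiteSymbol_lpSymbol hφ j).toFinset ⊆
      Fintype.piFinset fun _ : Fin 3 => Finset.Icc (-(2 ^ (j + 1)) : ℤ) (2 ^ (j + 1)) := by
    intro ξ hξ
    replace hξ := (Set.Finite.mem_toFinset (finiteSymbol_lpSymbol hφ j)).mp hξ
    rw [Fintype.mem_piFinset]
    intro i
    have h1 : ‖latticePoint ξ‖ ≤ 2 * 2 ^ j := by
      by_contra! h
      refine hξ ?_
      rw [lpSymbol_eq, lpProfile_eq_zero hφ]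
      rw [norm_smul, norm_inv, Real.norm_of_nonneg (by positivity), inv_mul_eq_div,
        lt_div_iff₀ (by positivity)]
      exact h
    have h2 : |(ξ i : ℝ)| ≤ 2 ^ (j + 1) := by
      have := (PiLp.norm_apply_le (latticePoint ξ) i).trans h1
      rw [pow_succ']
      simpa [latticePoint] using this
    rw [Finset.mem_Icc, ← abs_le]
    exact_mod_cast h2
  have h3 := Finset.card_le_card hsub
  rw [Fintype.card_piFinset, Finset.prod_const, Finset.card_univ, Fintype.card_fin,
    Int.card_Icc] at h3
  -- An interval of 4 · 2^j + 1 integers in each coordinate.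
  have h4 : (2 ^ (j + 1) + 1 - -(2 ^ (j + 1)) : ℤ).toNat ≤ 8 * 2 ^ j := by
    have : (1 : ℤ) ≤ 2 ^ j := one_le_pow₀ (by norm_num)
    have e : (2 ^ (j + 1) : ℤ) = 2 * 2 ^ j := pow_succ' _ _
    rw [Int.toNat_le]
    push_cast
    omega
  exact_mod_cast h3.trans (Nat.pow_le_pow_left h4 3)

/-- Bernstein's inequality for `P_j`. -/
lemma exists_bernstein (hφ : IsCutoff φ) : ∃ C : ℝ≥0, ∀ (j : ℕ) (f : Field) (t : ℝ),
    Continuous (fun y : Space => f (Matrix.vecCons t y)) → sliceNorm ⊤ (LP φ j f) t ≤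
      ENNReal.ofReal ((2 ^ j) ^ 2) * C * sliceNorm (ENNReal.ofReal (3 / 2)) f t := by
  obtain ⟨B, hB⟩ := exists_hasKernel_lpSymbol hφ
  -- 64 = 8² comes from n = 8 · 2^j in the count of frequencies; the loss is n².
  refine ⟨64 * B, fun j f t hf => ?_⟩
  rw [sliceNorm, eLpNorm_exponent_top]
  refine essSup_le_of_ae_le _ (.of_forall fun y => ?_)
  have h := enorm_sum_coef_le hf (F := (finiteSymbol_lpSymbol hφ j).toFinset)
    (c := fun ξ => lpSymbol φ j (latticePoint ξ) * chr ξ y) (b := B) (n := 8 * 2 ^ j)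
    (fun ξ _ => by simpa using (hB j).norm_le ξ) B.2 (by positivity) (card_lpSymbol_le hφ j)
  have e : LP φ j f (Matrix.vecCons t y) = ∑ ξ ∈ (finiteSymbol_lpSymbol hφ j).toFinset,
      lpSymbol φ j (latticePoint ξ) * chr ξ y * coef (fun y => f (Matrix.vecCons t y)) ξ := by
    rw [LP, (finiteSymbol_lpSymbol hφ j).mult_eq]
    refine Finset.sum_congr rfl fun ξ _ => ?_
    simp only [Matrix.cons_val_zero, Matrix.cons_val_succ, fourierCoef_eq]
    ring
  simp only [e]
  refine h.trans (le_of_eq ?_)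
  rw [sliceNorm, show (8 * 2 ^ j : ℝ) ^ 2 * B = (2 ^ j) ^ 2 * (64 * B : ℝ≥0) by push_cast; ring,
    ENNReal.ofReal_mul (by positivity), ENNReal.ofReal_coe_nnreal]

end Estimates

end MinimalSurface
end

noncomputable section

namespace MinimalSurface

open Filter Topology

/-! ### Calculus of slice norms -/

section SliceNorm

variable {U : Set ℝ} {f g : Field} {t : ℝ}

lemma sliceNorm_congr (h : Set.EqOn f g (slab U)) (ht : t ∈ U) (q : ℝ≥0∞) :
    sliceNorm q f t = sliceNorm q g t := by
  simp only [sliceNorm]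
  congr 1
  ext y
  exact h (by simpa using ht)

lemma sliceNorm_add_le (hf : ContPer U f) (hg : ContPer U g) (ht : t ∈ U) {q : ℝ≥0∞} (hq : 1 ≤ q) :
    sliceNorm q (fun x => f x + g x) t ≤ sliceNorm q f t + sliceNorm q g t :=
  eLpNorm_add_le (hf.slice_continuous ht).aestronglyMeasurable
    (hg.slice_continuous ht).aestronglyMeasurable hq

lemma sliceNorm_sub_le (hf : ContPer U f) (hg : ContPer U g) (ht : t ∈ U) {q : ℝ≥0∞} (hq : 1 ≤ q) :
    sliceNorm q (fun x => f x - g x) t ≤ sliceNorm q f t + sliceNorm q g t :=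
  eLpNorm_sub_le (hf.slice_continuous ht).aestronglyMeasurable
    (hg.slice_continuous ht).aestronglyMeasurable hq

lemma sliceNorm_sum_le {ι : Type*} {s : Finset ι} {f : ι → Field} (hf : ∀ i ∈ s, ContPer U (f i))
    (ht : t ∈ U) {q : ℝ≥0∞} (hq : 1 ≤ q) :
    sliceNorm q (fun x => ∑ i ∈ s, f i x) t ≤ ∑ i ∈ s, sliceNorm q (f i) t := by
  have := eLpNorm_sum_le (f := fun i y => f i (Matrix.vecCons t y)) (s := s)
    (fun i hi => ((hf i hi).slice_continuous ht).aestronglyMeasurable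
      (μ := volume.restrict unitCube)) hq
  refine le_trans (le_of_eq ?_) this
  rw [sliceNorm]
  congr 1
  ext y
  simp

lemma sliceNorm_const_mul (c : ℂ) (f : Field) (t : ℝ) (q : ℝ≥0∞) :
    sliceNorm q (fun x => c * f x) t = ‖c‖ₑ * sliceNorm q f t :=
  eLpNorm_const_smul c (fun y => f (Matrix.vecCons t y)) q _

/-- Hölder's inequality on time slices. -/
lemma sliceNorm_mul_le (hf : ContPer U f) (hg : ContPer U g) (ht : t ∈ U) (p q r : ℝ≥0∞)
    [ENNReal.HolderTriple p q r] :
    sliceNorm r (fun x => f x * g x) t ≤ sliceNorm p f t * sliceNorm q g t := by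
  have h := eLpNorm_smul_le_mul_eLpNorm (p := p) (q := q) (r := r) (μ := volume.restrict unitCube)
    (hg.slice_continuous ht).aestronglyMeasurable (hf.slice_continuous ht).aestronglyMeasurable
  simpa only [sliceNorm, smul_eq_mul, Pi.mul_def] using h

/-- 5/12 + 1/4 = 2/3, for a source times a factor k, before Bernstein is applied. -/
instance : ENNReal.HolderTriple (ENNReal.ofReal (12 / 5)) 4 (ENNReal.ofReal (3 / 2)) where
  inv_add_inv_eq_inv := by
    rw [← ENNReal.ofReal_ofNat 4, ← ENNReal.ofReal_inv_of_pos (by norm_num),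
      ← ENNReal.ofReal_inv_of_pos (by norm_num), ← ENNReal.ofReal_inv_of_pos (by norm_num),
      ← ENNReal.ofReal_add (by norm_num) (by norm_num)]
    norm_num

/-- 1/6 + 1/4 = 5/12, for the source itself: a coefficient g·∂g or ω times k. -/
instance : ENNReal.HolderTriple 6 4 (ENNReal.ofReal (12 / 5)) where
  inv_add_inv_eq_inv := by
    rw [← ENNReal.ofReal_ofNat 4, ← ENNReal.ofReal_ofNat 6,
      ← ENNReal.ofReal_inv_of_pos (by norm_num),
      ← ENNReal.ofReal_inv_of_pos (by norm_num), ← ENNReal.ofReal_inv_of_pos (by norm_num),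
      ← ENNReal.ofReal_add (by norm_num) (by norm_num)]
    norm_num

lemma HasKernel.sliceNorm_mult_le {σ : Freq → ℂ} {B : ℝ≥0∞} (h : HasKernel σ B)
    (hf : AbsFourier f t) {q : ℝ≥0∞} (hq : 1 ≤ q) :
    sliceNorm q (mult σ f) t ≤ B * sliceNorm q f t := by
  rcases eq_or_ne q ⊤ with rfl | hqt
  · exact h.sliceNorm_top_le hf
  · have := h.sliceNorm_le hf (q := q.toReal) (by
      rw [← ENNReal.toReal_one]; exact ENNReal.toReal_mono hqt hq)
    rwa [ENNReal.ofReal_toReal hqt] at this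

/-- Slice norms are measurable functions of time. -/
lemma ContPer.aemeasurable_sliceNorm_top (hf : ContPer U f) (hU : IsOpen U) {I : Set ℝ}
    (hIU : I ⊆ U) : AEMeasurable (sliceNorm ⊤ f) (volume.restrict I) := by
  refine AEMeasurable.mono_measure ?_ (Measure.restrict_mono_set _ hIU)
  refine aemeasurable_restrict_of_measurable_subtype hU.measurableSet ?_
  refine measurable_of_Ioi fun c => IsOpen.measurableSet ?_
  -- For continuous periodic slices the essential supremum is a pointwise supremum of functions
  -- continuous in t, hence lower semicontinuous.
  have hle (t : U) : sliceNorm ⊤ f t ≤ c ↔ ∀ y, ‖f (Matrix.vecCons t y)‖ₑ ≤ c := by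
    refine ⟨fun h y => ((hf.slice_periodic t.2).enorm_le_eLpNorm_top
      (hf.slice_continuous t.2) y).trans h, fun h => ?_⟩
    rw [sliceNorm, eLpNorm_exponent_top]
    exact essSup_le_of_ae_le _ (.of_forall h)
  have e : (fun t : U => sliceNorm ⊤ f t) ⁻¹' Set.Ioi c =
      ⋃ y : Space, {t : U | c < ‖f (Matrix.vecCons t y)‖ₑ} := by
    ext t
    simp only [Set.mem_preimage, Set.mem_Ioi, Set.mem_iUnion, Set.mem_ofPred_eq]
    rw [← not_le, hle t]
    push Not
    rfl
  rw [e]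
  refine isOpen_iUnion fun y => isOpen_lt continuous_const (Continuous.enorm ?_)
  refine hf.continuousOn_prod.comp_continuous (f := fun t : U => ((t : ℝ), y)) (by fun_prop)
    fun t => ⟨t.2, Set.mem_univ _⟩

lemma ContPer.aemeasurable_sliceNorm (hf : ContPer U f) (hU : IsOpen U) {I : Set ℝ}
    (hIU : I ⊆ U) (q : ℝ≥0∞) : AEMeasurable (sliceNorm q f) (volume.restrict I) := by
  rcases eq_or_ne q ⊤ with rfl | hqt
  · exact hf.aemeasurable_sliceNorm_top hU hIU
  rcases eq_or_ne q 0 with rfl | hq0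
  · have : sliceNorm 0 f = fun _ => 0 := funext fun t => by simp [sliceNorm]
    rw [this]
    exact aemeasurable_const
  refine AEMeasurable.mono_measure ?_ (Measure.restrict_mono_set _ hIU)
  have e : sliceNorm q f = fun t => (∫⁻ y in unitCube,
      ‖f (Matrix.vecCons t y)‖ₑ ^ q.toReal) ^ (1 / q.toReal) := funext fun t =>
    eLpNorm_eq_lintegral_rpow_enorm_toReal hq0 hqt
  rw [e]
  refine AEMeasurable.pow_const ?_ _
  have h1 : AEMeasurable (fun p : ℝ × Space => f (Matrix.vecCons p.1 p.2))
      ((volume.restrict U).prod (volume.restrict unitCube)) := by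
    rw [Measure.prod_restrict]
    exact (hf.continuousOn_prod.mono (Set.prod_mono_right (Set.subset_univ _))).aemeasurable
      (hU.measurableSet.prod measurableSet_Icc)
  exact (h1.enorm.pow_const _).lintegral_prod_right'

end SliceNorm

/-! ### Littlewood--Paley estimates on time slices -/

section Estimates

variable {φ : ℝ → ℝ}

lemma mult_comm {U : Set ℝ} (hU : IsOpen U) {f : Field} (hf : SmoothPer U f) {σ τ : Freq → ℂ}
    (hσ : ModerateSymbol σ) (hτ : ModerateSymbol τ) :
    Set.EqOn (mult σ (mult τ f)) (mult τ (mult σ f)) (slab U) := fun x hx => by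
  rw [mult_mult hU hf hτ σ hx, mult_mult hU hf hσ τ hx]
  simp only [mul_comm]

lemma exists_gradInv_le (hφ : IsCutoff φ) : ∃ C : ℝ≥0, ∀ (U : Set ℝ), IsOpen U → ∀ f : Field,
    SmoothPer U f → ∀ t ∈ U, ∀ (j j' : ℕ) (i : Fin 3) (q : ℝ≥0∞), 1 ≤ q →
      sliceNorm q (LP φ j (mult (gradInv i j') f)) t ≤
        ENNReal.ofReal ((2 ^ j')⁻¹) * C * sliceNorm q (LP φ j f) t := by
  choose B hB using fun i => (isAnnular_gradInvSymbol i).exists_hasKernel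
  refine ⟨∑ i, B i, fun U hU f hf t ht j j' i q hq => ?_⟩
  rw [LP, sliceNorm_congr (mult_comm hU hf (finiteSymbol_lpSymbol hφ j).moderate
    (finiteSymbol_gradInv i j').moderate) ht]
  refine ((hB i (-1) j').sliceNorm_mult_le ((SmoothPer.LP hφ hU hf j).absFourier hU ht)
    hq).trans ?_
  rw [zpow_neg_one]
  gcongr
  exact Finset.single_le_sum (fun _ _ => zero_le) (Finset.mem_univ i)

lemma exists_LP_le (hφ : IsCutoff φ) : ∃ C : ℝ≥0, ∀ (U : Set ℝ), IsOpen U → ∀ f : Field,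
    SmoothPer U f → ∀ t ∈ U, ∀ (j : ℕ) (q : ℝ≥0∞), 1 ≤ q →
      sliceNorm q (LP φ j f) t ≤ C * sliceNorm q f t := by
  obtain ⟨B, hB⟩ := exists_hasKernel_lpSymbol hφ
  exact ⟨B, fun U hU f hf t ht j q hq => (hB j).sliceNorm_mult_le (hf.absFourier hU ht) hq⟩

lemma exists_LP_pd_le (hφ : IsCutoff φ) : ∃ C : ℝ≥0, ∀ (U : Set ℝ), IsOpen U → ∀ f : Field,
    SmoothPer U f → ∀ t ∈ U, ∀ (j : ℕ) (a : Fin 3) (q : ℝ≥0∞), 1 ≤ q →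
      sliceNorm q (LP φ j (pd a.succ f)) t ≤ ENNReal.ofReal (2 ^ j) * C * sliceNorm q f t := by
  obtain ⟨B, hB⟩ := exists_hasKernel_lpSymbol_deriv hφ
  refine ⟨B, fun U hU f hf t ht j a q hq => ?_⟩
  rw [LP, sliceNorm_congr (fun x hx => mult_pd_succ hU hf _ a hx) ht]
  exact (hB j a).sliceNorm_mult_le (hf.absFourier hU ht) hq

lemma moderate_bracket {s : ℝ} (hs : s ≤ 2) :
    ModerateSymbol fun ξ => (((1 + ‖ξ‖ ^ 2) ^ (s / 2) : ℝ) : ℂ) := by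
  refine ⟨1, fun ξ => ?_⟩
  have h : 1 ≤ 1 + ‖latticePoint ξ‖ ^ 2 := by nlinarith [sq_nonneg ‖latticePoint ξ‖]
  rw [Complex.norm_real, Real.norm_of_nonneg (by positivity), one_mul]
  simpa [japSq] using Real.rpow_le_rpow_of_exponent_le h (show s / 2 ≤ 1 by linarith)

/-- P_j f = (P_j⟨D⟩^{-s})⟨D⟩^s f, and the kernel of P_j⟨D⟩^{-s} has mass of order 2^{-sj}. -/
lemma exists_LP_le_bracketPow (hφ : IsCutoff φ) {s : ℝ} (hs : s ≤ 2) : ∃ C : ℝ≥0,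
    ∀ (U : Set ℝ), IsOpen U → ∀ f : Field, SmoothPer U f → ∀ t ∈ U, ∀ (j : ℕ) (q : ℝ≥0∞), 1 ≤ q →
      sliceNorm q (LP φ j f) t ≤
        ENNReal.ofReal (2 ^ (-s * j)) * C * sliceNorm q (bracketPow s f) t := by
  obtain ⟨B, hB⟩ := exists_hasKernel_lpSymbol_bracket hφ s
  refine ⟨B, fun U hU f hf t ht j q hq => ?_⟩
  have e : Set.EqOn (LP φ j f) (mult (fun ξ => lpSymbol φ j ξ *
      (((1 + ‖ξ‖ ^ 2) ^ (-s / 2) : ℝ) : ℂ)) (bracketPow s f)) (slab U) := fun x hx => by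
    rw [bracketPow, mult_mult hU hf (moderate_bracket hs) _ hx, LP]
    refine congrFun (mult_congr_symbol (fun ξ => ?_) f) x
    have h : 0 < 1 + ‖ξ‖ ^ 2 := by positivity
    rw [mul_assoc, ← Complex.ofReal_mul, ← Real.rpow_add h]
    simp [neg_div]
  rw [sliceNorm_congr e ht]
  exact (hB j).sliceNorm_mult_le (hf.absFourier_mult hU (moderate_bracket hs) ht) hq

/-- The sum telescopes to φ(2^{-N}|ξ|), which is 1 at any fixed frequency once N is large. -/
lemma sum_lpSymbol (φ : ℝ → ℝ) (N : ℕ) (ξ : Freq) :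
    ∑ j ∈ Finset.range (N + 1), lpSymbol φ j ξ = lpProfile φ 0 (((2 : ℝ) ^ N)⁻¹ • ξ) := by
  have hn (j : ℕ) : ‖((2 : ℝ) ^ j)⁻¹ • ξ‖ = ‖ξ‖ / 2 ^ j := by
    rw [norm_smul, norm_inv, Real.norm_of_nonneg (by positivity), inv_mul_eq_div]
  induction N with
  | zero => simp [lpSymbol, lpProfile]
  | succ N ih =>
    rw [Finset.sum_range_succ, ih]
    have : 2 * ‖ξ‖ / 2 ^ (N + 1) = ‖ξ‖ / 2 ^ N := by rw [pow_succ]; field_simp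
    simp only [lpSymbol, lpProfile, if_true, hn, Nat.succ_ne_zero, if_false, this]
    push_cast
    ring

/-- Convergence of the Littlewood--Paley decomposition. -/
lemma tendsto_sum_LP (hφ : IsCutoff φ) {U : Set ℝ} (hU : IsOpen U) {f : Field}
    (hf : SmoothPer U f) {x : Spacetime} (hx : x ∈ slab U) :
    Tendsto (fun N => ∑ j ∈ Finset.range (N + 1), LP φ j f x) atTop (𝓝 (f x)) := by
  have hfin := finiteSymbol_lpSymbol hφ
  have e (N : ℕ) : ∑ j ∈ Finset.range (N + 1), LP φ j f x =
      mult (fun ξ => lpProfile φ 0 (((2 : ℝ) ^ N)⁻¹ • ξ)) f x := by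
    rw [← mult_congr_symbol (sum_lpSymbol φ N), FiniteSymbol.mult_sum_symbol fun j _ => hfin j]
    rfl
  obtain ⟨B, hB⟩ := HasKernel.exists_of_dilation (contDiff_lpProfile hφ 0)
    (fun ξ hξ => lpProfile_eq_zero hφ 0 hξ)
  have hs := (hf.absFourier hU (t := x 0) hx).summable
  simp only [e]
  rw [← mult_one hU hf hx]
  simp only [mult_eq_tsum]
  refine tendsto_tsum_of_dominated_convergence (bound := fun ξ => B * ‖fourierCoef f (x 0) ξ‖)
    (hs.norm.mul_left _) (fun ξ => ?_) (.of_forall fun N ξ => ?_)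
  · refine (Tendsto.mul_const _ (Tendsto.mul_const _ ?_))
    refine tendsto_const_nhds.congr' ?_
    filter_upwards [(tendsto_pow_atTop_atTop_of_one_lt (one_lt_two (α := ℝ))).eventually_ge_atTop
      ‖latticePoint ξ‖] with N hN
    have h2 : ‖((2 : ℝ) ^ N)⁻¹ • latticePoint ξ‖ ≤ 1 := by
      rw [norm_smul, norm_inv, Real.norm_of_nonneg (by positivity), inv_mul_eq_div]
      exact div_le_one_of_le₀ hN (by positivity)
    rw [lpProfile, if_pos rfl, hφ.eq_one _ (by linarith), Complex.ofReal_one]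
  · rw [norm_mul, norm_mul, norm_chr, mul_one]
    gcongr
    exact (hB _).norm_le ξ

/-- The dyadic pieces are bounded by a geometric series, convergent because s > 0, and Fatou's lemma
carries the bound to the limit. This avoids the kernel of the unlocalised ⟨D⟩^{-s}. -/
lemma exists_le_bracketPow (hφ : IsCutoff φ) {s : ℝ} (hs0 : 0 < s) (hs : s ≤ 2) : ∃ C : ℝ≥0,
    ∀ (U : Set ℝ), IsOpen U → ∀ f : Field, SmoothPer U f → ∀ t ∈ U, ∀ (q : ℝ≥0∞), 1 ≤ q →
      sliceNorm q f t ≤ C * sliceNorm q (bracketPow s f) t := by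
  obtain ⟨C, hC⟩ := exists_LP_le_bracketPow hφ hs
  have hsum : Summable fun j : ℕ => (2 : ℝ) ^ (-s * j) := by
    have : (fun j : ℕ => (2 : ℝ) ^ (-s * j)) = fun j : ℕ => ((2 : ℝ) ^ (-s)) ^ j := funext fun j => by
      rw [Real.rpow_mul zero_le_two, Real.rpow_natCast]
    rw [this]
    exact summable_geometric_of_lt_one (by positivity)
      (Real.rpow_lt_one_of_one_lt_of_neg one_lt_two (by linarith))
  refine ⟨(∑' j : ℕ, (2 : ℝ) ^ (-s * j)).toNNReal * C, fun U hU f hf t ht q hq => ?_⟩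
  have h1 (N : ℕ) : sliceNorm q (fun x => ∑ j ∈ Finset.range (N + 1), LP φ j f x) t ≤
      ((∑' j : ℕ, (2 : ℝ) ^ (-s * j)).toNNReal * C : ℝ≥0) * sliceNorm q (bracketPow s f) t := by
    refine (sliceNorm_sum_le (fun j _ => (SmoothPer.LP hφ hU hf j).contPer) ht hq).trans ?_
    calc ∑ j ∈ Finset.range (N + 1), sliceNorm q (LP φ j f) t
        ≤ ∑ j ∈ Finset.range (N + 1), ENNReal.ofReal (2 ^ (-s * j)) *
            (C * sliceNorm q (bracketPow s f) t) := Finset.sum_le_sum fun j _ => by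
          rw [← mul_assoc]
          exact hC U hU f hf t ht j q hq
      _ = ENNReal.ofReal (∑ j ∈ Finset.range (N + 1), 2 ^ (-s * j)) *
            (C * sliceNorm q (bracketPow s f) t) := by
          rw [← Finset.sum_mul, ENNReal.ofReal_sum_of_nonneg fun j _ => by positivity]
      _ ≤ _ := by
          rw [ENNReal.coe_mul, mul_assoc]
          gcongr
          exact ENNReal.ofReal_le_ofReal (hsum.sum_le_tsum _ fun j _ => by positivity)
  refine le_trans (Lp.eLpNorm_lim_le_liminf_eLpNorm (f := fun N y =>
    ∑ j ∈ Finset.range (N + 1), LP φ j f (Matrix.vecCons t y)) (fun N => ?_) _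
    (.of_forall fun y => tendsto_sum_LP hφ hU hf (by simpa using ht))) ?_
  · exact Continuous.aestronglyMeasurable (continuous_finsetSum _ fun j _ =>
      (SmoothPer.LP hφ hU hf j).contPer.slice_continuous ht)
  · exact (liminf_le_liminf (.of_forall h1)).trans (by rw [liminf_const])

end Estimates

end MinimalSurface
end

noncomputable section

namespace MinimalSurface

open Filter Topology

/-! ### Estimates for the null form at a fixed time -/

lemma sum_source_le {A B C D E F G H P : Type*} [Fintype A] [Fintype B] [Fintype C] [Fintype D]
    [Fintype E] [Fintype F] [Fintype G] [Fintype H] [Fintype P]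
    {n : (A × B × C × D × E × P) ⊕ (F × G × H × P) → ℝ≥0∞} {u : A → B → C → D → E → ℝ≥0∞}
    {w : F → G → H → ℝ≥0∞} {x : P → ℝ≥0∞}
    (h₁ : ∀ a b c d e p, n (.inl (a, b, c, d, e, p)) ≤ u a b c d e * x p)
    (h₂ : ∀ a b c p, n (.inr (a, b, c, p)) ≤ w a b c * x p) :
    ∑ s, n s ≤ (∑ a, ∑ b, ∑ c, ∑ d, ∑ e, u a b c d e + ∑ a, ∑ b, ∑ c, w a b c) * ∑ p, x p := by
  rw [Fintype.sum_sum_type, add_mul]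
  simp only [Fintype.sum_prod_type, Finset.sum_mul]
  refine add_le_add ?_ ?_
  · refine Finset.sum_le_sum fun a _ => Finset.sum_le_sum fun b _ => Finset.sum_le_sum fun c _ =>
      Finset.sum_le_sum fun d _ => Finset.sum_le_sum fun e _ => ?_
    rw [Finset.mul_sum]
    exact Finset.sum_le_sum fun p _ => h₁ a b c d e p
  · refine Finset.sum_le_sum fun a _ => Finset.sum_le_sum fun b _ => Finset.sum_le_sum fun c _ => ?_
    rw [Finset.mul_sum]
    exact Finset.sum_le_sum fun p _ => h₂ a b c p

lemma mult_sub {U : Set ℝ} (hU : IsOpen U) {f g : Field} (hf : SmoothPer U f) (hg : SmoothPer U g)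
    {σ : Freq → ℂ} (hσ : ModerateSymbol σ) {x : Spacetime} (hx : x ∈ slab U) :
    mult σ (fun x => f x - g x) x = mult σ f x - mult σ g x := by
  have := mult_sum hU (s := Finset.univ) (f := ![f, g]) ![1, -1]
    (fun i _ => by fin_cases i <;> assumption) hσ hx
  simpa [sub_eq_add_neg] using this

section

variable {φ : ℝ → ℝ} {U : Set ℝ} {f g : Field} {t : ℝ}

lemma sliceNorm_LP_add_le (hφ : IsCutoff φ) (hU : IsOpen U) (hf : SmoothPer U f)
    (hg : SmoothPer U g) (ht : t ∈ U) (j : ℕ) {q : ℝ≥0∞} (hq : 1 ≤ q) :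
    sliceNorm q (LP φ j fun x => f x + g x) t ≤
      sliceNorm q (LP φ j f) t + sliceNorm q (LP φ j g) t := by
  refine (sliceNorm_congr (g := fun x => LP φ j f x + LP φ j g x) (fun x hx => mult_add hU hf hg
    (finiteSymbol_lpSymbol hφ j).moderate hx) ht q).trans_le ?_
  exact sliceNorm_add_le (SmoothPer.LP hφ hU hf j).contPer (SmoothPer.LP hφ hU hg j).contPer ht hq

lemma sliceNorm_LP_sub_le (hφ : IsCutoff φ) (hU : IsOpen U) (hf : SmoothPer U f)
    (hg : SmoothPer U g) (ht : t ∈ U) (j : ℕ) {q : ℝ≥0∞} (hq : 1 ≤ q) :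
    sliceNorm q (LP φ j fun x => f x - g x) t ≤
      sliceNorm q (LP φ j f) t + sliceNorm q (LP φ j g) t := by
  refine (sliceNorm_congr (g := fun x => LP φ j f x - LP φ j g x) (fun x hx => mult_sub hU hf hg
    (finiteSymbol_lpSymbol hφ j).moderate hx) ht q).trans_le ?_
  exact sliceNorm_sub_le (SmoothPer.LP hφ hU hf j).contPer (SmoothPer.LP hφ hU hg j).contPer ht hq

end

namespace FramedImmersion

variable {d : ℕ} {U : Set ℝ} (M : FramedImmersion d U)

/-- The sum of a functional over the components of `k`. -/
def kSum (N : Field → ℝ≥0∞) : ℝ≥0∞ := ∑ p, N (M.kField p)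

lemma le_kSum (N : Field → ℝ≥0∞) (p : KIdx d) : N (M.kField p) ≤ M.kSum N :=
  Finset.single_le_sum (f := fun p => N (M.kField p)) (fun _ _ => zero_le) (Finset.mem_univ p)

lemma kSum_le {N N' : Field → ℝ≥0∞} {c : ℝ≥0∞} (h : ∀ p, N (M.kField p) ≤ c * N' (M.kField p)) :
    M.kSum N ≤ c * M.kSum N' := by
  rw [kSum, kSum, Finset.mul_sum]
  exact Finset.sum_le_sum fun p _ => h p

/-- `‖g·∂g‖_{L^q} + ‖ω‖_{L^q}` at time `t`. -/
def coefSlice (q : ℝ≥0∞) (t : ℝ) : ℝ≥0∞ :=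
  ∑ μ, ∑ ν, ∑ κ, ∑ l, ∑ ρ, sliceNorm q (M.gdgField μ ν κ l ρ) t +
    ∑ α, ∑ A, ∑ B, sliceNorm q (M.connField α A B) t

lemma sum_sourceField_le (hU : IsOpen U) {t : ℝ} (ht : t ∈ U) :
    ∑ s, sliceNorm (ENNReal.ofReal (12 / 5)) (M.sourceField s) t ≤
      M.coefSlice 6 t * M.kSum fun f => sliceNorm 4 f t :=
  sum_source_le (n := fun s => sliceNorm (ENNReal.ofReal (12 / 5)) (M.sourceField s) t)
    (fun μ ν κ l ρ p => sliceNorm_mul_le (M.smoothPer_gdgField hU μ ν κ l ρ).contPer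
      (M.smoothPer_kField hU p).contPer ht 6 4 _)
    (fun α A B p => sliceNorm_mul_le (M.smoothPer_connField hU α A B).contPer
      (M.smoothPer_kField hU p).contPer ht 6 4 _)

end FramedImmersion

section

variable {φ : ℝ → ℝ}

lemma exists_pot_le (hφ : IsCutoff φ) : ∃ C : ℝ≥0, ∀ (d : ℕ) (U : Set ℝ), IsOpen U →
    ∀ M : FramedImmersion d U, ∀ t ∈ U, ∀ (j' j : ℕ) (γ : Fin 4) (B : Fin d) (q : ℝ≥0∞), 1 ≤ q →
      sliceNorm q (M.pot φ j' j γ B) t ≤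
        ENNReal.ofReal ((2 ^ j')⁻¹) * C * M.kSum fun f => sliceNorm q (LP φ j f) t := by
  obtain ⟨C, hC⟩ := exists_gradInv_le hφ
  refine ⟨3 * C, fun d U hU M t ht j' j γ B q hq => ?_⟩
  refine (sliceNorm_sum_le (fun i _ => (M.smoothPer_potTerm hφ hU j' j γ B i).contPer) ht
    hq).trans ?_
  calc ∑ i, sliceNorm q (M.potTerm φ j' j γ B i) t
      ≤ ∑ i : Fin 3, ENNReal.ofReal ((2 ^ j')⁻¹) * C *
          M.kSum fun f => sliceNorm q (LP φ j f) t := Finset.sum_le_sum fun i _ => by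
        refine (hC U hU _ (M.smoothPer_kField hU (i.succ, γ, B)) t ht j j' i q hq).trans ?_
        gcongr
        exact M.le_kSum (fun f => sliceNorm q (LP φ j f) t) (i.succ, γ, B)
    _ = _ := by simp; ring

lemma sliceNorm_sum_const_mul_le {ι : Type*} [Fintype ι] {U : Set ℝ} {F : ι → Field}
    (hF : ∀ i, SmoothPer U (F i)) {c : ι → ℂ} {K : ℝ≥0} (hc : ∀ i, ‖c i‖₊ ≤ K) {t : ℝ}
    (ht : t ∈ U) {q : ℝ≥0∞} (hq : 1 ≤ q) :
    sliceNorm q (fun x => ∑ i, c i * F i x) t ≤ K * ∑ i, sliceNorm q (F i) t := by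
  refine (sliceNorm_sum_le (fun i _ => ((SmoothPer.const _).mul (hF i)).contPer) ht hq).trans ?_
  rw [Finset.mul_sum]
  refine Finset.sum_le_sum fun i _ => ?_
  rw [sliceNorm_const_mul]
  gcongr
  exact_mod_cast hc i

lemma nnnorm_codazziCoef_le {d : ℕ} (c α γ : Fin 4) (A : Fin d) (s : SIdx d) :
    ‖(codazziCoef c α γ A s : ℂ)‖₊ ≤ 50 := by
  rw [← NNReal.coe_le_coe, coe_nnnorm, Complex.norm_real, Real.norm_eq_abs]
  exact abs_codazziCoef_le c α γ A s

lemma exists_source_le (hφ : IsCutoff φ) : ∃ C : ℝ≥0, ∀ (d : ℕ) (U : Set ℝ), IsOpen U →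
    ∀ M : FramedImmersion d U, ∀ t ∈ U, ∀ (j : ℕ) (c α γ : Fin 4) (A : Fin d) (q : ℝ≥0∞), 1 ≤ q →
      sliceNorm q (fun x => ∑ s, (codazziCoef c α γ A s : ℂ) * LP φ j (M.sourceField s) x) t ≤
        C * ∑ s, sliceNorm q (M.sourceField s) t := by
  obtain ⟨C, hC⟩ := exists_LP_le hφ
  refine ⟨50 * C, fun d U hU M t ht j c α γ A q hq => ?_⟩
  refine (sliceNorm_sum_const_mul_le (fun s => SmoothPer.LP hφ hU (M.smoothPer_sourceField hU s) j)
    (nnnorm_codazziCoef_le c α γ A) ht hq).trans ?_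
  rw [ENNReal.coe_mul, mul_assoc, Finset.mul_sum _ _ (C : ℝ≥0∞)]
  gcongr with s
  exact hC U hU _ (M.smoothPer_sourceField hU s) t ht j q hq

lemma exists_potErr_le (hφ : IsCutoff φ) : ∃ C : ℝ≥0, ∀ (d : ℕ) (U : Set ℝ), IsOpen U →
    ∀ M : FramedImmersion d U, ∀ t ∈ U, ∀ (j' j : ℕ) (α γ : Fin 4) (B : Fin d) (q : ℝ≥0∞), 1 ≤ q →
      sliceNorm q (M.potErr φ j' j α γ B) t ≤
        ENNReal.ofReal ((2 ^ j')⁻¹) * C * ∑ s, sliceNorm q (M.sourceField s) t := by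
  obtain ⟨C₁, hC₁⟩ := exists_gradInv_le hφ
  obtain ⟨C₂, hC₂⟩ := exists_LP_le hφ
  -- 150 = 3 · 50: three directions i, with coefficients bounded by 50.
  refine ⟨150 * (C₁ * C₂), fun d U hU M t ht j' j α γ B q hq => ?_⟩
  refine (sliceNorm_sum_le (fun i _ => (SmoothPer.sum fun s _ => (SmoothPer.const _).mul
    (M.smoothPer_errTerm hφ hU j' j i s)).contPer) ht hq).trans ?_
  have h (i : Fin 3) (s : SIdx d) : sliceNorm q (M.errTerm φ j' j i s) t ≤
      ENNReal.ofReal ((2 ^ j')⁻¹) * (C₁ * C₂) * sliceNorm q (M.sourceField s) t := by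
    refine (hC₁ U hU _ (M.smoothPer_sourceField hU s) t ht j j' i q hq).trans ?_
    rw [← mul_assoc, mul_assoc _ (C₂ : ℝ≥0∞)]
    gcongr
    exact hC₂ U hU _ (M.smoothPer_sourceField hU s) t ht j q hq
  calc ∑ i : Fin 3, sliceNorm q (fun x => ∑ s, (codazziCoef i.succ α γ B s : ℂ) *
        M.errTerm φ j' j i s x) t
      ≤ ∑ i : Fin 3, 50 * (ENNReal.ofReal ((2 ^ j')⁻¹) * (C₁ * C₂) *
          ∑ s, sliceNorm q (M.sourceField s) t) := Finset.sum_le_sum fun i _ => by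
        refine (sliceNorm_sum_const_mul_le (fun s => M.smoothPer_errTerm hφ hU j' j i s)
          (nnnorm_codazziCoef_le i.succ α γ B) ht hq).trans ?_
        rw [Finset.mul_sum _ _ (ENNReal.ofReal _ * _)]
        push_cast
        gcongr with s
        exact h i s
    _ = _ := by
      simp only [Finset.sum_const, Finset.card_univ, Fintype.card_fin, nsmul_eq_mul,
        ENNReal.coe_mul]
      push_cast
      ring

/-- `P_j k` in `L^q`, in terms of `⟨D⟩^s k`. -/
lemma exists_kSum_LP_le (hφ : IsCutoff φ) {s : ℝ} (hs0 : 0 < s) (hs : s ≤ 2) : ∃ C : ℝ≥0,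
    ∀ (d : ℕ) (U : Set ℝ), IsOpen U → ∀ M : FramedImmersion d U, ∀ t ∈ U, ∀ (j j' : ℕ),
      j' ≤ j + 2 → ∀ q : ℝ≥0∞, 1 ≤ q → M.kSum (fun f => sliceNorm q (LP φ j f) t) ≤
        ENNReal.ofReal (2 ^ (-s * j')) * C * M.kSum fun f => sliceNorm q (bracketPow s f) t := by
  obtain ⟨C, hC⟩ := exists_LP_le_bracketPow hφ hs
  -- 16 = 2^{2·2} absorbs 2^{s(j' − j)}, since s ≤ 2 and j' − j ≤ 2.
  refine ⟨16 * C, fun d U hU M t ht j j' hj q hq => M.kSum_le fun p => ?_⟩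
  refine (hC U hU _ (M.smoothPer_kField hU p) t ht j q hq).trans ?_
  rw [ENNReal.coe_mul, ← mul_assoc (ENNReal.ofReal _)]
  gcongr
  calc ENNReal.ofReal (2 ^ (-s * j)) ≤ ENNReal.ofReal (2 ^ (-s * j') * 16) := by
        refine ENNReal.ofReal_le_ofReal ?_
        rw [show (16 : ℝ) = 2 ^ (4 : ℝ) by norm_num, ← Real.rpow_add two_pos]
        refine Real.rpow_le_rpow_of_exponent_le one_le_two ?_
        have : (j' : ℝ) ≤ j + 2 := by exact_mod_cast hj
        nlinarith
    _ = _ := by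
        rw [ENNReal.ofReal_mul (by positivity)]
        norm_num

/-- The expression `u_a v_b - v_a u_b`, `u = P_{j₁} k^B_{·γ}`, `v = P_{j₂} k^A_{·δ}`. -/
def FramedImmersion.nullForm {d : ℕ} {U : Set ℝ} (M : FramedImmersion d U) (φ : ℝ → ℝ)
    (j₁ j₂ : ℕ) (A B : Fin d) (a b γ δ : Fin 4) : Field := fun x =>
  M.projK φ j₁ a γ B x * M.projK φ j₂ b δ A x - M.projK φ j₂ a δ A x * M.projK φ j₁ b γ B x

lemma FramedImmersion.smoothPer_nullForm (hφ : IsCutoff φ) {d : ℕ} {U : Set ℝ} (hU : IsOpen U)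
    (M : FramedImmersion d U) (j₁ j₂ : ℕ) (A B : Fin d) (a b γ δ : Fin 4) :
    SmoothPer U (M.nullForm φ j₁ j₂ A B a b γ δ) :=
  ((M.smoothPer_projK hφ hU _ _ _ _).mul (M.smoothPer_projK hφ hU _ _ _ _)).sub
    ((M.smoothPer_projK hφ hU _ _ _ _).mul (M.smoothPer_projK hφ hU _ _ _ _))

/-- The bound for the low frequencies of the null form at a fixed time. -/
lemma exists_nullForm_le (hφ : IsCutoff φ) {s : ℝ} (hs0 : 0 < s) (hs : s ≤ 2) : ∃ C : ℝ≥0,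
    ∀ (d : ℕ) (U : Set ℝ), IsOpen U → ∀ M : FramedImmersion d U, ∀ t ∈ U, ∀ (a b : Fin 3)
      (γ δ : Fin 4) (A B : Fin d) (j j' j₁ j₂ : ℕ), 1 ≤ j₁ → j₁ ≤ j' + 2 → j' ≤ j₁ + 2 →
      j' ≤ j₂ + 2 → sliceNorm ⊤ (LP φ j (M.nullForm φ j₁ j₂ A B a.succ b.succ γ δ)) t ≤
        C * (ENNReal.ofReal (2 ^ j) * ENNReal.ofReal ((2 ^ j')⁻¹) *
          (M.kSum (fun f => sliceNorm ⊤ (LP φ j₁ f) t) *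
            M.kSum fun f => sliceNorm ⊤ (LP φ j₂ f) t) +
          ENNReal.ofReal ((2 ^ j) ^ 2) * ENNReal.ofReal ((2 ^ j')⁻¹) *
            ENNReal.ofReal (2 ^ (-s * j')) *
            (M.coefSlice 6 t * (M.kSum fun f => sliceNorm 4 (bracketPow s f) t) ^ 2)) := by
  obtain ⟨C₁, h₁⟩ := exists_pot_le hφ
  obtain ⟨C₂, h₂⟩ := exists_source_le hφ
  obtain ⟨C₃, h₃⟩ := exists_potErr_le hφ
  obtain ⟨C₄, h₄⟩ := exists_kSum_LP_le hφ hs0 hs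
  obtain ⟨C₅, h₅⟩ := exists_le_bracketPow hφ hs0 hs
  obtain ⟨C₆, h₆⟩ := exists_LP_pd_le hφ
  obtain ⟨C₇, h₇⟩ := exists_bernstein hφ
  refine ⟨2 * (C₆ * C₁) + C₇ * C₅ * C₄ * (C₂ * C₁ + 2 * C₃),
    fun d U hU M t ht a b γ δ A B j j' j₁ j₂ hj₁ hj₂ hj₃ hj₄ => ?_⟩
  have sΦ := M.smoothPer_pot hφ hU j' j₁ γ B
  have sv (b : Fin 3) := M.smoothPer_projK hφ hU j₂ b.succ δ A
  have sE (a : Fin 3) := M.smoothPer_potErr hφ hU j' j₁ a.succ γ B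
  have sS : SmoothPer U fun x => ∑ s, (codazziCoef b.succ a.succ δ A s : ℂ) *
      LP φ j₂ (M.sourceField s) x := SmoothPer.sum fun s _ =>
    (SmoothPer.const _).mul (SmoothPer.LP hφ hU (M.smoothPer_sourceField hU s) j₂)
  have q4 : (1 : ℝ≥0∞) ≤ 4 := by norm_num
  have q12 : 1 ≤ ENNReal.ofReal (12 / 5) := by
    rw [← ENNReal.ofReal_one]; exact ENNReal.ofReal_le_ofReal (by norm_num)
  set X := M.kSum fun f => sliceNorm 4 (bracketPow s f) t
  set G := M.coefSlice 6 t
  set K₁ := M.kSum (fun f => sliceNorm ⊤ (LP φ j₁ f) t)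
  set K₂ := M.kSum (fun f => sliceNorm ⊤ (LP φ j₂ f) t)
  set r := ENNReal.ofReal ((2 ^ j')⁻¹)
  set ρ := ENNReal.ofReal (2 ^ (-s * j'))
  have hsrc : ∑ s, sliceNorm (ENNReal.ofReal (12 / 5)) (M.sourceField s) t ≤ G * (C₅ * X) :=
    (M.sum_sourceField_le hU ht).trans (by
      gcongr
      exact M.kSum_le fun p => h₅ U hU _ (M.smoothPer_kField hU p) t ht 4 q4)
  -- Divergence terms: P_j∂_a costs 2^j, the potential gains 2^{-j'}, and both factors are taken in
  -- L^∞.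
  have main (a b : Fin 3) : sliceNorm ⊤ (LP φ j (pd a.succ fun x =>
      M.pot φ j' j₁ γ B x * M.projK φ j₂ b.succ δ A x)) t ≤
      ENNReal.ofReal (2 ^ j) * C₆ * (r * C₁ * K₁ * K₂) := by
    refine (h₆ U hU _ (sΦ.mul (sv b)) t ht j a ⊤ le_top).trans ?_
    gcongr
    refine (sliceNorm_mul_le sΦ.contPer (sv b).contPer ht ⊤ ⊤ ⊤).trans ?_
    exact mul_le_mul' (h₁ d U hU M t ht j' j₁ γ B ⊤ le_top)
      (M.le_kSum (fun f => sliceNorm ⊤ (LP φ j₂ f) t) (b.succ, δ, A))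
  -- Bernstein from L^{3/2}, then the source in L^{12/5} and the potential in L⁴. The potential
  -- supplies both gains, 2^{-j'} from the inverse gradient and 2^{-sj'} from ⟨D⟩^s k.
  have src : sliceNorm ⊤ (LP φ j fun x => (∑ s, (codazziCoef b.succ a.succ δ A s : ℂ) *
      LP φ j₂ (M.sourceField s) x) * M.pot φ j' j₁ γ B x) t ≤
      ENNReal.ofReal ((2 ^ j) ^ 2) * C₇ * ((C₂ * (G * (C₅ * X))) * (r * C₁ * (ρ * C₄ * X))) := by
    refine (h₇ j _ t ((sS.mul sΦ).contPer.slice_continuous ht)).trans ?_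
    gcongr
    refine (sliceNorm_mul_le sS.contPer sΦ.contPer ht (ENNReal.ofReal (12 / 5)) 4 _).trans ?_
    refine mul_le_mul' ((h₂ d U hU M t ht j₂ _ _ _ _ _ q12).trans (by gcongr))
      ((h₁ d U hU M t ht j' j₁ γ B 4 q4).trans ?_)
    gcongr
    exact h₄ d U hU M t ht j₁ j' hj₃ 4 q4
  -- The same exponents, with the gain 2^{-j'} now on the source factor and 2^{-sj'} on the
  -- projected k.
  have err (a b : Fin 3) : sliceNorm ⊤ (LP φ j fun x => M.potErr φ j' j₁ a.succ γ B x *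
      M.projK φ j₂ b.succ δ A x) t ≤
      ENNReal.ofReal ((2 ^ j) ^ 2) * C₇ * ((r * C₃ * (G * (C₅ * X))) * (ρ * C₄ * X)) := by
    refine (h₇ j _ t (((sE a).mul (sv b)).contPer.slice_continuous ht)).trans ?_
    gcongr
    refine (sliceNorm_mul_le (sE a).contPer (sv b).contPer ht (ENNReal.ofReal (12 / 5)) 4 _).trans ?_
    refine mul_le_mul' ((h₃ d U hU M t ht j' j₁ _ _ _ _ q12).trans (by gcongr))
      ((M.le_kSum (fun f => sliceNorm 4 (LP φ j₂ f) t) (b.succ, δ, A)).trans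
        (h₄ d U hU M t ht j₂ j' hj₄ 4 q4))
  have e : Set.EqOn (M.nullForm φ j₁ j₂ A B a.succ b.succ γ δ) (fun x =>
      pd a.succ (fun x => M.pot φ j' j₁ γ B x * M.projK φ j₂ b.succ δ A x) x -
      pd b.succ (fun x => M.pot φ j' j₁ γ B x * M.projK φ j₂ a.succ δ A x) x +
      (∑ s, (codazziCoef b.succ a.succ δ A s : ℂ) * LP φ j₂ (M.sourceField s) x) *
        M.pot φ j' j₁ γ B x +
      M.potErr φ j' j₁ a.succ γ B x * M.projK φ j₂ b.succ δ A x -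
      M.potErr φ j' j₁ b.succ γ B x * M.projK φ j₂ a.succ δ A x) (slab U) := fun x hx => by
    rw [FramedImmersion.nullForm, M.wedge_potential hφ hU hj₁ hj₂ hj₃ a.succ b.succ γ δ A B hx,
      mul_comm (M.pot φ j' j₁ γ B x) (∑ s, _)]
  have p₁ := (sΦ.mul (sv b)).pd hU a.succ
  have p₂ := (sΦ.mul (sv a)).pd hU b.succ
  have p₃ := sS.mul sΦ
  have p₄ := (sE a).mul (sv b)
  have p₅ := (sE b).mul (sv a)
  refine (sliceNorm_congr (mult_congr_on e (lpSymbol φ j)) ht ⊤).trans_le ?_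
  refine (sliceNorm_LP_sub_le hφ hU (((p₁.sub p₂).add p₃).add p₄) p₅ ht j le_top).trans ?_
  refine (add_le_add ((sliceNorm_LP_add_le hφ hU ((p₁.sub p₂).add p₃) p₄ ht j le_top).trans
    (add_le_add ((sliceNorm_LP_add_le hφ hU (p₁.sub p₂) p₃ ht j le_top).trans
    (add_le_add ((sliceNorm_LP_sub_le hφ hU p₁ p₂ ht j le_top).trans
    (add_le_add (main a b) (main b a))) src)) (err a b))) (err b a)).trans ?_
  generalize ENNReal.ofReal (2 ^ j) = u
  generalize ENNReal.ofReal ((2 ^ j) ^ 2) = w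
  push_cast
  calc _ = 2 * (C₆ * C₁) * (u * r * (K₁ * K₂)) +
        C₇ * C₅ * C₄ * (C₂ * C₁ + 2 * C₃) * (w * r * ρ * (G * X ^ 2)) := by ring
    _ ≤ _ := by
      refine le_trans (add_le_add ?_ ?_) (mul_add _ _ _).ge
      · gcongr
        exact le_self_add
      · gcongr
        exact le_add_self

end

end MinimalSurface
end

noncomputable section

namespace MinimalSurface

open Filter Topology

/-! ### Integration in time -/

section Holder

variable {ι κ : Type*} [Fintype ι] [Fintype κ] {μ : Measure ℝ} {u : ι → ℝ → ℝ≥0∞}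
  {v : κ → ℝ → ℝ≥0∞}

lemma lintegral_sum_mul_sum_le (hu : ∀ i, AEMeasurable (u i) μ) (hv : ∀ k, AEMeasurable (v k) μ) :
    ∫⁻ t, (∑ i, u i t) * ∑ k, v k t ∂μ ≤
      (∑ i, (∫⁻ t, u i t ^ (2 : ℝ) ∂μ) ^ (1 / (2 : ℝ))) *
        ∑ k, (∫⁻ t, v k t ^ (2 : ℝ) ∂μ) ^ (1 / (2 : ℝ)) := by
  have hm (i : ι) (k : κ) : AEMeasurable (fun t => u i t * v k t) μ := (hu i).mul (hv k)
  simp only [Finset.sum_mul_sum]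
  rw [lintegral_finsetSum' _ fun i _ => Finset.aemeasurable_fun_sum _ fun k _ => hm i k]
  refine Finset.sum_le_sum fun i _ => ?_
  rw [lintegral_finsetSum' _ fun k _ => hm i k]
  exact Finset.sum_le_sum fun k _ => ENNReal.lintegral_mul_le_Lp_mul_Lq μ
    (Real.holderConjugate_iff.mpr (by norm_num)) (hu i) (hv k)

/-- The square is a sum over pairs. Cauchy–Schwarz separates the coefficient, and Hölder with 1/2 =
1/4 + 1/4 splits each pair. -/
lemma lintegral_sum_mul_sum_sq_le (hu : ∀ i, AEMeasurable (u i) μ)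
    (hv : ∀ k, AEMeasurable (v k) μ) : ∫⁻ t, (∑ i, u i t) * (∑ k, v k t) ^ 2 ∂μ ≤
      (∑ i, (∫⁻ t, u i t ^ (2 : ℝ) ∂μ) ^ (1 / (2 : ℝ))) *
        (∑ k, (∫⁻ t, v k t ^ (4 : ℝ) ∂μ) ^ (1 / (4 : ℝ))) ^ 2 := by
  have h := lintegral_sum_mul_sum_le hu (v := fun (p : κ × κ) t => v p.1 t * v p.2 t)
    fun p => (hv p.1).mul (hv p.2)
  have hsq (x : κ → ℝ≥0∞) : (∑ k, x k) ^ 2 = ∑ p : κ × κ, x p.1 * x p.2 := by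
    rw [sq, Finset.sum_mul_sum, Fintype.sum_prod_type]
  simp only [hsq]
  refine h.trans ?_
  gcongr with p
  obtain ⟨k, l⟩ := p
  exact ENNReal.lintegral_Lp_mul_le_Lq_mul_Lr two_pos (by norm_num) (by norm_num) μ (hv k) (hv l)

end Holder

/-! ### Time-integrated norms of the fields of a framed immersion. -/

namespace FramedImmersion

variable {d : ℕ} {U : Set ℝ} (M : FramedImmersion d U)

/-- The components of `g·∂g` and `ω`. -/
def coefField : (Fin 4 × Fin 4 × Fin 4 × Fin 4 × Fin 4) ⊕ (Fin 4 × Fin d × Fin d) → Field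
  | .inl (μ, ν, κ, l, ρ) => M.gdgField μ ν κ l ρ
  | .inr (α, A, B) => M.connField α A B

lemma sum_coefField (N : Field → ℝ≥0∞) : ∑ i, N (M.coefField i) =
    ∑ μ, ∑ ν, ∑ κ, ∑ l, ∑ ρ, N (M.gdgField μ ν κ l ρ) + ∑ α, ∑ A, ∑ B, N (M.connField α A B) := by
  simp only [Fintype.sum_sum_type, Fintype.sum_prod_type, coefField]

lemma smoothPer_coefField (hU : IsOpen U) : ∀ i, SmoothPer U (M.coefField i)
  | .inl (μ, ν, κ, l, ρ) => M.smoothPer_gdgField hU μ ν κ l ρ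
  | .inr (α, A, B) => M.smoothPer_connField hU α A B

variable {φ : ℝ → ℝ}

lemma hhWedge_eq_add_nullForm (j₁ j₂ : ℕ) (A B : Fin d) (a b γ δ : Fin 4) :
    M.hhWedge φ j₁ j₂ A B a b γ δ = fun x =>
      M.nullForm φ j₁ j₂ A B a b γ δ x + M.nullForm φ j₂ j₁ A B a b γ δ x := by
  ext x
  simp only [hhWedge, wedge, nullForm]
  ring

lemma lintegral_kSum_mul_le (hφ : IsCutoff φ) (hU : IsOpen U) {I : Set ℝ} (hIU : I ⊆ U)
    (j₁ j₂ : ℕ) : ∫⁻ t in I, M.kSum (fun f => sliceNorm ⊤ (LP φ j₁ f) t) *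
      M.kSum (fun f => sliceNorm ⊤ (LP φ j₂ f) t) ≤
        M.projKNorm φ I 2 ⊤ j₁ * M.projKNorm φ I 2 ⊤ j₂ := by
  have hm (j : ℕ) (p : KIdx d) := (SmoothPer.LP hφ hU (M.smoothPer_kField hU p)
    j).contPer.aemeasurable_sliceNorm hU hIU ⊤
  have e (j : ℕ) : M.projKNorm φ I 2 ⊤ j = ∑ p, mixedNorm I 2 ⊤ (LP φ j (M.kField p)) := by
    simp only [projKNorm, projK, Fintype.sum_prod_type]
  rw [e, e]
  exact lintegral_sum_mul_sum_le (hm j₁) (hm j₂)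

lemma lintegral_coefSlice_mul_le (hU : IsOpen U) {I : Set ℝ} (hIU : I ⊆ U) {s : ℝ} (hs : s ≤ 2) :
    ∫⁻ t in I, M.coefSlice 6 t * (M.kSum fun f => sliceNorm 4 (bracketPow s f) t) ^ 2 ≤
      (M.gdgNorm I 2 6 + M.connNorm I 2 6) * M.kSobolevNorm I 4 s 4 ^ 2 := by
  have e1 : M.gdgNorm I 2 6 + M.connNorm I 2 6 = ∑ i, mixedNorm I 2 6 (M.coefField i) := by
    rw [M.sum_coefField]
    rfl
  have e2 : M.kSobolevNorm I 4 s 4 = ∑ p, mixedNorm I 4 4 (bracketPow s (M.kField p)) := by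
    simp only [kSobolevNorm, mixedSobolevNorm, Fintype.sum_prod_type]
  have e3 (t : ℝ) : M.coefSlice 6 t = ∑ i, sliceNorm 6 (M.coefField i) t := by
    rw [M.sum_coefField fun f => sliceNorm 6 f t]
    rfl
  simp only [e1, e2, e3]
  exact lintegral_sum_mul_sum_sq_le
    (fun i => (M.smoothPer_coefField hU i).contPer.aemeasurable_sliceNorm hU hIU 6)
    (fun p => (contPer_mult hU (M.smoothPer_kField hU p)
      (moderate_bracket hs)).aemeasurable_sliceNorm hU hIU 4)

end FramedImmersion

lemma exists_mixedNorm_hhWedge_le {φ : ℝ → ℝ} (hφ : IsCutoff φ) {δ₀ : ℝ} (h0 : 0 < δ₀)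
    (h1 : δ₀ ≤ 1) : ∃ C : ℝ≥0, ∀ (d : ℕ) (U I : Set ℝ), IsOpen U → MeasurableSet I → I ⊆ U →
      ∀ (M : FramedImmersion d U) (a b : Fin 3) (γ δ : Fin 4) (A B : Fin d) (j j' j'' : ℕ),
        1 ≤ j' → 1 ≤ j'' → j'' ≤ j' + 2 → j' ≤ j'' + 2 →
          mixedNorm I 1 ⊤ (LP φ j (M.hhWedge φ j' j'' A B a.succ b.succ γ δ)) ≤
            C * (ENNReal.ofReal ((2 : ℝ) ^ ((j : ℝ) - (1 - δ₀) * j')) *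
                  (M.projKNorm φ I 2 ⊤ j' * M.projKNorm φ I 2 ⊤ j'') +
                ENNReal.ofReal ((2 : ℝ) ^ (2 * (j : ℝ) - (1 + 2 * δ₀) * j')) *
                  ((M.gdgNorm I 2 6 + M.connNorm I 2 6) *
                    M.kSobolevNorm I 4 (2 * δ₀) 4 ^ 2)) := by
  obtain ⟨C, hC⟩ := exists_nullForm_le hφ (s := 2 * δ₀) (by linarith) (by linarith)
  refine ⟨2 * C, fun d U I hU hI hIU M a b γ δ A B j j' j'' hj' hj'' hjj hjj' => ?_⟩
  set D₁ := ENNReal.ofReal ((2 : ℝ) ^ ((j : ℝ) - (1 - δ₀) * j'))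
  set D₂ := ENNReal.ofReal ((2 : ℝ) ^ (2 * (j : ℝ) - (1 + 2 * δ₀) * j'))
  -- The argument yields 2^{j − j'}, which is at most the stated power because δ₀j' ≥ 0.
  have hD₁ : ENNReal.ofReal (2 ^ j) * ENNReal.ofReal ((2 ^ j')⁻¹) ≤ D₁ := by
    rw [← ENNReal.ofReal_mul (by positivity)]
    refine ENNReal.ofReal_le_ofReal ?_
    rw [← Real.rpow_natCast, ← Real.rpow_natCast, ← Real.rpow_neg zero_le_two,
      ← Real.rpow_add two_pos]
    refine Real.rpow_le_rpow_of_exponent_le one_le_two ?_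
    nlinarith [(Nat.cast_nonneg j' : (0 : ℝ) ≤ j')]
  have hD₂ : ENNReal.ofReal ((2 ^ j) ^ 2) * ENNReal.ofReal ((2 ^ j')⁻¹) *
      ENNReal.ofReal (2 ^ (-(2 * δ₀) * j')) = D₂ := by
    rw [← ENNReal.ofReal_mul (by positivity), ← ENNReal.ofReal_mul (by positivity), ← pow_mul,
      ← Real.rpow_natCast, ← Real.rpow_natCast, ← Real.rpow_neg zero_le_two,
      ← Real.rpow_add two_pos, ← Real.rpow_add two_pos]
    congr 2
    push_cast
    ring
  set K : ℕ → ℝ → ℝ≥0∞ := fun j t => M.kSum fun f => sliceNorm ⊤ (LP φ j f) t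
  set X : ℝ → ℝ≥0∞ := fun t => M.coefSlice 6 t *
    (M.kSum fun f => sliceNorm 4 (bracketPow (2 * δ₀) f) t) ^ 2
  have hK (j : ℕ) : AEMeasurable (K j) (volume.restrict I) :=
    Finset.aemeasurable_fun_sum _ fun p _ => (SmoothPer.LP hφ hU (M.smoothPer_kField hU p)
      j).contPer.aemeasurable_sliceNorm hU hIU ⊤
  have hKK : AEMeasurable (fun t => D₁ * (K j' t * K j'' t)) (volume.restrict I) :=
    ((hK j').mul (hK j'')).const_mul _
  have hslice (t : ℝ) (ht : t ∈ I) :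
      sliceNorm ⊤ (LP φ j (M.hhWedge φ j' j'' A B a.succ b.succ γ δ)) t ≤
        (2 * C : ℝ≥0) * (D₁ * (K j' t * K j'' t) + D₂ * X t) := by
    rw [M.hhWedge_eq_add_nullForm]
    refine (sliceNorm_LP_add_le hφ hU (M.smoothPer_nullForm hφ hU _ _ _ _ _ _ _ _)
      (M.smoothPer_nullForm hφ hU _ _ _ _ _ _ _ _) (hIU ht) j le_top).trans ?_
    -- Whichever factor receives the potential, the multipliers are normalised at 2^{j'}, so both
    -- null forms come with the same powers of 2.
    refine (add_le_add (hC d U hU M t (hIU ht) a b γ δ A B j j' j' j'' hj' (by omega) (by omega)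
      hjj') (hC d U hU M t (hIU ht) a b γ δ A B j j' j'' j' hj'' hjj hjj' (by omega))).trans ?_
    rw [hD₂]
    calc _ ≤ C * (D₁ * (K j' t * K j'' t) + D₂ * X t) +
          C * (D₁ * (K j'' t * K j' t) + D₂ * X t) := by gcongr
      _ = _ := by push_cast; ring
  simp only [mixedNorm, ENNReal.rpow_one, one_div_one]
  calc ∫⁻ t in I, sliceNorm ⊤ (LP φ j (M.hhWedge φ j' j'' A B a.succ b.succ γ δ)) t
      ≤ ∫⁻ t in I, (2 * C : ℝ≥0) * (D₁ * (K j' t * K j'' t) + D₂ * X t) :=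
        setLIntegral_mono' hI hslice
    _ = (2 * C : ℝ≥0) * (D₁ * ∫⁻ t in I, K j' t * K j'' t) + (2 * C : ℝ≥0) *
          (D₂ * ∫⁻ t in I, X t) := by
        rw [lintegral_const_mul' _ _ ENNReal.coe_ne_top,
          lintegral_add_left' hKK,
          lintegral_const_mul' _ _ ENNReal.ofReal_ne_top,
          lintegral_const_mul' _ _ ENNReal.ofReal_ne_top, mul_add]
    _ ≤ _ := by
        rw [← mul_add]
        gcongr
        · exact M.lintegral_kSum_mul_le hφ hU hIU j' j''
        · exact M.lintegral_coefSlice_mul_le hU hIU (by linarith)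

end MinimalSurface
end

/-! ### The theorem. -/

open MinimalSurface

theorem proposition6p4 (φ : ℝ → ℝ) (hφ : IsCutoff φ) :
    -- one derivative
    (∀ (d : ℕ) (a b : Fin 3) (γ δ : Fin 4) (A B : Fin d) (J : ℤ), -2 ≤ J → J ≤ 2 →
      ∃ S : OneDerivScheme d,
        ∀ (U : Set ℝ), IsOpen U → ∀ (M : FramedImmersion d U) (j' j'' : ℕ),
          2 < j' → (j'' : ℤ) = j' + J → ∀ x ∈ slab U,
            M.hhWedge φ j' j'' A B a.succ b.succ γ δ x = S.eval M φ j' j'' x) ∧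
    -- two derivatives, after contraction with `P_{j₃}(m(e)_{AB})`
    (∀ (d : ℕ) (a b : Fin 3) (γ δ : Fin 4) (J : ℤ), -2 ≤ J → J ≤ 2 →
      ∃ S : TwoDerivScheme d, (γ ≠ 0 → δ ≠ 0 → S.IsSpatial) ∧
        ∀ (U : Set ℝ), IsOpen U → ∀ (M : FramedImmersion d U) (j₃ j' j'' : ℕ),
          2 < j' → (j'' : ℤ) = j' + J → ∀ x ∈ slab U,
            ∑ A, ∑ B, LP φ j₃ (M.mField (A, B)) x *
                M.hhWedge φ j' j'' A B a.succ b.succ γ δ x =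
              S.eval M φ j₃ j' j'' x) ∧
    -- the improved `L¹L^∞` bound
    (∀ s δ₀ : ℝ, 5 / 2 + 1 / 6 < s → 0 < δ₀ →
      δ₀ < min ((s - 5 / 2 - 1 / 6) / 10) (1 / 100) →
      ∃ C : ℝ≥0, ∀ (d : ℕ) (U I : Set ℝ), IsOpen U → I.OrdConnected → I ⊆ U →
        ∀ (M : FramedImmersion d U) (a b : Fin 3) (γ δ : Fin 4) (A B : Fin d)
          (J : ℤ) (j j' j'' : ℕ), -2 ≤ J → J ≤ 2 → 2 < j' → (j'' : ℤ) = j' + J → j + 2 < j' →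
          mixedNorm I 1 ⊤ (LP φ j (M.hhWedge φ j' j'' A B a.succ b.succ γ δ)) ≤
            C * (ENNReal.ofReal ((2 : ℝ) ^ ((j : ℝ) - (1 - δ₀) * j')) *
                  (M.projKNorm φ I 2 ⊤ j' * M.projKNorm φ I 2 ⊤ j'') +
                ENNReal.ofReal ((2 : ℝ) ^ (2 * (j : ℝ) - (1 + 2 * δ₀) * j')) *
                  ((M.gdgNorm I 2 6 + M.connNorm I 2 6) *
                    M.kSobolevNorm I 4 (2 * δ₀) 4 ^ 2))) := by

  refine ⟨fun d a b γ δ A B J hJ₁ hJ₂ => ?_, fun d a b γ δ J hJ₁ hJ₂ => ?_, ?_⟩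
  · exact OneRep.hhWedge hφ hJ₁ hJ₂ a b γ δ A B
  -- A single scheme covers all γ, δ: the claim that its derivatives are spatial is carried as an
  -- implication from `sp`.
  · obtain ⟨S, hs, hS⟩ := TwoRep.contracted (sp := γ ≠ 0 ∧ δ ≠ 0) (d := d) hφ hJ₁ hJ₂ a b
      (γ := γ) (δ := δ) And.left And.right
    exact ⟨S, fun h h' => hs ⟨h, h'⟩, hS⟩
  · intro s δ₀ _ h0 h1
    obtain ⟨C, hC⟩ := exists_mixedNorm_hhWedge_le hφ h0
      (h1.le.trans ((min_le_right _ _).trans (by norm_num)))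
    exact ⟨C, fun d U I hU hI hIU M a b γ δ A B J j j' j'' hJ₁ hJ₂ hj' hj'' _ =>
      hC d U I hU hI.measurableSet hIU M a b γ δ A B j j' j'' (by omega) (by omega) (by omega)
        (by omega)⟩
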